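/- Let $\Gamma$ be a good resolution graph of a normal surface singularity with rational homology sphere link, i.e. a finite tree with vertex set $\mathcal V$ and integer decorations $e_i$ $(i\in\mathcal V)$ whose intersection form ($(E_i,E_i)=e_i$, $(E_i,E_j)=1$ if $ij$ is an edge, $0$ otherwise) on the lattice $L=\mathbb Z\langle E_i\rangle_{i\in\mathcal V}$ is negative definite. Let $L'=\{x\in L\otimes\mathbb Q: (x,L)\subset\mathbb Z\}$, $H=L'/L$, let $\mathcal S'=\{x\in L':(x,E_i)\le 0\ \forall i\}$ be the Lipman cone, and let $Z_K\in L'$ be given by $(Z_K,E_i)=e_i+2$ for all $i$. For $h\in H$ let $s_h$ be the smallest element of $\mathcal S'$ (for the coefficientwise order) in the class $h$, $k_h=-Z_K+2s_h$, and $\chi_h(l)=-\tfrac12(l,l+k_h)$ for $l\in L$. For $l\in L$ and $I\subset\mathcal V$ let $(l,I)\subset\mathbb R^{\mathcal V}$ be the cube with vertices $l+E_J$, $J\subset I$, where $E_J=\sum_{i\in J}E_i$; its weight $w_h((l,I))$ is the maximum of $\chi_h$ on its vertices. Let $S_n=S_n(w_h)$ be the union of the cubes of weight $\le n$ contained in $(\mathbb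 R_{\ge0})^{\mathcal V}$ $(n\in\mathbb Z)$. For $s\in\mathcal S'\setminus\{0\}$ put $\mathfrak X_{-d}=\bigcup\{(l,I): l\ge 0,\ (s,l)\le -d\}$. The increasing filtration $\{S_n\cap\mathfrak X_{-d}\}_d$ of the space $S_n$ filters its singular chain complex (with $\mathbb Z$ coefficients); let $(E^k_{-d,q})_n$, $1\le k\le\infty$, with differentials $d^k:(E^k_{-d,q})_n\to(E^k_{-d-k,q+k-1})_n$ for $k<\infty$, be the pages of its homological spectral sequence. In particular $(E^1_{-d,q})_n=H_{-d+q}(S_n\cap\mathfrak X_{-d},S_n\cap\mathfrak X_{-d-1};\mathbb Z)$. A blow-up $\psi$ of $\Gamma_2$ at a vertex $v$ (resp. at an edge $uv$) is the graph $\Gamma_1$ obtained by adding a new vertex with decoration $-1$ joined to $v$ (resp. to $u$ and $v$, with the edge $uv$ deleted), and lowering the decoration of $v$ (resp. of $u$ and $v$) by $1$; $\psi^*:L_2'\to L_1'$ keeps the coefficients at the old vertices, and the coefficient at the new vertex is that of $v$ (resp. the sum of those of $u$ and $v$). Let $\sim$ be the equivalence relation on triples $(\Gamma,s,h)$, with $s\in\mathcal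 S'\setminus\{0\}$ and $h\in H$, generated by $(\Gamma_1,s_1,h_1)\sim(\Gamma_2,s_2,h_2)$ whenever $\Gamma_1$ is a blow-up $\psi$ of $\Gamma_2$, $s_1=\psi^*s_2$ (the blow-up is at a non-base point) and $h_1=\psi^*h_2$. (a) The modules $(E^k_{-d,q})_n$ depend only on the class of $(\Gamma,s,h)$: if $(\Gamma,s,h)\sim(\Gamma',s',h')$ then for every $n\in\mathbb Z$ the two spectral sequences are isomorphic, i.e. there are isomorphisms between all entries of all pages $E^k$, $1\le k\le\infty$, which commute with the differentials $d^k$, $1\le k<\infty$, and such that the isomorphism on each later page is induced by the one on any earlier page. (b) Let $\overline{\mathcal V}\subset\mathcal V$ be an SR-set: for suitable integers $e_i'\le e_i$ $(i\in\overline{\mathcal V})$, replacing $e_i$ by $e_i'$ for $i\in\overline{\mathcal V}$ gives a rational graph (one with $-\frac12(l,l-Z_K)\ge1$ for all $0\ne l\in L$, $l\ge0$, computed in the new graph). For $\bar l\in\overline L=\mathbb Z\langle E_i\rangle_{i\in\overline{\mathcal V}}$ let $x_h(\bar l)\in L$ be the minimal element whose coefficients at the vertices of $\overline{\mathcal V}$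 are those of $\bar l$ and for which $(x_h(\bar l)+s_h,E_i)\le0$ for all $i\notin\overline{\mathcal V}$. Put $\overline w_h(\bar l)=\chi_h(x_h(\bar l))$, extend $\overline w_h$ to cubes by the maximum over the vertices, and define $S_n(\overline w_h)$ and $\overline{\mathfrak X}_{-d}=\bigcup\{(\bar l,I):\bar l\ge0,\ (s,\bar l)\le-d\}$ in $(\mathbb R_{\ge0})^{\overline{\mathcal V}}$ as before. If ${\rm Supp}(s)=\{i:(s,E_i)<0\}\subset\overline{\mathcal V}$, then for every $n\in\mathbb Z$ the spectral sequence of $\{S_n(w_h)\cap\mathfrak X_{-d}\}_d$ is isomorphic, in the sense of (a), to the spectral sequence of $\{S_n(\overline w_h)\cap\overline{\mathfrak X}_{-d}\}_d$. -/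

import Mathlib

open scoped Classical

noncomputable section

/-! ## The homological spectral sequence of a filtered chain complex -/

namespace FilteredLattice

open CategoryTheory

/-- A chain complex of modules with an increasing `ℤ`-filtration by subcomplexes. -/
structure FilteredComplex (R : Type) [CommRing R] where
  /-- the underlying chain complex -/
  C : ChainComplex (ModuleCat.{0} R) ℕ
  /-- `F p m` is the part of filtration level `≤ p` of the chain group `C_m` -/
  F : ℤ → ∀ m : ℕ, Submodule R (C.X m)
  mono : ∀ p p' m, p ≤ p' → F p m ≤ F p' m
  d_mem : ∀ p i j x, x ∈ F p i → (C.d i j).hom x ∈ F p j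

namespace FilteredComplex

variable {R : Type} [CommRing R] (K : FilteredComplex R)

/-- `F_{p-k} C_m`, with the convention `F_{p-∞} = 0`. -/
def lower (k : ℕ∞) (p : ℤ) (m : ℕ) : Submodule R (K.C.X m) :=
  if k = ⊤ then ⊥ else K.F (p - (k.toNat : ℤ)) m

/-- `F_{p+k} C_m`, with the convention `F_{p+∞} = C`. -/
def upper (k : ℕ∞) (p : ℤ) (m : ℕ) : Submodule R (K.C.X m) :=
  if k = ⊤ then ⊤ else K.F (p + (k.toNat : ℤ)) m

/-- `Z^k_p = {x ∈ F_p C_m : ∂x ∈ F_{p-k} C}` (so `Z^∞_p` consists of the cycles in `F_p`). -/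
def Z (k : ℕ∞) (p : ℤ) (m : ℕ) : Submodule R (K.C.X m) :=
  K.F p m ⊓ ⨅ j : ℕ, (K.lower k p j).comap (K.C.d m j).hom

/-- `B^k_p = F_p C_m ∩ ∂ (F_{p+k-1} C_{m+1})` (so `B^∞_p` consists of the boundaries in `F_p`). -/
def B (k : ℕ∞) (p : ℤ) (m : ℕ) : Submodule R (K.C.X m) :=
  K.F p m ⊓ (K.upper (k - 1) p (m + 1)).map (K.C.d (m + 1) m).hom

/-- The submodule `Z^{k-1}_{p-1} + B^k_p`, by which `Z^k_p` is divided. -/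
def denom (k : ℕ∞) (p : ℤ) (m : ℕ) : Submodule R (K.C.X m) :=
  K.Z (k - 1) (p - 1) m ⊔ K.B k p m

/-- The entry `E^k_{p,q} = Z^k_p / (Z^{k-1}_{p-1} + B^k_p)` of the `k`-th page (`1 ≤ k ≤ ∞`), where
`m = p + q` is the total degree; the entries of negative total degree are zero. -/
abbrev Page (k : ℕ∞) (p : ℤ) (m : ℕ) : Type :=
  ↥(K.Z k p m) ⧸ (K.denom k p m).submoduleOf (K.Z k p m)

/-- The class in `E^k_{p,q}` of an element of `Z^k_p`. -/
def cls (k : ℕ∞) (p : ℤ) (m : ℕ) : ↥(K.Z k p m) →ₗ[R] K.Page k p m :=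
  Submodule.mkQ _

theorem d_Z (k : ℕ) (p : ℤ) (m : ℕ) (x : K.C.X (m + 1)) (hx : x ∈ K.Z (k : ℕ∞) p (m + 1)) :
    (K.C.d (m + 1) m).hom x ∈ K.Z (k : ℕ∞) (p - k) m := by
  simp only [Z, lower, Submodule.mem_inf, Submodule.mem_iInf, Submodule.mem_comap,
    ENat.natCast_ne_top, if_false, ENat.toNat_natCast] at hx ⊢
  refine ⟨hx.2 m, fun j => ?_⟩
  have h0 : (K.C.d m j).hom ((K.C.d (m + 1) m).hom x) = 0 := by
    rw [← LinearMap.comp_apply, ← ModuleCat.hom_comp, HomologicalComplex.d_comp_d]; rfl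
  rw [h0]
  exact Submodule.zero_mem _

theorem d_denom (k : ℕ) (hk : 1 ≤ k) (p : ℤ) (m : ℕ) (x : K.C.X (m + 1))
    (hx : x ∈ K.denom (k : ℕ∞) p (m + 1)) :
    (K.C.d (m + 1) m).hom x ∈ K.denom (k : ℕ∞) (p - k) m := by
  obtain ⟨r, rfl⟩ : ∃ r, k = r + 1 := ⟨k - 1, by omega⟩
  have hr : (((r + 1 : ℕ) : ℕ∞) - 1) = (r : ℕ∞) := by
    rw [← ENat.natCast_one, ← ENat.natCast_sub]; rfl
  simp only [denom, B, hr] at hx ⊢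
  obtain ⟨y, hy, z, hz, rfl⟩ := Submodule.mem_sup.1 hx
  rw [map_add]
  have hz0 : (K.C.d (m + 1) m).hom z = 0 := by
    obtain ⟨w, -, rfl⟩ := hz.2
    rw [← LinearMap.comp_apply, ← ModuleCat.hom_comp, HomologicalComplex.d_comp_d]; rfl
  rw [hz0, add_zero]
  refine Submodule.mem_sup_right ⟨?_, y, ?_, rfl⟩
  · have h := (Submodule.mem_iInf _).1 hy.2 m
    simp only [lower, Submodule.mem_comap, ENat.natCast_ne_top, if_false, ENat.toNat_natCast] at h
    have e : p - 1 - (r : ℤ) = p - ((r + 1 : ℕ) : ℤ) := by push_cast; ring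
    exact e ▸ h
  · have e : p - ((r + 1 : ℕ) : ℤ) + (r : ℤ) = p - 1 := by push_cast; ring
    simp only [upper, ENat.natCast_ne_top, if_false, ENat.toNat_natCast, SetLike.mem_coe, e]
    exact hy.1

/-- The differential `d^k : E^k_{p,q} → E^k_{p-k,q+k-1}` (`1 ≤ k < ∞`), induced by `∂`. -/
def diff (k : ℕ) (hk : 1 ≤ k) (p : ℤ) (m : ℕ) :
    K.Page (k : ℕ∞) p (m + 1) →ₗ[R] K.Page (k : ℕ∞) (p - k) m :=
  Submodule.mapQ _ _
    ((K.C.d (m + 1) m).hom.restrict (fun x hx => K.d_Z k p m x hx))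
    (fun x hx => K.d_denom k hk p m x.1 hx)

end FilteredComplex

/-- An isomorphism between the spectral sequences (from the first page on) of two filtered
complexes: isomorphisms of all the entries of all pages `E^k`, `1 ≤ k ≤ ∞`, that commute with the
differentials, and such that the isomorphism on a later page is the one induced by the isomorphism
on an earlier page. -/
structure SpectralSequenceIso {R : Type} [CommRing R] (K K' : FilteredComplex R) where
  /-- the isomorphisms of the entries -/
  equiv : ∀ (k : ℕ∞), 1 ≤ k → ∀ (p : ℤ) (m : ℕ), K.Page k p m ≃ₗ[R] K'.Page k p m
  comm : ∀ (k : ℕ) (hk : 1 ≤ k) (hk' : 1 ≤ (k : ℕ∞)) (p : ℤ) (m : ℕ)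
    (x : K.Page (k : ℕ∞) p (m + 1)),
    equiv k hk' (p - k) m (K.diff k hk p m x) = K'.diff k hk p m (equiv k hk' p (m + 1) x)
  induced : ∀ (k k' : ℕ∞) (hk : 1 ≤ k) (hk' : 1 ≤ k'), k ≤ k' → ∀ (p : ℤ) (m : ℕ)
    (z : K.C.X m) (z' : K'.C.X m) (h₁ : z ∈ K.Z k p m) (h₂ : z ∈ K.Z k' p m)
    (h₁' : z' ∈ K'.Z k p m) (h₂' : z' ∈ K'.Z k' p m),
    equiv k hk p m (K.cls k p m ⟨z, h₁⟩) = K'.cls k p m ⟨z', h₁'⟩ →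
      equiv k' hk' p m (K.cls k' p m ⟨z, h₂⟩) = K'.cls k' p m ⟨z', h₂'⟩

/-! ## Filtered spaces and their singular chains -/

/-- The singular chain complex of a space with integral coefficients. -/
abbrev singularChains (Y : TopCat.{0}) : ChainComplex (ModuleCat.{0} ℤ) ℕ :=
  ((AlgebraicTopology.singularChainComplexFunctor (ModuleCat.{0} ℤ)).obj
    (ModuleCat.of ℤ ℤ)).obj Y

/-- The chain map induced by a continuous map. -/
abbrev singularChainsMap {Y Y' : TopCat.{0}} (f : Y ⟶ Y') : singularChains Y ⟶ singularChains Y' :=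
  ((AlgebraicTopology.singularChainComplexFunctor (ModuleCat.{0} ℤ)).obj
    (ModuleCat.of ℤ ℤ)).map f

/-- The inclusion of a subspace. -/
abbrev subspaceIncl {Y : Type} [TopologicalSpace Y] (A : Set Y) : TopCat.of ↥A ⟶ TopCat.of Y :=
  TopCat.ofHom ⟨Subtype.val, continuous_subtype_val⟩

/-- The singular chains of `Y`, filtered by the (images of the) singular chains of the members of an
increasing family `A` of subspaces of `Y`. -/
def filteredSingularChains {Y : Type} [TopologicalSpace Y] (A : ℤ → Set Y) (hA : Monotone A) :
    FilteredComplex ℤ where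
  C := singularChains (TopCat.of Y)
  F p m := LinearMap.range ((singularChainsMap (subspaceIncl (A p))).f m).hom
  mono p p' m hp := by
    rintro _ ⟨x, rfl⟩
    let g : TopCat.of ↥(A p) ⟶ TopCat.of ↥(A p') :=
      TopCat.ofHom ⟨Set.inclusion (hA hp), continuous_inclusion (hA hp)⟩
    refine ⟨((singularChainsMap g).f m).hom x, ?_⟩
    have h : subspaceIncl (A p) = g ≫ subspaceIncl (A p') := rfl
    rw [h]
    simp only [Functor.map_comp, HomologicalComplex.comp_f]
    rfl
  d_mem p i j x hx := by
    obtain ⟨y, rfl⟩ := hx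
    refine ⟨((singularChains (TopCat.of ↥(A p))).d i j).hom y, ?_⟩
    rw [← LinearMap.comp_apply, ← LinearMap.comp_apply, ← ModuleCat.hom_comp,
      ← ModuleCat.hom_comp, HomologicalComplex.Hom.comm]

/-! ## Cubes, weights, and the spaces built from them -/

section Cubes

variable {W : Type}

/-- `E_J = ∑_{i ∈ J} E_i`. -/
def sumE (J : Finset W) : W → ℤ := fun i => if i ∈ J then 1 else 0

/-- The closed cube `(l, I)`, with vertices `l + E_J`, `J ⊆ I`. -/
def cube (l : W → ℤ) (I : Finset W) : Set (W → ℝ) :=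
  Set.Icc (fun i => (l i : ℝ)) (fun i => ((l + sumE I) i : ℝ))

/-- The weight of a cube: the maximum of the weights of its vertices. -/
def cubeWeight (w : (W → ℤ) → ℚ) (l : W → ℤ) (I : Finset W) : ℚ :=
  I.powerset.sup' ⟨∅, Finset.empty_mem_powerset I⟩ (fun J => w (l + sumE J))

/-- `S_n(w)` (in the first quadrant): the union of all cubes of weight at most `n` of the first
quadrant. -/
def sublevel (w : (W → ℤ) → ℚ) (n : ℤ) : Set (W → ℝ) :=
  ⋃ (l : W → ℤ) (I : Finset W) (_ : 0 ≤ l) (_ : cubeWeight w l I ≤ (n : ℚ)), cube l I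

/-- `𝔛_p = ⋃ {(l, I) : l ≥ 0, φ(l) ≤ p}`; it is used with `φ(l) = (s, l)` and `p = -d`. -/
def filtPart (φ : (W → ℤ) → ℚ) (p : ℤ) : Set (W → ℝ) :=
  ⋃ (l : W → ℤ) (I : Finset W) (_ : 0 ≤ l) (_ : φ l ≤ (p : ℚ)), cube l I

theorem filtPart_mono (φ : (W → ℤ) → ℚ) : Monotone (filtPart φ) := by
  intro p p' hp x hx
  simp only [filtPart, Set.mem_iUnion] at hx ⊢
  obtain ⟨l, I, hl, hφ, hx⟩ := hx
  exact ⟨l, I, hl, hφ.trans (by exact_mod_cast hp), hx⟩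

/-- The singular chains of `S_n(w)`, filtered by those of the subspaces `S_n(w) ∩ 𝔛_p`, `p ∈ ℤ`. -/
def latticeFilteredChains (w φ : (W → ℤ) → ℚ) (n : ℤ) : FilteredComplex ℤ :=
  filteredSingularChains (Y := ↥(sublevel w n)) (fun p => Subtype.val ⁻¹' filtPart φ p)
    (fun _ _ hp => Set.preimage_mono (filtPart_mono φ hp))

end Cubes

/-! ## Resolution graphs and their lattices -/

/-- A negative definite tree of rational vertices with Euler decorations `e`: the resolution
(plumbing) graph of a good resolution of a normal surface singularity whose link is a rational
homology sphere. -/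
structure ResolutionGraph (V : Type) [Fintype V] where
  /-- the underlying graph -/
  graph : SimpleGraph V
  isTree : graph.IsTree
  /-- the Euler decorations `e_i = (E_i, E_i)` -/
  e : V → ℤ
  negDef : ∀ l : V → ℤ, l ≠ 0 →
    l ⬝ᵥ (Matrix.of (fun i j => if i = j then e i else if graph.Adj i j then 1 else 0)).mulVec l < 0

namespace ResolutionGraph

variable {V : Type} [Fintype V] (Γ : ResolutionGraph V)

/-- The intersection matrix, with rational entries. -/
def form : Matrix V V ℚ :=
  Matrix.of fun i j => if i = j then (Γ.e i : ℚ) else if Γ.graph.Adj i j then 1 else 0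

/-- The intersection form on `L ⊗ ℚ`. -/
def pair (x y : V → ℚ) : ℚ := x ⬝ᵥ Γ.form.mulVec y

/-- The base element `E_i`. -/
def E (i : V) : V → ℚ := fun j => if j = i then 1 else 0

/-- The embedding `L → L ⊗ ℚ`. -/
def toQ (l : V → ℤ) : V → ℚ := fun i => (l i : ℚ)

/-- The lattice `L` inside `L ⊗ ℚ`. -/
def lattice (_ : ResolutionGraph V) : AddSubgroup (V → ℚ) where
  carrier := Set.range toQ
  zero_mem' := ⟨0, by ext; simp [toQ]⟩
  add_mem' := by
    rintro _ _ ⟨a, rfl⟩ ⟨b, rfl⟩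
    exact ⟨a + b, by ext; simp [toQ]⟩
  neg_mem' := by
    rintro _ ⟨a, rfl⟩
    exact ⟨-a, by ext; simp [toQ]⟩

/-- The dual lattice `L' = {x ∈ L ⊗ ℚ : (x, L) ⊆ ℤ}`. -/
def dualLattice : AddSubgroup (V → ℚ) where
  carrier := {x | ∀ l : V → ℤ, ∃ m : ℤ, Γ.pair x (toQ l) = m}
  zero_mem' := fun l => ⟨0, by simp [pair]⟩
  add_mem' := by
    intro a b ha hb l
    obtain ⟨m, hm⟩ := ha l
    obtain ⟨m', hm'⟩ := hb l
    refine ⟨m + m', ?_⟩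
    simp only [pair, add_dotProduct] at *
    rw [hm, hm']; push_cast; ring
  neg_mem' := by
    intro a ha l
    obtain ⟨m, hm⟩ := ha l
    refine ⟨-m, ?_⟩
    simp only [pair, neg_dotProduct] at *
    rw [hm]; push_cast; ring

/-- The group `H = L'/L`. -/
abbrev H : Type := ↥Γ.dualLattice ⧸ Γ.lattice.addSubgroupOf Γ.dualLattice

/-- The Lipman cone `𝒮' = {x ∈ L' : (x, E_i) ≤ 0 for all i}`. -/
def lipmanCone : Set (V → ℚ) := {x | x ∈ Γ.dualLattice ∧ ∀ i, Γ.pair x (E i) ≤ 0}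

/-- The set of elements of `L'` in the class `h`. -/
def classSet (h : Γ.H) : Set (V → ℚ) :=
  {x | ∃ hx : x ∈ Γ.dualLattice, (QuotientAddGroup.mk (⟨x, hx⟩ : Γ.dualLattice) : Γ.H) = h}

/-- `s_h`: the (unique) smallest element of the Lipman cone in the class `h`. -/
def sMin (h : Γ.H) : V → ℚ :=
  Classical.epsilon fun x => IsLeast (Γ.lipmanCone ∩ Γ.classSet h) x

/-- The anticanonical cycle `Z_K`, the solution of the adjunction formulae
`(Z_K, E_i) = (E_i, E_i) + 2`. -/
def ZK : V → ℚ := Γ.form⁻¹.mulVec fun i => (Γ.e i : ℚ) + 2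

/-- The distinguished characteristic element `k_h = -Z_K + 2 s_h`. -/
def kChar (h : Γ.H) : V → ℚ := -Γ.ZK + (2 : ℚ) • Γ.sMin h

/-- `χ_h(l) = -(l, l + k_h)/2`. -/
def chi (h : Γ.H) (l : V → ℤ) : ℚ := -(1 / 2) * Γ.pair (toQ l) (toQ l + Γ.kChar h)

/-- Artin's criterion: the graph is rational if `χ(l) = -(l, l - Z_K)/2 ≥ 1` for all `l > 0`. -/
def IsRational : Prop :=
  ∀ l : V → ℤ, 0 ≤ l → l ≠ 0 → 1 ≤ -(1 / 2) * Γ.pair (toQ l) (toQ l - Γ.ZK)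

/-- `B` is an SR-set: replacing the decorations of the vertices in `B` by suitable smaller or equal
ones one gets a rational graph. -/
def IsSRSet (B : Finset V) : Prop :=
  ∃ Γ' : ResolutionGraph V, Γ'.graph = Γ.graph ∧ (∀ i ∈ B, Γ'.e i ≤ Γ.e i) ∧
    (∀ i, i ∉ B → Γ'.e i = Γ.e i) ∧ Γ'.IsRational

/-- The `E^*`-support of `s`. -/
def supp (s : V → ℚ) : Set V := {i | Γ.pair s (E i) < 0}

/-- The filtered singular chains of `{S_n(w_h) ∩ 𝔛_{-d}}_d`, where `𝔛_{-d}` is defined by `s`;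
the filtration index is `p = -d`. -/
def filteredChains (s : V → ℚ) (h : Γ.H) (n : ℤ) : FilteredComplex ℤ :=
  latticeFilteredChains (Γ.chi h) (fun l => Γ.pair s (toQ l)) n

/-- The universal cycle `x_h(l̄)`: the minimal `x ∈ L` whose coefficients on `B` are those of `l̄`
and which satisfies `(x + s_h, E_i) ≤ 0` for all `i ∉ B`. -/
def xCycle (B : Finset V) (h : Γ.H) (l : ↥B → ℤ) : V → ℤ :=
  Classical.epsilon fun x => IsLeast {x : V → ℤ | (∀ i : ↥B, x i = l i) ∧
    ∀ i, i ∉ B → Γ.pair (toQ x + Γ.sMin h) (E i) ≤ 0} x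

/-- The reduced weight function `w̄_h(l̄) = χ_h(x_h(l̄))`. -/
def redWeight (B : Finset V) (h : Γ.H) (l : ↥B → ℤ) : ℚ := Γ.chi h (Γ.xCycle B h l)

/-- The embedding `L̄ → L`, extension by zero. -/
def extendZero (B : Finset V) (l : ↥B → ℤ) : V → ℤ :=
  fun i => if hi : i ∈ B then l ⟨i, hi⟩ else 0

/-- The filtered singular chains of `{S_n(w̄_h) ∩ 𝔛̄_{-d}}_d`. -/
def redFilteredChains (B : Finset V) (s : V → ℚ) (h : Γ.H) (n : ℤ) : FilteredComplex ℤ :=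
  latticeFilteredChains (Γ.redWeight B h) (fun l => Γ.pair s (toQ (extendZero B l))) n

end ResolutionGraph

/-! ## Blow-ups and the equivalence relation -/

/-- `Γ₁` is the blow-up of `Γ₂` at a vertex `v` (`c = {v}`) or at an edge `uv` (`c = {u, v}`):
`σ none` is the new vertex and `σ (some i)` the vertex of `Γ₁` that corresponds to `i`. -/
structure IsBlowUp {V₁ V₂ : Type} [Fintype V₁] [Fintype V₂] (Γ₁ : ResolutionGraph V₁)
    (Γ₂ : ResolutionGraph V₂) (σ : Option V₂ ≃ V₁) (c : Finset V₂) : Prop where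
  center : (∃ v, c = {v}) ∨ ∃ u v, Γ₂.graph.Adj u v ∧ c = {u, v}
  e_new : Γ₁.e (σ none) = -1
  e_old : ∀ i, Γ₁.e (σ (some i)) = if i ∈ c then Γ₂.e i - 1 else Γ₂.e i
  adj_new : ∀ i, Γ₁.graph.Adj (σ none) (σ (some i)) ↔ i ∈ c
  adj_old : ∀ i j, Γ₁.graph.Adj (σ (some i)) (σ (some j)) ↔
    Γ₂.graph.Adj i j ∧ ¬ (i ∈ c ∧ j ∈ c)

/-- The pullback `ψ^*` of rational cycles along the blow-up: `ψ^*(E_i)` is the strict transform of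
`E_i`, plus `E_new` if `i ∈ c`. -/
def pullback {V₁ V₂ : Type} (σ : Option V₂ ≃ V₁) (c : Finset V₂) (x : V₂ → ℚ) : V₁ → ℚ :=
  fun v => (σ.symm v).elim (∑ i ∈ c, x i) x

/-- A resolution graph with a nonzero element `s` of the Lipman cone and a class `h ∈ H = L'/L`. -/
structure DecoratedGraph where
  /-- the set of vertices -/
  V : Type
  /-- the set of vertices is finite -/
  fintypeV : Fintype V
  /-- the graph -/
  Γ : ResolutionGraph V
  /-- the semigroup element -/
  s : V → ℚ
  s_mem : s ∈ Γ.lipmanCone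
  s_ne : s ≠ 0
  /-- the class in `H` -/
  h : Γ.H

attribute [instance] DecoratedGraph.fintypeV

/-- The graph of `T₁` is a blow-up `ψ` of the graph of `T₂`, `s₁ = ψ^* s₂` (that is, `ψ` is a
non-base-point blow-up) and the classes correspond under `ψ^* : L₂'/L₂ → L₁'/L₁`. -/
def DecoratedGraph.Step (T₁ T₂ : DecoratedGraph) : Prop :=
  ∃ (σ : Option T₂.V ≃ T₁.V) (c : Finset T₂.V), IsBlowUp T₁.Γ T₂.Γ σ c ∧
    T₁.s = pullback σ c T₂.s ∧
    ∃ x : T₂.V → ℚ, x ∈ T₂.Γ.classSet T₂.h ∧ pullback σ c x ∈ T₁.Γ.classSet T₁.h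

/-- The equivalence relation generated by the non-base-point blow-ups. -/
def DecoratedGraph.Equivalent : DecoratedGraph → DecoratedGraph → Prop :=
  Relation.EqvGen DecoratedGraph.Step

end FilteredLattice

end

/-! Both statements come from one operation: removing from the weighted cubical complex a vertex `j`
with `(s, E_j) = 0`. The filtration does not see the coordinate at `j`, so it suffices that the
projection forgetting it is a homotopy equivalence through maps and homotopies that respect the
filtration. Such homotopies induce filtered chain homotopies, because the prism operator is natural
for inclusions of subspaces, and filtered homotopic maps agree on every page from the first one on.

The projection has a homotopy inverse as soon as three facts hold (`pageEquiv_eliminate`): over each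
lattice point the heights of weight at most `n` form an interval; projecting does not raise the
weight above `n`; and over each cube of the reduced sublevel set some single height works for all
vertices. The inverse is then a section at a continuously interpolated lowest height.

The facts are proved for the twisted Riemann–Roch function `f`, with `D` the set of eliminated
vertices and `χ ≥ 1` on nonzero effective cycles that are reduced outside `D` (`IsRationalOn`). The
universal cycle (`lift`) then minimizes `f` among cycles with given coordinates outside `D`:
generalized Laufer steps reach it from below, rationality gives nonincreasing steps from above, and
submodularity does the rest (`f_lift_le`). Monotone paths towards the universal cycle make the
sublevel sets intervals, and minimality controls the projection.

The common height is the deep point. Since the graph is a tree, the branches at `j` interact only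
through the coordinate at `j`, so the minima on slices are additive under exchange of branches.
Rationality bounds by one the effect of a branch on the slope, and makes the intervals of two
vertices that differ on one branch meet. A discrete minimax argument (`exists_common_of_exchange`)
yields a common point of all the intervals.

For (b) the complement of the SR-set is eliminated one vertex at a time. For (a) the new vertex of a
blow-up is eliminated: it is orthogonal to pullbacks, `χ` is at least one on the relevant cycles,
and the reduced weight is the weight of the original graph. -/

noncomputable section

namespace FilteredLattice
open CategoryTheory

/-! ## Filtered chain maps and the induced maps of pages -/

namespace FilteredComplex

variable {R : Type} [CommRing R] (K : FilteredComplex R)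

/-- Lowering the page and the filtration level together leaves `p - k` unchanged, so `Z^{k-1}_{p-1}`
and `Z^k_p` impose the same condition on the boundary. The bound `1 ≤ k` avoids truncated
subtraction, and `⊤ - 1 = ⊤` covers the last page. -/
theorem lower_shift {k : ℕ∞} (hk : 1 ≤ k) (p : ℤ) (m : ℕ) :
    K.lower (k - 1) (p - 1) m = K.lower k p m := by
  induction k using ENat.recTopCoe with
  | top => rfl
  | coe k =>
    have hk' : 1 ≤ k := by exact_mod_cast hk
    have h1 : ((k : ℕ∞) - 1) = ((k - 1 : ℕ) : ℕ∞) := by simp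
    have h2 : p - 1 - ((k - 1 : ℕ) : ℤ) = p - (k : ℤ) := by omega
    simp only [lower, h1, ENat.natCast_ne_top, if_false, ENat.toNat_natCast, h2]

theorem le_upper (k : ℕ∞) (p : ℤ) (m : ℕ) : K.F p m ≤ K.upper k p m := by
  unfold upper
  split_ifs
  · exact le_top
  · exact K.mono _ _ _ (by omega)

theorem upper_mono {k k' : ℕ∞} (h : k ≤ k') (p : ℤ) (m : ℕ) : K.upper k p m ≤ K.upper k' p m := by
  unfold upper
  split_ifs with h1 h2 h2
  · exact le_top
  · exact absurd (top_le_iff.1 (h1 ▸ h)) h2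
  · exact le_top
  · have := ENat.toNat_le_toNat h h2
    exact K.mono _ _ _ (by omega)

theorem lower_le {k : ℕ∞} (hk : 1 ≤ k) (p : ℤ) (m : ℕ) : K.lower k p m ≤ K.F (p - 1) m := by
  unfold lower
  split_ifs with h
  · exact bot_le
  · have := ENat.toNat_le_toNat hk h
    exact K.mono _ _ _ (by simp at this; omega)

theorem mem_Z {k : ℕ∞} {p : ℤ} {m : ℕ} {x : K.C.X m} :
    x ∈ K.Z k p m ↔ x ∈ K.F p m ∧ ∀ j, (K.C.d m j).hom x ∈ K.lower k p j := by
  simp [Z]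

theorem mem_B {k : ℕ∞} {p : ℤ} {m : ℕ} {x : K.C.X m} :
    x ∈ K.B k p m ↔ x ∈ K.F p m ∧ ∃ y ∈ K.upper (k - 1) p (m + 1), (K.C.d (m + 1) m).hom y = x := by
  simp [B]

theorem d_d_apply (i j l : ℕ) (x : K.C.X i) : (K.C.d j l).hom ((K.C.d i j).hom x) = 0 := by
  rw [← LinearMap.comp_apply, ← ModuleCat.hom_comp, HomologicalComplex.d_comp_d]; rfl

theorem B_mono {k k' : ℕ∞} (h : k ≤ k') (p : ℤ) (m : ℕ) : K.B k p m ≤ K.B k' p m := by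
  intro x hx
  obtain ⟨hx, y, hy, rfl⟩ := K.mem_B.1 hx
  exact K.mem_B.2 ⟨hx, y, K.upper_mono (tsub_le_tsub_right h 1) _ _ hy, rfl⟩

/-- An element of the denominator of an earlier page which survives to a later page lies in the
denominator of the later page. -/
theorem mem_denom_of_le {k k' : ℕ∞} (hk' : 1 ≤ k') (h : k ≤ k') {p : ℤ} {m : ℕ} {x : K.C.X m}
    (hx : x ∈ K.denom k p m) (hx' : x ∈ K.Z k' p m) : x ∈ K.denom k' p m := by
  obtain ⟨a, ha, b, hb, rfl⟩ := Submodule.mem_sup.1 hx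
  refine Submodule.add_mem_sup ?_ (K.B_mono h _ _ hb)
  refine K.mem_Z.2 ⟨(K.mem_Z.1 ha).1, fun j => ?_⟩
  obtain ⟨-, y, -, rfl⟩ := K.mem_B.1 hb
  -- The summand `b` is a boundary, so `a` has the same differential as the whole element, which
  -- survives to page `k'`.
  have := (K.mem_Z.1 hx').2 j
  rwa [map_add, d_d_apply, add_zero, ← K.lower_shift hk'] at this

variable {K} {K' K'' : FilteredComplex R}

/-- A chain map which preserves the filtrations. -/
structure Hom (K K' : FilteredComplex R) where
  /-- the chain map -/
  map : K.C ⟶ K'.C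
  map_mem : ∀ p m x, x ∈ K.F p m → (map.f m).hom x ∈ K'.F p m

namespace Hom

/-- The identity. -/
def id (K : FilteredComplex R) : Hom K K := ⟨𝟙 _, fun _ _ _ hx => hx⟩

/-- The composition of filtered chain maps. -/
def comp (f : Hom K K') (g : Hom K' K'') : Hom K K'' :=
  ⟨f.map ≫ g.map, fun p m _ hx => g.map_mem p m _ (f.map_mem p m _ hx)⟩

theorem d_map (f : Hom K K') (i j : ℕ) (x : K.C.X i) :
    (K'.C.d i j).hom ((f.map.f i).hom x) = (f.map.f j).hom ((K.C.d i j).hom x) := by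
  rw [← LinearMap.comp_apply, ← ModuleCat.hom_comp, f.map.comm, ModuleCat.hom_comp]; rfl

theorem lower_mem (f : Hom K K') {k : ℕ∞} {p : ℤ} {m : ℕ} {x : K.C.X m} (hx : x ∈ K.lower k p m) :
    (f.map.f m).hom x ∈ K'.lower k p m := by
  unfold lower at *
  split_ifs at * with h
  · rw [(Submodule.mem_bot R).1 hx, map_zero]; exact Submodule.zero_mem _
  · exact f.map_mem _ _ _ hx

theorem upper_mem (f : Hom K K') {k : ℕ∞} {p : ℤ} {m : ℕ} {x : K.C.X m} (hx : x ∈ K.upper k p m) :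
    (f.map.f m).hom x ∈ K'.upper k p m := by
  unfold upper at *
  split_ifs at * with h
  · trivial
  · exact f.map_mem _ _ _ hx

theorem Z_mem (f : Hom K K') {k : ℕ∞} {p : ℤ} {m : ℕ} {x : K.C.X m} (hx : x ∈ K.Z k p m) :
    (f.map.f m).hom x ∈ K'.Z k p m := by
  obtain ⟨h1, h2⟩ := K.mem_Z.1 hx
  refine K'.mem_Z.2 ⟨f.map_mem _ _ _ h1, fun j => ?_⟩
  rw [f.d_map]
  exact f.lower_mem (h2 j)

theorem B_mem (f : Hom K K') {k : ℕ∞} {p : ℤ} {m : ℕ} {x : K.C.X m} (hx : x ∈ K.B k p m) :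
    (f.map.f m).hom x ∈ K'.B k p m := by
  obtain ⟨h1, y, hy, rfl⟩ := K.mem_B.1 hx
  exact K'.mem_B.2 ⟨f.map_mem _ _ _ h1, _, f.upper_mem hy, f.d_map _ _ _⟩

theorem denom_mem (f : Hom K K') {k : ℕ∞} {p : ℤ} {m : ℕ} {x : K.C.X m} (hx : x ∈ K.denom k p m) :
    (f.map.f m).hom x ∈ K'.denom k p m := by
  obtain ⟨a, ha, b, hb, rfl⟩ := Submodule.mem_sup.1 hx
  rw [map_add]
  exact Submodule.add_mem_sup (f.Z_mem ha) (f.B_mem hb)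

/-- The map of pages induced by a filtered chain map. -/
def page (f : Hom K K') (k : ℕ∞) (p : ℤ) (m : ℕ) : K.Page k p m →ₗ[R] K'.Page k p m :=
  Submodule.mapQ _ _ ((f.map.f m).hom.restrict (fun _ hx => f.Z_mem hx))
    (fun _ hx => f.denom_mem hx)

theorem page_cls (f : Hom K K') (k : ℕ∞) (p : ℤ) (m : ℕ) (x : K.C.X m) (hx : x ∈ K.Z k p m) :
    f.page k p m (K.cls k p m ⟨x, hx⟩) = K'.cls k p m ⟨(f.map.f m).hom x, f.Z_mem hx⟩ := rfl

theorem cls_eq_cls {k : ℕ∞} {p : ℤ} {m : ℕ} {x y : K.C.X m} {hx : x ∈ K.Z k p m}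
    {hy : y ∈ K.Z k p m} : K.cls k p m ⟨x, hx⟩ = K.cls k p m ⟨y, hy⟩ ↔ x - y ∈ K.denom k p m :=
  Submodule.Quotient.eq _

theorem page_ext {k : ℕ∞} {p : ℤ} {m : ℕ} {f g : K.Page k p m → K'.Page k p m}
    (h : ∀ x hx, f (K.cls k p m ⟨x, hx⟩) = g (K.cls k p m ⟨x, hx⟩)) (x : K.Page k p m) :
    f x = g x := by
  obtain ⟨⟨x, hx⟩, rfl⟩ := Submodule.mkQ_surjective _ x
  exact h x hx

theorem page_comp (f : Hom K K') (g : Hom K' K'') (k : ℕ∞) (p : ℤ) (m : ℕ) (x : K.Page k p m) :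
    (f.comp g).page k p m x = g.page k p m (f.page k p m x) := by
  obtain ⟨⟨x, hx⟩, rfl⟩ := Submodule.mkQ_surjective _ x
  rfl

theorem page_id (k : ℕ∞) (p : ℤ) (m : ℕ) (x : K.Page k p m) :
    (Hom.id K).page k p m x = x := by
  obtain ⟨⟨x, hx⟩, rfl⟩ := Submodule.mkQ_surjective _ x
  rfl

theorem page_diff (f : Hom K K') (k : ℕ) (hk : 1 ≤ k) (p : ℤ) (m : ℕ)
    (x : K.Page (k : ℕ∞) p (m + 1)) :
    f.page k (p - k) m (K.diff k hk p m x) = K'.diff k hk p m (f.page k p (m + 1) x) := by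
  obtain ⟨⟨x, hx⟩, rfl⟩ := Submodule.mkQ_surjective _ x
  refine cls_eq_cls.2 ?_
  change (f.map.f m).hom ((K.C.d (m + 1) m).hom x) -
    (K'.C.d (m + 1) m).hom ((f.map.f (m + 1)).hom x) ∈ _
  rw [f.d_map, sub_self]
  exact Submodule.zero_mem _

/-- Filtered chain maps which are homotopic through a filtered homotopy induce the same maps of
pages. -/
theorem page_eq_of_homotopy {f g : Hom K K'} (H : Homotopy f.map g.map)
    (hH : ∀ p i j x, x ∈ K.F p i → (H.hom i j).hom x ∈ K'.F p j)
    {k : ℕ∞} (hk : 1 ≤ k) (p : ℤ) (m : ℕ) (x : K.Page k p m) :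
    f.page k p m x = g.page k p m x := by
  refine page_ext (fun x hx => ?_) x
  rw [page_cls, page_cls, cls_eq_cls]
  obtain ⟨hx1, hx2⟩ := K.mem_Z.1 hx
  set a := (H.hom ((ComplexShape.down ℕ).next m) m).hom
    ((K.C.d m ((ComplexShape.down ℕ).next m)).hom x) with ha
  set b := (K'.C.d (m + 1) m).hom ((H.hom m (m + 1)).hom x) with hb
  have hab : (f.map.f m).hom x - (g.map.f m).hom x = a + b := by
    have h := H.comm m
    rw [prevD_eq (j := m) (j' := m + 1) (f := H.hom) (w := by simp)] at h
    rw [h, sub_eq_iff_eq_add]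
    rfl
  -- This is where `1 ≤ k` enters: the differential of `x` lies one level lower, hence so does its
  -- image under the homotopy.
  have ha1 : a ∈ K'.F (p - 1) m := hH _ _ _ _ (K.lower_le hk _ _ (hx2 _))
  have hb1 : b ∈ K'.F p m := K'.d_mem _ _ _ _ (hH _ _ _ _ hx1)
  rw [hab]
  refine Submodule.add_mem_sup (K'.mem_Z.2 ⟨ha1, fun j => ?_⟩)
    (K'.mem_B.2 ⟨hb1, _, K'.le_upper _ _ _ (hH _ _ _ _ hx1), rfl⟩)
  -- As `b` is a boundary, `∂a = ∂(a + b) = f(∂x) - g(∂x)`, which lies in level `p - k`; this puts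
  -- `a` in `Z^{k-1}_{p-1}`.
  have : (K'.C.d m j).hom a = (K'.C.d m j).hom (a + b) := by
    rw [map_add, hb, d_d_apply, add_zero]
  rw [this, ← hab, map_sub, f.d_map, g.d_map, K'.lower_shift hk]
  exact sub_mem (f.lower_mem (hx2 j)) (g.lower_mem (hx2 j))

end Hom

/-- Two filtered complexes are page equivalent if there are filtered chain maps in both directions
which induce mutually inverse maps of all pages from the first one on. -/
def PageEquiv (K K' : FilteredComplex R) : Prop :=
  ∃ (f : Hom K K') (g : Hom K' K), ∀ k : ℕ∞, 1 ≤ k → ∀ p m,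
    (∀ x, g.page k p m (f.page k p m x) = x) ∧ ∀ y, f.page k p m (g.page k p m y) = y

namespace PageEquiv

theorem refl (K : FilteredComplex R) : PageEquiv K K :=
  ⟨Hom.id K, Hom.id K, fun k _ p m => by simp [Hom.page_id]⟩

theorem symm (h : PageEquiv K K') : PageEquiv K' K := by
  obtain ⟨f, g, h⟩ := h
  exact ⟨g, f, fun k hk p m => (h k hk p m).symm⟩

theorem trans (h : PageEquiv K K') (h' : PageEquiv K' K'') : PageEquiv K K'' := by
  obtain ⟨f, g, h⟩ := h
  obtain ⟨f', g', h'⟩ := h'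
  refine ⟨f.comp f', g'.comp g, fun k hk p m => ⟨fun x => ?_, fun y => ?_⟩⟩
  · rw [Hom.page_comp, Hom.page_comp, (h' k hk p m).1, (h k hk p m).1]
  · rw [Hom.page_comp, Hom.page_comp, (h k hk p m).2, (h' k hk p m).2]

theorem spectralSequenceIso (h : PageEquiv K K') : Nonempty (SpectralSequenceIso K K') := by
  obtain ⟨f, g, h⟩ := h
  refine ⟨⟨fun k hk p m => LinearEquiv.ofLinearMap (f.page k p m) (g.page k p m)
      (LinearMap.ext (h k hk p m).2) (LinearMap.ext (h k hk p m).1),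
    fun k hk _ p m x => f.page_diff k hk p m x, ?_⟩⟩
  intro k k' hk hk' hkk p m z z' h₁ h₂ h₁' h₂' he
  simp only [LinearEquiv.coe_ofLinearMap, Hom.page_cls, Hom.cls_eq_cls] at he ⊢
  -- The difference of `f z` and `z'` dies on page `k` and lies in `Z^{k'}`, so it dies on the later
  -- page as well.
  exact K'.mem_denom_of_le hk' hkk he (sub_mem (f.Z_mem h₂) h₂')

end PageEquiv

end FilteredComplex
end FilteredLattice

namespace FilteredLattice
open CategoryTheory MonoidalCategory Simplicial

/-! ## Filtered homotopy equivalences -/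

/-- The components of the simplicial homotopy at a simplex evaluate `H` on the prism over it, so
they commute with maps compatible with the homotopies. This is the source of the naturality that
lets a homotopy of spaces act on the chains of each filtration piece. -/
theorem simplicialHomotopy_naturality {X Y X' Y' : SSet.{0}} {f g : X ⟶ Y} {f' g' : X' ⟶ Y'}
    (H : SSet.Homotopy f g) (H' : SSet.Homotopy f' g') (i : X' ⟶ X) (j : Y' ⟶ Y)
    (h : H'.h ≫ j = i ▷ Δ[1] ≫ H.h) {n : ℕ} (k : Fin (n + 1)) :
    H'.toSimplicialObjectHomotopy.h k ≫ j.app _ = i.app _ ≫ H.toSimplicialObjectHomotopy.h k := by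
  ext x
  have h2 : SSet.yonedaEquiv.symm (i.app _ x) = SSet.yonedaEquiv.symm x ≫ i :=
    (SSet.yonedaEquiv_symm_comp x i).symm
  change ((SSet.yonedaEquiv.symm x ▷ Δ[1] ≫ H'.h) ≫ j).app _ _ =
    (SSet.yonedaEquiv.symm (i.app _ x) ▷ Δ[1] ≫ H.h).app _ _
  rw [h2, Category.assoc, h, comp_whiskerRight, Category.assoc]

theorem chainHomotopy_naturality {X Y X' Y' : SSet.{0}} {f g : X ⟶ Y} {f' g' : X' ⟶ Y'}
    (H : SSet.Homotopy f g) (H' : SSet.Homotopy f' g') (i : X' ⟶ X) (j : Y' ⟶ Y)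
    (h : H'.h ≫ j = i ▷ Δ[1] ≫ H.h) (R : ModuleCat.{0} ℤ) (p q : ℕ) :
    (H'.chainComplexMap R).hom p q ≫ (SSet.chainComplexMap j R).f q =
      (SSet.chainComplexMap i R).f p ≫ (H.chainComplexMap R).hom p q := by
  change SimplicialObject.Homotopy.ToChainHomotopy.hom
      (H'.toSimplicialObjectHomotopy.whiskerRight (Limits.sigmaConst.obj R)) p q ≫ _ =
    _ ≫ SimplicialObject.Homotopy.ToChainHomotopy.hom
      (H.toSimplicialObjectHomotopy.whiskerRight (Limits.sigmaConst.obj R)) p q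
  by_cases hpq : p + 1 = q
  · subst hpq
    rw [SimplicialObject.Homotopy.ToChainHomotopy.hom_eq,
      SimplicialObject.Homotopy.ToChainHomotopy.hom_eq]
    simp only [Preadditive.neg_comp, Preadditive.comp_neg, Preadditive.sum_comp,
      Preadditive.comp_sum, Preadditive.zsmul_comp, Preadditive.comp_zsmul]
    congr 1
    refine Finset.sum_congr rfl fun k _ => ?_
    congr 1
    have := congrArg (fun t => (Limits.sigmaConst.obj R).map t)
      (simplicialHomotopy_naturality H H' i j h k)
    simp only [Functor.map_comp] at this
    exact this
  · rw [SimplicialObject.Homotopy.ToChainHomotopy.hom_eq_zero _ _ _ hpq,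
      SimplicialObject.Homotopy.ToChainHomotopy.hom_eq_zero _ _ _ hpq,
      Limits.zero_comp, Limits.comp_zero]

/-- The functor to simplicial sets carries a homotopy along its lax monoidal structure map, which is
natural in the factor without the interval. -/
theorem toSSet_homotopy_naturality {X Y X' Y' : TopCat.{0}} {f g : X ⟶ Y} {f' g' : X' ⟶ Y'}
    (H : TopCat.Homotopy f g) (H' : TopCat.Homotopy f' g') (i : X' ⟶ X) (j : Y' ⟶ Y)
    (h : ∀ t x, j (H' (t, x)) = H (t, i x)) :
    H'.toSSet.h ≫ TopCat.toSSet.map j = TopCat.toSSet.map i ▷ Δ[1] ≫ H.toSSet.h := by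
  have h1 : H'.h ≫ j = i ▷ TopCat.I ≫ H.h := by
    ext x
    exact h _ _
  simp only [TopCat.Homotopy.toSSet, Category.assoc, ← Functor.map_comp]
  rw [h1, Functor.map_comp, ← Functor.LaxMonoidal.μ_natural_left_assoc, whisker_exchange_assoc]

/-- The chain homotopy obtained from a homotopy is natural. -/
theorem singularChainHomotopy_naturality {X Y X' Y' : TopCat.{0}} {f g : X ⟶ Y} {f' g' : X' ⟶ Y'}
    (H : TopCat.Homotopy f g) (H' : TopCat.Homotopy f' g') (i : X' ⟶ X) (j : Y' ⟶ Y)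
    (h : ∀ t x, j (H' (t, x)) = H (t, i x)) (p q : ℕ) :
    (H'.singularChainComplexFunctorObjMap (ModuleCat.of ℤ ℤ)).hom p q ≫
        (singularChainsMap j).f q =
      (singularChainsMap i).f p ≫
        (H.singularChainComplexFunctorObjMap (ModuleCat.of ℤ ℤ)).hom p q :=
  chainHomotopy_naturality _ _ _ _ (toSSet_homotopy_naturality H H' i j h) _ p q

section Filtered

variable {Y Y' : Type} [TopologicalSpace Y] [TopologicalSpace Y'] {A : ℤ → Set Y} {A' : ℤ → Set Y'}

/-- The filtered chain map induced by a continuous map compatible with the filtrations. -/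
def filteredMap (hA : Monotone A) (hA' : Monotone A') (f : C(Y, Y'))
    (hf : ∀ p, Set.MapsTo f (A p) (A' p)) :
    (filteredSingularChains A hA).Hom (filteredSingularChains A' hA') where
  map := singularChainsMap (TopCat.ofHom f)
  map_mem p m x hx := by
    obtain ⟨y, rfl⟩ := hx
    let g : TopCat.of ↥(A p) ⟶ TopCat.of ↥(A' p) :=
      TopCat.ofHom ⟨(hf p).restrict, f.continuous.restrict (hf p)⟩
    refine ⟨((singularChainsMap g).f m).hom y, ?_⟩
    have h : subspaceIncl (A p) ≫ TopCat.ofHom f = g ≫ subspaceIncl (A' p) := rfl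
    have h' := congrArg (fun t => ((singularChainsMap t).f m).hom y) h
    simp only [Functor.map_comp, HomologicalComplex.comp_f] at h'
    exact h'.symm

theorem filteredMap_page_eq (hA : Monotone A) (hA' : Monotone A') {f g : C(Y, Y')}
    (hf : ∀ p, Set.MapsTo f (A p) (A' p)) (hg : ∀ p, Set.MapsTo g (A p) (A' p))
    (H : f.Homotopy g) (hH : ∀ p t, ∀ x ∈ A p, H (t, x) ∈ A' p)
    {k : ℕ∞} (hk : 1 ≤ k) (p : ℤ) (m : ℕ) (x) :
    (filteredMap hA hA' f hf).page k p m x = (filteredMap hA hA' g hg).page k p m x := by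
  let H₁ : TopCat.Homotopy (TopCat.ofHom f) (TopCat.ofHom g) := H
  refine FilteredComplex.Hom.page_eq_of_homotopy
    (H₁.singularChainComplexFunctorObjMap (ModuleCat.of ℤ ℤ)) ?_ hk p m x
  rintro p i j _ ⟨y, rfl⟩
  let f' : C(↥(A p), ↥(A' p)) := ⟨(hf p).restrict, f.continuous.restrict (hf p)⟩
  let g' : C(↥(A p), ↥(A' p)) := ⟨(hg p).restrict, g.continuous.restrict (hg p)⟩
  -- The homotopy restricts to the filtration pieces. By naturality the chain homotopy of `H₁` on a
  -- chain coming from `A p` is the image of the chain homotopy of `H₂`, hence it comes from `A' p`.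
  let H₂ : TopCat.Homotopy (TopCat.ofHom f') (TopCat.ofHom g') :=
    { toFun := fun z => ⟨H (z.1, z.2), hH p z.1 z.2 z.2.2⟩
      continuous_toFun := by fun_prop
      map_zero_left := fun z => Subtype.ext (H.map_zero_left z)
      map_one_left := fun z => Subtype.ext (H.map_one_left z) }
  have h := singularChainHomotopy_naturality H₁ H₂ (subspaceIncl (A p)) (subspaceIncl (A' p))
    (fun t x => rfl) i j
  exact ⟨_, congrArg (fun t => t.hom y) h⟩

theorem filteredMap_comp_page {Y'' : Type} [TopologicalSpace Y''] {A'' : ℤ → Set Y''}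
    (hA : Monotone A) (hA' : Monotone A') (hA'' : Monotone A'') (f : C(Y, Y')) (g : C(Y', Y''))
    (hf : ∀ p, Set.MapsTo f (A p) (A' p)) (hg : ∀ p, Set.MapsTo g (A' p) (A'' p))
    (k : ℕ∞) (p : ℤ) (m : ℕ) (x) :
    (filteredMap hA' hA'' g hg).page k p m ((filteredMap hA hA' f hf).page k p m x) =
      (filteredMap hA hA'' (g.comp f) (fun p => (hg p).comp (hf p))).page k p m x := by
  rw [← FilteredComplex.Hom.page_comp]
  congr 2
  have h : TopCat.ofHom (g.comp f) = TopCat.ofHom f ≫ TopCat.ofHom g := rfl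
  simp only [FilteredComplex.Hom.comp, filteredMap, h, Functor.map_comp]
  rfl

theorem filteredMap_id_page (hA : Monotone A) (k : ℕ∞) (p : ℤ) (m : ℕ) (x) :
    (filteredMap hA hA (ContinuousMap.id Y) (fun _ _ hx => hx)).page k p m x = x := by
  have : filteredMap hA hA (ContinuousMap.id Y) (fun _ _ hx => hx) =
      FilteredComplex.Hom.id _ := by
    have h : TopCat.ofHom (ContinuousMap.id Y) = 𝟙 (TopCat.of Y) := rfl
    simp only [FilteredComplex.Hom.id, filteredMap, h, CategoryTheory.Functor.map_id]
    rfl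
  rw [this, FilteredComplex.Hom.page_id]

end Filtered

end FilteredLattice

namespace FilteredLattice

/-! ## Elimination of a coordinate from a weighted cubical complex -/

section Near

variable {W : Type}

/-- The lattice point `v` is a vertex of the smallest cube that contains `x`. -/
def Near (x : W → ℝ) (v : W → ℤ) : Prop := ∀ i, |x i - v i| < 1

theorem near_floor (x : W → ℝ) : Near x (fun i => ⌊x i⌋) := fun i => by
  rw [abs_lt]
  constructor <;> linarith [Int.floor_le (x i), Int.lt_floor_add_one (x i)]

theorem Near.nonneg {x : W → ℝ} {v : W → ℤ} (h : Near x v) (hx : 0 ≤ x) : 0 ≤ v := fun i => by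
  have h1 := abs_lt.1 (h i)
  have h2 : 0 ≤ x i := hx i
  have h3 : (-1 : ℝ) < v i := by linarith
  have : (-1 : ℤ) < v i := by exact_mod_cast h3
  simp only [Pi.zero_apply]; omega

theorem Near.eq_add_sumE [Fintype W] {x : W → ℝ} {v : W → ℤ} (h : Near x v) :
    ∃ K ⊆ Finset.univ.filter (fun i => x i ≠ ⌊x i⌋), v = (fun i => ⌊x i⌋) + sumE K := by
  refine ⟨Finset.univ.filter (fun i => v i ≠ ⌊x i⌋), fun i hi => ?_, funext fun i => ?_⟩
  · simp only [Finset.mem_filter, Finset.mem_univ, true_and] at hi ⊢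
    intro hx
    have h1 := abs_lt.1 (h i)
    rw [hx] at h1
    have h2 : (-1 : ℤ) < ⌊x i⌋ - v i ∧ ⌊x i⌋ - v i < 1 := by exact_mod_cast h1
    omega
  · have h1 := abs_lt.1 (h i)
    have h2 := Int.floor_le (x i)
    have h3 := Int.lt_floor_add_one (x i)
    have h4 : (⌊x i⌋ : ℝ) - 1 < v i := by linarith
    have h5 : (v i : ℝ) < ⌊x i⌋ + 2 := by linarith
    have h4' : ⌊x i⌋ - 1 < v i := by exact_mod_cast h4
    have h5' : v i < ⌊x i⌋ + 2 := by exact_mod_cast h5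
    simp only [Pi.add_apply, sumE, Finset.mem_filter, Finset.mem_univ, true_and]
    split_ifs <;> omega

theorem near_floor_add_sumE [Fintype W] (x : W → ℝ) {K : Finset W}
    (hK : K ⊆ Finset.univ.filter (fun i => x i ≠ ⌊x i⌋)) :
    Near x ((fun i => ⌊x i⌋) + sumE K) := fun i => by
  have h2 := Int.floor_le (x i)
  have h3 := Int.lt_floor_add_one (x i)
  simp only [Pi.add_apply, sumE]
  rw [abs_lt]
  split_ifs with h
  · have h4 := hK h
    simp only [Finset.mem_filter, Finset.mem_univ, true_and] at h4
    have h5 : (⌊x i⌋ : ℝ) < x i := lt_of_le_of_ne h2 (Ne.symm h4)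
    push_cast
    constructor <;> linarith
  · push_cast
    constructor <;> linarith

theorem Near.of_mem_cube {x : W → ℝ} {v l : W → ℤ} {I : Finset W} (h : Near x v)
    (hx : x ∈ cube l I) : ∃ K ⊆ I, v = l + sumE K := by
  refine ⟨I.filter (fun i => v i ≠ l i), Finset.filter_subset _ _, funext fun i => ?_⟩
  have h1 := abs_lt.1 (h i)
  have h2 : (l i : ℝ) ≤ x i := hx.1 i
  have h3 : x i ≤ ((l + sumE I) i : ℤ) := hx.2 i
  simp only [Pi.add_apply, sumE, Finset.mem_filter] at h3 ⊢
  have h4 : (l i : ℝ) - 1 < v i := by linarith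
  have h4' : l i - 1 < v i := by exact_mod_cast h4
  split_ifs at h3 with hi
  · have h5 : (v i : ℝ) < (l i + 1 : ℤ) + 1 := by linarith
    have h5' : v i < (l i + 1) + 1 := by exact_mod_cast h5
    split_ifs with h6
    · have := h6.2; omega
    · have : v i = l i := by tauto
      omega
  · have h5 : (v i : ℝ) < (l i + 0 : ℤ) + 1 := by linarith
    have h5' : v i < (l i + 0) + 1 := by exact_mod_cast h5
    split_ifs <;> omega

theorem mem_cube_floor [Fintype W] (x : W → ℝ) :
    x ∈ cube (fun i => ⌊x i⌋) (Finset.univ.filter (fun i => x i ≠ ⌊x i⌋)) := by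
  refine ⟨fun i => Int.floor_le _, fun i => ?_⟩
  simp only [Pi.add_apply, sumE, Finset.mem_filter, Finset.mem_univ, true_and]
  split_ifs with h
  · push_cast; exact (Int.lt_floor_add_one _).le
  · push_cast
    rw [not_not] at h
    linarith

/-- The vertices of the smallest cube around `x` are vertices of every cube that contains `x`, so
that cube has the least weight and decides membership. This turns unions of cubes into pointwise
conditions. -/
theorem mem_sublevel_iff [Fintype W] (w : (W → ℤ) → ℚ) (n : ℤ) (x : W → ℝ) :
    x ∈ sublevel w n ↔ 0 ≤ x ∧ ∀ v, Near x v → w v ≤ n := by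
  simp only [sublevel, Set.mem_iUnion, exists_prop]
  constructor
  · rintro ⟨l, I, hl, hw, hx⟩
    refine ⟨fun i => le_trans ?_ (hx.1 i), fun v hv => ?_⟩
    · have : (0 : ℝ) ≤ l i := by exact_mod_cast hl i
      exact this
    · obtain ⟨K, hK, rfl⟩ := hv.of_mem_cube hx
      exact (Finset.le_sup' (fun J => w (l + sumE J)) (Finset.mem_powerset.2 hK)).trans hw
  · rintro ⟨hx, h⟩
    refine ⟨_, _, (near_floor x).nonneg hx, ?_, mem_cube_floor x⟩
    exact Finset.sup'_le _ _ fun J hJ => h _ (near_floor_add_sumE x (Finset.mem_powerset.1 hJ))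

/-- For antitone `φ` the bottom vertex has the largest value on its cube, so testing `φ` at `l` is
the same as testing it at all vertices, as for a sublevel set. -/
theorem mem_filtPart_iff [Fintype W] {φ : (W → ℤ) → ℚ} (hφ : Antitone φ) (p : ℤ) (x : W → ℝ) :
    x ∈ filtPart φ p ↔ 0 ≤ x ∧ ∀ v, Near x v → φ v ≤ p := by
  simp only [filtPart, Set.mem_iUnion, exists_prop]
  constructor
  · rintro ⟨l, I, hl, hw, hx⟩
    refine ⟨fun i => le_trans ?_ (hx.1 i), fun v hv => ?_⟩
    · have : (0 : ℝ) ≤ l i := by exact_mod_cast hl i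
      exact this
    · obtain ⟨K, hK, rfl⟩ := hv.of_mem_cube hx
      refine (hφ (fun i => ?_)).trans hw
      simp only [Pi.add_apply, sumE]
      split_ifs <;> omega
  · rintro ⟨hx, h⟩
    exact ⟨_, _, (near_floor x).nonneg hx, h _ (near_floor x), mem_cube_floor x⟩

end Near

/-! ### The collapse of the neighbourhoods of the integers -/

/-- The monotone continuous map which sends `[m - 1/3, m + 1/3]` to `m` for all integers `m`. -/
def collapse (y : ℝ) : ℝ := y + (max 0 (min 1 (3 * Int.fract y - 1)) - Int.fract y)

theorem continuous_collapse : Continuous collapse := by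
  refine continuous_id.add ?_
  -- A continuous function of the fractional part is continuous on the line when its values at `0`
  -- and `1` agree; here both are `0`.
  exact ContinuousOn.comp_fract'' (f := fun r => max 0 (min 1 (3 * r - 1)) - r)
    (by fun_prop) (by norm_num)

theorem le_collapse {m : ℤ} {y : ℝ} (h : m ≤ y) : m ≤ collapse y := by
  have h1 : m ≤ ⌊y⌋ := Int.le_floor.2 h
  have h1' : (m : ℝ) ≤ ⌊y⌋ := by exact_mod_cast h1
  have h2 : y - Int.fract y = ⌊y⌋ := Int.self_sub_fract y
  have h3 : 0 ≤ max 0 (min 1 (3 * Int.fract y - 1)) := le_max_left _ _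
  unfold collapse
  linarith

theorem collapse_le {m : ℤ} {y : ℝ} (h : y ≤ m) : collapse y ≤ m := by
  have h2 : y - Int.fract y = ⌊y⌋ := Int.self_sub_fract y
  unfold collapse
  rcases h.lt_or_eq with h | h
  · have h1 : ⌊y⌋ + 1 ≤ m := Int.floor_lt.2 h
    have h1' : (⌊y⌋ : ℝ) + 1 ≤ m := by exact_mod_cast h1
    have h3 : max 0 (min 1 (3 * Int.fract y - 1)) ≤ 1 := max_le (by norm_num) (min_le_left _ _)
    linarith
  · have : Int.fract y = 0 := by rw [h, Int.fract_intCast]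
    rw [this, h]; norm_num

/-- Collapsing removes the lattice points at distance more than `2/3` from the vertices to be
considered. On the remaining ones the bump function equals `1`, so the interpolated height dominates
their lowest heights. -/
theorem abs_le_of_collapse {m : ℤ} {y : ℝ} (h : |collapse y - m| < 1) : |y - m| ≤ 2 / 3 := by
  obtain ⟨h1, h2⟩ := abs_lt.1 h
  have e : y - Int.fract y = ⌊y⌋ := Int.self_sub_fract y
  rw [abs_le]
  constructor
  · by_contra hlt
    rw [not_le] at hlt
    rcases le_or_gt y ((m - 1 : ℤ) : ℝ) with h3 | h3
    · have := collapse_le h3; push_cast at this; linarith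
    · have h4 : ⌊y⌋ = m - 1 := by
        rw [Int.floor_eq_iff]; push_cast at h3 ⊢; constructor <;> linarith
      rw [h4] at e; push_cast at e
      have : collapse y = m - 1 := by
        unfold collapse
        rw [min_eq_right (by linarith), max_eq_left (by linarith)]; linarith
      linarith
  · by_contra hlt
    rw [not_le] at hlt
    rcases le_or_gt ((m + 1 : ℤ) : ℝ) y with h3 | h3
    · have := le_collapse h3; push_cast at this; linarith
    · have h4 : ⌊y⌋ = m := by
        rw [Int.floor_eq_iff]; push_cast at h3 ⊢; constructor <;> linarith
      rw [h4] at e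
      have : collapse y = m + 1 := by
        unfold collapse
        rw [min_eq_left (by linarith), max_eq_right (by linarith)]; linarith
      linarith

/-- The collapse preserves the inequalities with integers, so the segment from a point to its
collapse stays in every cube that contains the point and acquires no new near vertices. -/
theorem near_of_near_mix {W : Type} {x : W → ℝ} {v : W → ℤ} {u : ℝ} (hu : 0 ≤ u) (hu' : u ≤ 1)
    (h : Near (fun i => (1 - u) * x i + u * collapse (x i)) v) : Near x v := fun i => by
  obtain ⟨h1, h2⟩ := abs_lt.1 (h i)
  rw [abs_lt]
  constructor
  · by_contra hlt
    rw [not_lt] at hlt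
    have h3 : x i ≤ ((v i - 1 : ℤ) : ℝ) := by push_cast; linarith
    have h4 := collapse_le h3
    push_cast at h3 h4
    nlinarith
  · by_contra hlt
    rw [not_lt] at hlt
    have h3 : ((v i + 1 : ℤ) : ℝ) ≤ x i := by push_cast; linarith
    have h4 := le_collapse h3
    push_cast at h3 h4
    nlinarith

/-! ### The interpolated height -/

/-- A bump function: `1` for norm at most `2/3`, and `0` for norm at least `1`. -/
def bump {W : Type} [Fintype W] (x : W → ℝ) : ℝ := max 0 (min 1 (3 * (1 - ‖x‖)))

section Height

variable {W : Type} [Fintype W]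

theorem bump_nonneg (x : W → ℝ) : 0 ≤ bump x := le_max_left _ _

theorem bump_le_one (x : W → ℝ) : bump x ≤ 1 := max_le (by norm_num) (min_le_left _ _)

theorem bump_eq_zero {x : W → ℝ} {v : W → ℤ} (h : ¬ Near x v) : bump (fun i => x i - v i) = 0 := by
  have : ¬ ‖fun i => x i - (v i : ℝ)‖ < 1 := by
    rwa [pi_norm_lt_iff one_pos]
  unfold bump
  exact max_eq_left ((min_le_right _ _).trans (by linarith))

theorem bump_eq_one {x : W → ℝ} {v : W → ℤ} (h : ∀ i, |x i - v i| ≤ 2 / 3) :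
    bump (fun i => x i - v i) = 1 := by
  have : ‖fun i => x i - (v i : ℝ)‖ ≤ 2 / 3 := (pi_norm_le_iff_of_nonneg (by norm_num)).2 h
  unfold bump
  rw [min_eq_left (by linarith), max_eq_right (by norm_num)]

theorem continuous_bump : Continuous (bump (W := W)) := by
  unfold bump; fun_prop

/-- The continuous interpolation of the function `α` on the lattice points from above. -/
def height (α : (W → ℤ) → ℕ) (x : W → ℝ) : ℝ := ⨆ v : W → ℤ, α v * bump (fun i => x i - v i)

theorem height_eq_sup' (α : (W → ℤ) → ℕ) {x : W → ℝ} {B : Finset (W → ℤ)}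
    (hB : ∀ v, Near x v → v ∈ B) (hne : B.Nonempty) :
    height α x = B.sup' hne (fun v => α v * bump (fun i => x i - v i)) := by
  have key : ∀ v, α v * bump (fun i => x i - v i) ≤
      B.sup' hne (fun v => α v * bump (fun i => x i - v i)) := by
    intro v
    by_cases hv : Near x v
    · exact Finset.le_sup' (fun v => α v * bump (fun i => x i - v i)) (hB v hv)
    · rw [bump_eq_zero hv, mul_zero]
      obtain ⟨v', hv'⟩ := hne
      exact (mul_nonneg (Nat.cast_nonneg (α v')) (bump_nonneg _)).trans
        (Finset.le_sup' (fun v => α v * bump (fun i => x i - v i)) hv')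
  refine le_antisymm (ciSup_le key) (Finset.sup'_le _ _ fun v _ => ?_)
  exact le_ciSup (f := fun v : W → ℤ => α v * bump (fun i => x i - v i))
    ⟨_, by rintro _ ⟨v, rfl⟩; exact key v⟩ v

theorem continuous_height (α : (W → ℤ) → ℕ) : Continuous (height α) := by
  rw [continuous_iff_continuousAt]
  intro x₀
  -- Points within distance `1` of `x₀` have all their near vertices within distance `2` of `x₀`.
  -- This finite box contains them, so locally the height is a finite supremum of continuous
  -- functions.
  set B : Finset (W → ℤ) := Finset.Icc (fun i => ⌊x₀ i⌋ - 2) (fun i => ⌊x₀ i⌋ + 3) with hBdef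
  have hne : B.Nonempty := Finset.nonempty_Icc.2 fun i => by dsimp; omega
  have h : ∀ᶠ x in nhds x₀, B.sup' hne (fun v => α v * bump (fun i => x i - v i)) =
      height α x := by
    filter_upwards [Metric.ball_mem_nhds x₀ one_pos] with x hx
    refine (height_eq_sup' α (fun v hv => ?_) hne).symm
    have key : ∀ i, ⌊x₀ i⌋ - 2 ≤ v i ∧ v i ≤ ⌊x₀ i⌋ + 3 := fun i => by
      have h1 := abs_lt.1 (hv i)
      have h2 : dist (x i) (x₀ i) < 1 := (dist_le_pi_dist x x₀ i).trans_lt hx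
      rw [Real.dist_eq, abs_lt] at h2
      have h3 := Int.floor_le (x₀ i)
      have h4 := Int.lt_floor_add_one (x₀ i)
      have h5 : (⌊x₀ i⌋ : ℝ) - 2 < v i := by linarith
      have h6 : (v i : ℝ) < ⌊x₀ i⌋ + 3 := by linarith
      have h5' : ⌊x₀ i⌋ - 2 < v i := by exact_mod_cast h5
      have h6' : v i < ⌊x₀ i⌋ + 3 := by exact_mod_cast h6
      omega
    exact Finset.mem_Icc.2 ⟨fun i => (key i).1, fun i => (key i).2⟩
  refine ContinuousAt.congr ?_ h
  refine Continuous.continuousAt ?_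
  refine Continuous.finset_sup'_apply hne fun v _ => ?_
  exact continuous_const.mul (continuous_bump.comp (by fun_prop))

theorem le_height (α : (W → ℤ) → ℕ) {x : W → ℝ} {v : W → ℤ} (h : ∀ i, |x i - v i| ≤ 2 / 3) :
    (α v : ℝ) ≤ height α x := by
  set B : Finset (W → ℤ) := insert v (Finset.Icc (fun i => ⌊x i⌋) (fun i => ⌊x i⌋ + 1)) with hBdef
  have hne : B.Nonempty := ⟨v, Finset.mem_insert_self _ _⟩
  rw [height_eq_sup' α (B := B) (fun v' hv' => ?_) hne]
  · have := Finset.le_sup' (fun v : W → ℤ => α v * bump (fun i => x i - v i))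
      (Finset.mem_insert_self v (Finset.Icc (fun i => ⌊x i⌋) (fun i => ⌊x i⌋ + 1)))
    rw [bump_eq_one h, mul_one] at this
    exact this
  · obtain ⟨K, -, rfl⟩ := hv'.eq_add_sumE
    refine Finset.mem_insert_of_mem (Finset.mem_Icc.2 ⟨fun i => ?_, fun i => ?_⟩) <;>
    · simp only [Pi.add_apply, sumE]
      split_ifs <;> omega

theorem height_le (α : (W → ℤ) → ℕ) {x : W → ℝ} {t : ℝ} (ht : 0 ≤ t)
    (h : ∀ v, Near x v → (α v : ℝ) ≤ t) : height α x ≤ t := by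
  refine ciSup_le fun v => ?_
  by_cases hv : Near x v
  · exact (mul_le_of_le_one_right (Nat.cast_nonneg _) (bump_le_one _)).trans (h v hv)
  · rw [bump_eq_zero hv, mul_zero]; exact ht

theorem height_nonneg (α : (W → ℤ) → ℕ) (x : W → ℝ) : 0 ≤ height α x :=
  Real.iSup_nonneg fun _ => mul_nonneg (Nat.cast_nonneg _) (bump_nonneg _)

end Height

end FilteredLattice

/-! ### Filtered homotopy equivalences that forget or relabel coordinates -/

namespace FilteredLattice

open FilteredComplex

theorem filteredMap_page_eq_of_segment {U U' : Type} {S : Set (U → ℝ)} {S' : Set (U' → ℝ)}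
    {A : ℤ → Set ↥S} {A' : ℤ → Set (U' → ℝ)} (hA : Monotone A)
    (hA' : Monotone fun p => (Subtype.val ⁻¹' A' p : Set ↥S')) {f g : C(↥S, ↥S')}
    (hf : ∀ p, Set.MapsTo f (A p) (Subtype.val ⁻¹' A' p))
    (hg : ∀ p, Set.MapsTo g (A p) (Subtype.val ⁻¹' A' p))
    (hS : ∀ x, ∀ u : ℝ, 0 ≤ u → u ≤ 1 → (fun i => (1 - u) * (f x).1 i + u * (g x).1 i) ∈ S')
    (hA'' : ∀ p, ∀ x ∈ A p, ∀ u : ℝ, 0 ≤ u → u ≤ 1 →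
      (fun i => (1 - u) * (f x).1 i + u * (g x).1 i) ∈ A' p)
    {k : ℕ∞} (hk : 1 ≤ k) (p : ℤ) (m : ℕ) (x) :
    (filteredMap hA hA' f hf).page k p m x = (filteredMap hA hA' g hg).page k p m x := by
  refine filteredMap_page_eq hA hA' hf hg
    { toFun := fun z => ⟨fun i => (1 - (z.1 : ℝ)) * (f z.2).1 i + z.1 * (g z.2).1 i,
        hS z.2 z.1 z.1.2.1 z.1.2.2⟩
      continuous_toFun := by
        refine Continuous.subtype_mk (continuous_pi fun i => ?_) _
        have h1 : Continuous fun z : unitInterval × ↥S => (f z.2).1 i :=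
          (continuous_apply i).comp (continuous_subtype_val.comp (f.continuous.comp continuous_snd))
        have h2 : Continuous fun z : unitInterval × ↥S => (g z.2).1 i :=
          (continuous_apply i).comp (continuous_subtype_val.comp (g.continuous.comp continuous_snd))
        have h3 : Continuous fun z : unitInterval × ↥S => (z.1 : ℝ) :=
          continuous_subtype_val.comp continuous_fst
        exact ((continuous_const.sub h3).mul h1).add (h3.mul h2)
      map_zero_left := fun x => Subtype.ext (funext fun i => by simp)
      map_one_left := fun x => Subtype.ext (funext fun i => by simp) }
    (fun p t x hx => hA'' p x hx t t.2.1 t.2.2) hk p m x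

/-- The vector on `Option W` with the given value at the additional index. -/
def withValue {W α : Type} (l : W → α) (t : α) : Option W → α := fun o => o.elim t l

section Elimination

variable {W : Type}

theorem near_withValue {x : W → ℝ} {t : ℝ} {v : W → ℤ} {s : ℤ} :
    Near (withValue x t) (withValue v s) ↔ Near x v ∧ |t - s| < 1 := by
  constructor
  · exact fun h => ⟨fun i => h (some i), h none⟩
  · rintro ⟨h1, h2⟩ (_ | i)
    exacts [h2, h1 i]

theorem withValue_eta {α : Type} (x : Option W → α) :
    withValue (fun i => x (some i)) (x none) = x := by
  funext o; cases o <;> rfl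

theorem withValue_nonneg {x : W → ℝ} {t : ℝ} : 0 ≤ withValue x t ↔ 0 ≤ x ∧ 0 ≤ t := by
  constructor
  · exact fun h => ⟨fun i => h (some i), h none⟩
  · rintro ⟨h1, h2⟩ (_ | i)
    exacts [h2, h1 i]

variable [Fintype W]

theorem withValue_mem_sublevel_iff (w : (Option W → ℤ) → ℚ) (n : ℤ) (x : W → ℝ) (t : ℝ) :
    withValue x t ∈ sublevel w n ↔ (0 ≤ x ∧ 0 ≤ t) ∧
      ∀ v s, Near x v → |t - (s : ℤ)| < 1 → w (withValue v s) ≤ n := by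
  rw [mem_sublevel_iff, withValue_nonneg]
  refine and_congr_right fun _ => ⟨fun h v s hv hs => h _ (near_withValue.2 ⟨hv, hs⟩), ?_⟩
  intro h v hv
  rw [← withValue_eta v] at hv ⊢
  exact h _ _ (near_withValue.1 hv).1 (near_withValue.1 hv).2

theorem withValue_mem_filtPart_iff {φ : (W → ℤ) → ℚ} (hφ : Antitone φ) (p : ℤ) (x : W → ℝ)
    (t : ℝ) : withValue x t ∈ filtPart (fun l : Option W → ℤ => φ fun i => l (some i)) p ↔
      (0 ≤ x ∧ 0 ≤ t) ∧ ∀ v, Near x v → φ v ≤ p := by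
  rw [mem_filtPart_iff (fun a b hab => hφ fun i => hab (some i)), withValue_nonneg]
  refine and_congr_right fun _ => ⟨fun h v hv => ?_, fun h v hv => ?_⟩
  · refine h (withValue v ⌊t⌋) (near_withValue.2 ⟨hv, ?_⟩)
    exact near_floor (fun _ : Unit => t) ()
  · rw [← withValue_eta v] at hv
    exact h _ (near_withValue.1 hv).1

/-- The least nonnegative height over `l` of weight at most `n`. -/
def lowest (w : (Option W → ℤ) → ℚ) (n : ℤ) (l : W → ℤ) : ℕ :=
  sInf {t : ℕ | w (withValue l t) ≤ n}

/-- If a coordinate does not affect the filtration, the sublevel sets in its direction are intervals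
and the sublevel intervals over the vertices of a cube have a common element as soon as the cube
belongs to the sublevel set of the weight `w'` on the remaining coordinates, then the coordinate can
be eliminated. -/
theorem pageEquiv_eliminate (w : (Option W → ℤ) → ℚ) (w' φ : (W → ℤ) → ℚ) (n : ℤ)
    (hφ : Antitone φ)
    (hconv : ∀ l : W → ℤ, 0 ≤ l → ∀ a b c : ℤ, 0 ≤ a → a ≤ b → b ≤ c → w (withValue l a) ≤ n →
      w (withValue l c) ≤ n → w (withValue l b) ≤ n)
    (hle : ∀ l : W → ℤ, 0 ≤ l → ∀ t : ℤ, 0 ≤ t → w (withValue l t) ≤ n → w' l ≤ n)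
    (hex : ∀ (l : W → ℤ) (I : Finset W), 0 ≤ l → (∀ K ⊆ I, w' (l + sumE K) ≤ n) →
      ∃ t : ℤ, 0 ≤ t ∧ ∀ K ⊆ I, w (withValue (l + sumE K) t) ≤ n) :
    PageEquiv (latticeFilteredChains w (fun l => φ fun i => l (some i)) n)
      (latticeFilteredChains w' φ n) := by
  set S := sublevel w n with hS
  set S' := sublevel w' n with hS'
  set α := lowest w n with hα
  have memS := withValue_mem_sublevel_iff w n
  have memA := fun p => withValue_mem_filtPart_iff hφ p
  have memS' := mem_sublevel_iff w' n
  have memA' := fun p => mem_filtPart_iff hφ p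
  -- heights
  have hcommon : ∀ x ∈ S', ∃ t : ℕ, ∀ v, Near x v → w (withValue v (t : ℤ)) ≤ n := by
    intro x hx
    obtain ⟨hx0, hx⟩ := (memS' x).1 hx
    obtain ⟨t, ht, h⟩ := hex (fun i => ⌊x i⌋) (Finset.univ.filter (fun i => x i ≠ ⌊x i⌋))
      ((near_floor x).nonneg hx0) (fun K hK => hx _ (near_floor_add_sumE x hK))
    lift t to ℕ using ht
    refine ⟨t, fun v hv => ?_⟩
    obtain ⟨K, hK, rfl⟩ := hv.eq_add_sumE
    exact h K hK
  -- `lowest` is an infimum of natural numbers and is `0` on the empty set; a witness `t` guarantees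
  -- that it is attained.
  have hlow : ∀ v (t : ℕ), w (withValue v (t : ℤ)) ≤ n →
      α v ≤ t ∧ w (withValue v ((α v : ℕ) : ℤ)) ≤ n := fun v t h =>
    ⟨Nat.sInf_le h, Nat.sInf_mem (s := {t : ℕ | w (withValue v (t : ℤ)) ≤ n}) ⟨t, h⟩⟩
  have hproj : ∀ x t, withValue x t ∈ S → x ∈ S' := by
    intro x t h
    obtain ⟨⟨h0, h1⟩, h2⟩ := (memS x t).1 h
    exact (memS' x).2 ⟨h0, fun v hv => hle v (hv.nonneg h0) ⌊t⌋ (Int.floor_nonneg.2 h1)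
      (h2 v _ hv (near_floor (fun _ : Unit => t) ()))⟩
  have hcol0 : ∀ x : W → ℝ, 0 ≤ x → 0 ≤ fun i => collapse (x i) := fun x hx i => by
    have := le_collapse (m := 0) (y := x i) (by simpa using hx i)
    simpa using this
  have hcol : ∀ (x : W → ℝ) v, Near (fun i => collapse (x i)) v → Near x v := fun x v h i =>
    (abs_le_of_collapse (h i)).trans_lt (by norm_num)
  -- the points between the height of a point and the interpolated height
  have hmix : ∀ x ∈ S', ∀ t : ℝ, (0 ≤ t ∧ ∀ v s, Near x v → |t - (s : ℤ)| < 1 →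
      w (withValue v s) ≤ n) ∨ t = height α x → ∀ u : ℝ, 0 ≤ u → u ≤ 1 →
      withValue (fun i => collapse (x i)) ((1 - u) * t + u * height α x) ∈ S := by
    intro x hx t ht u hu hu'
    have hx0 := ((memS' x).1 hx).1
    obtain ⟨t₀, ht₀⟩ := hcommon x hx
    have hT0 := height_nonneg α x
    have hT : height α x ≤ t₀ := height_le α (Nat.cast_nonneg _) fun v hv => by
      exact_mod_cast (hlow v t₀ (ht₀ v hv)).1
    have ht0 : 0 ≤ t := by
      rcases ht with ht | rfl
      exacts [ht.1, hT0]
    refine (memS _ _).2 ⟨⟨hcol0 x hx0, by nlinarith⟩, fun v s hv hs => ?_⟩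
    have hvx := hcol x v hv
    -- A vertex near the collapsed point is within `2/3` of `x`. For other vertices near `x` this
    -- bound could fail, which is why the section passes through the collapse.
    have hαT : (α v : ℝ) ≤ height α x := le_height α fun i => abs_le_of_collapse (hv i)
    obtain ⟨hαt, hαw⟩ := hlow v t₀ (ht₀ v hvx)
    obtain ⟨hs1, hs2⟩ := abs_lt.1 hs
    -- Over `v` the good heights form an interval. Its members `a` and `b` are chosen on either side
    -- of `t`, with `a ≤ α v` and `t₀ ≤ b`; as `α v ≤ height α x ≤ t₀`, the whole segment lies in
    -- `[a, b]`, and an integer at distance less than `1` from it lies there too.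
    obtain ⟨a, b, ha, haw, hbw, hat, hbt, haα, hbt₀⟩ : ∃ a b : ℤ, 0 ≤ a ∧ w (withValue v a) ≤ n ∧
        w (withValue v b) ≤ n ∧ (a : ℝ) ≤ t ∧ t ≤ b ∧ a ≤ (α v : ℤ) ∧ (t₀ : ℤ) ≤ b := by
      rcases ht with ⟨-, ht⟩ | rfl
      · have h1 := ht v ⌊t⌋ hvx (near_floor (fun _ : Unit => t) ())
        have h2 := ht v ⌈t⌉ hvx (by
          rw [abs_lt]; constructor <;> linarith [Int.le_ceil t, Int.ceil_lt_add_one t])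
        have hv0 := hvx.nonneg hx0
        refine ⟨min ⌊t⌋ (α v), max ⌈t⌉ t₀, le_min (Int.floor_nonneg.2 ht0) (by omega), ?_, ?_, ?_,
          ?_, min_le_right _ _, le_max_right _ _⟩
        · rcases min_choice ⌊t⌋ ((α v : ℕ) : ℤ) with h | h <;> rw [h] <;> assumption
        · rcases max_choice ⌈t⌉ ((t₀ : ℕ) : ℤ) with h | h <;> rw [h]
          exacts [h2, ht₀ v hvx]
        · exact le_trans (by exact_mod_cast min_le_left _ _) (Int.floor_le t)
        · exact (Int.le_ceil t).trans (by exact_mod_cast le_max_left _ _)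
      · exact ⟨α v, t₀, by omega, hαw, ht₀ v hvx, by exact_mod_cast hαT, by exact_mod_cast hT,
          le_rfl, le_rfl⟩
    have haT : (a : ℝ) ≤ height α x := le_trans (by exact_mod_cast haα) hαT
    have hbT : height α x ≤ b := hT.trans (by exact_mod_cast hbt₀)
    have h1 : (a : ℝ) ≤ (1 - u) * t + u * height α x := by nlinarith
    have h2 : (1 - u) * t + u * height α x ≤ b := by nlinarith
    have h3 : (a : ℝ) - 1 < s := by linarith
    have h4 : (s : ℝ) < b + 1 := by linarith
    have h3' : a - 1 < s := by exact_mod_cast h3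
    have h4' : s < b + 1 := by exact_mod_cast h4
    exact hconv v (hvx.nonneg hx0) a s b ha (by omega) (by omega) haw hbw
  -- the three maps
  let F : C(↥S, ↥S') := ⟨fun x => ⟨fun i => x.1 (some i), hproj _ (x.1 none) (by
    rw [withValue_eta]; exact x.2)⟩, by
    refine Continuous.subtype_mk ?_ _
    exact continuous_pi fun i => (continuous_apply (some i)).comp continuous_subtype_val⟩
  have hG : ∀ x ∈ S', withValue (fun i => collapse (x i)) (height α x) ∈ S := fun x hx => by
    have := hmix x hx _ (Or.inr rfl) 0 le_rfl zero_le_one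
    simpa using this
  have hcont : ∀ {Z : Type} [TopologicalSpace Z] (a : Z → W → ℝ) (b : Z → ℝ), Continuous a →
      Continuous b → Continuous fun z => withValue (a z) (b z) := fun a b ha hb =>
    continuous_pi fun o => by
      rcases o with _ | i
      exacts [hb, (continuous_apply i).comp ha]
  let G : C(↥S', ↥S) := ⟨fun x => ⟨_, hG x.1 x.2⟩, by
    refine Continuous.subtype_mk (hcont _ _ ?_ ?_) _
    · exact continuous_pi fun i => continuous_collapse.comp
        ((continuous_apply i).comp continuous_subtype_val)
    · exact (continuous_height α).comp continuous_subtype_val⟩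
  have hM : ∀ x t, withValue x t ∈ S → ∀ u : ℝ, 0 ≤ u → u ≤ 1 →
      withValue (fun i => (1 - u) * x i + u * collapse (x i)) t ∈ S := by
    intro x t h u hu hu'
    obtain ⟨⟨h0, h1⟩, h2⟩ := (memS x t).1 h
    refine (memS _ _).2 ⟨⟨fun i => ?_, h1⟩, fun v s hv hs => h2 v s (near_of_near_mix hu hu' hv) hs⟩
    have h3 : 0 ≤ x i := h0 i
    have h4 : 0 ≤ collapse (x i) := hcol0 x h0 i
    simp only [Pi.zero_apply]
    nlinarith
  -- The filtration ignores the additional coordinate, so the new height `t'` can be any nonnegative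
  -- number.
  have hM' : ∀ p x t, withValue x t ∈ filtPart (fun l : Option W → ℤ => φ fun i => l (some i)) p →
      ∀ t' : ℝ, 0 ≤ t' → ∀ u : ℝ, 0 ≤ u → u ≤ 1 →
      withValue (fun i => (1 - u) * x i + u * collapse (x i)) t' ∈
        filtPart (fun l : Option W → ℤ => φ fun i => l (some i)) p := by
    intro p x t h t' ht' u hu hu'
    obtain ⟨⟨h0, h1⟩, h2⟩ := (memA p x t).1 h
    refine (memA p _ _).2 ⟨⟨fun i => ?_, ht'⟩, fun v hv => h2 v (near_of_near_mix hu hu' hv)⟩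
    have h3 : 0 ≤ x i := h0 i
    have h4 : 0 ≤ collapse (x i) := hcol0 x h0 i
    simp only [Pi.zero_apply]
    nlinarith
  have hcol1 : ∀ x : W → ℝ, (fun i => collapse (x i)) =
      fun i => (1 - (1 : ℝ)) * x i + 1 * collapse (x i) := fun x => by funext i; ring
  -- The identity is joined to `G ∘ F` through `M`. From the identity to `M` points move
  -- horizontally inside their smallest cube; from `M` to `G ∘ F` they move vertically over a
  -- collapsed point, where `hmix` applies.
  let M : C(↥S, ↥S) := ⟨fun x => ⟨withValue (fun i => collapse (x.1 (some i))) (x.1 none), by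
      rw [hcol1]
      exact hM _ _ (by rw [withValue_eta]; exact x.2) 1 zero_le_one le_rfl⟩, by
    refine Continuous.subtype_mk (hcont _ _ ?_ ?_) _
    · exact continuous_pi fun i => continuous_collapse.comp
        ((continuous_apply (some i)).comp continuous_subtype_val)
    · exact (continuous_apply none).comp continuous_subtype_val⟩
  set A : ℤ → Set (Option W → ℝ) := filtPart (fun l : Option W → ℤ => φ fun i => l (some i)) with hAd
  have hA : Monotone fun p => (Subtype.val ⁻¹' A p : Set ↥S) :=
    fun _ _ hp => Set.preimage_mono (filtPart_mono _ hp)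
  have hA' : Monotone fun p => (Subtype.val ⁻¹' filtPart φ p : Set ↥S') :=
    fun _ _ hp => Set.preimage_mono (filtPart_mono _ hp)
  have hFA : ∀ p, Set.MapsTo F (Subtype.val ⁻¹' A p) (Subtype.val ⁻¹' filtPart φ p) := by
    intro p x hx
    have hx' : withValue (fun i => x.1 (some i)) (x.1 none) ∈ A p := by
      rw [withValue_eta]; exact hx
    obtain ⟨⟨h0, -⟩, h2⟩ := (memA p _ _).1 hx'
    exact (memA' p _).2 ⟨h0, h2⟩
  have hGA : ∀ p, Set.MapsTo G (Subtype.val ⁻¹' filtPart φ p) (Subtype.val ⁻¹' A p) := by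
    intro p x hx
    obtain ⟨h0, h2⟩ := (memA' p _).1 hx
    exact (memA p _ _).2 ⟨⟨hcol0 _ h0, height_nonneg _ _⟩, fun v hv => h2 v (hcol _ _ hv)⟩
  have hMA : ∀ p, Set.MapsTo M (Subtype.val ⁻¹' A p) (Subtype.val ⁻¹' A p) := by
    intro p x hx
    have hx' : withValue (fun i => x.1 (some i)) (x.1 none) ∈ A p := by
      rw [withValue_eta]; exact hx
    change withValue _ _ ∈ A p
    rw [hcol1]
    exact hM' p _ _ hx' _ ((memA p _ _).1 hx').1.2 1 zero_le_one le_rfl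
  change PageEquiv (filteredSingularChains _ hA) (filteredSingularChains _ hA')
  refine ⟨filteredMap hA hA' F hFA, filteredMap hA' hA G hGA, fun k hk p m => ⟨fun x => ?_,
    fun x => ?_⟩⟩
  · rw [filteredMap_comp_page]
    refine Eq.trans ?_ (filteredMap_id_page hA k p m x)
    refine Eq.trans (b := (filteredMap hA hA M hMA).page k p m x) (Eq.symm ?_) (Eq.symm ?_)
    · refine filteredMap_page_eq_of_segment hA hA hMA _ (fun x u hu hu' => ?_)
        (fun p x hx u hu hu' => ?_) hk p m x
      · have hx' : withValue (fun i => x.1 (some i)) (x.1 none) ∈ S := by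
          rw [withValue_eta]; exact x.2
        have := hmix _ (hproj _ _ hx') (x.1 none) (Or.inl ⟨((memS _ _).1 hx').1.2,
          ((memS _ _).1 hx').2⟩) u hu hu'
        convert this using 1
        funext o
        cases o
        · rfl
        · exact (fun a => by ring : ∀ a : ℝ, (1 - u) * a + u * a = a) _
      · have hx' : withValue (fun i => x.1 (some i)) (x.1 none) ∈ A p := by
          rw [withValue_eta]; exact hx
        have h0 : 0 ≤ x.1 none := ((memA p _ _).1 hx').1.2
        have hT := height_nonneg α (fun i => x.1 (some i))
        have := hM' p _ _ hx' ((1 - u) * x.1 none + u * height α (fun i => x.1 (some i)))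
          (by nlinarith) 1 zero_le_one le_rfl
        rw [← hcol1] at this
        convert this using 1
        funext o
        cases o
        · rfl
        · exact (fun a => by ring : ∀ a : ℝ, (1 - u) * a + u * a = a) _
    · refine filteredMap_page_eq_of_segment hA hA _ hMA (fun x u hu hu' => ?_)
        (fun p x hx u hu hu' => ?_) hk p m x
      · have hx' : withValue (fun i => x.1 (some i)) (x.1 none) ∈ S := by
          rw [withValue_eta]; exact x.2
        convert hM _ _ hx' u hu hu' using 1
        funext o
        cases o
        · exact (fun a => by ring : ∀ a : ℝ, (1 - u) * a + u * a = a) _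
        · rfl
      · have hx' : withValue (fun i => x.1 (some i)) (x.1 none) ∈ A p := by
          rw [withValue_eta]; exact hx
        convert hM' p _ _ hx' _ ((memA p _ _).1 hx').1.2 u hu hu' using 1
        funext o
        cases o
        · exact (fun a => by ring : ∀ a : ℝ, (1 - u) * a + u * a = a) _
        · rfl
  · rw [filteredMap_comp_page]
    refine Eq.trans (Eq.symm ?_) (filteredMap_id_page hA' k p m x)
    refine filteredMap_page_eq_of_segment hA' hA' _ _ (fun x u hu hu' => ?_)
        (fun p x hx u hu hu' => ?_) hk p m x
    · have hx0 := ((memS' _).1 x.2).1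
      refine (memS' _).2 ⟨fun i => ?_, fun v hv =>
        ((memS' _).1 x.2).2 v (near_of_near_mix hu hu' hv)⟩
      have h3 : 0 ≤ x.1 i := hx0 i
      have h4 : 0 ≤ collapse (x.1 i) := hcol0 _ hx0 i
      change 0 ≤ (1 - u) * x.1 i + u * collapse (x.1 i)
      nlinarith
    · obtain ⟨hx0, hx1⟩ := (memA' p _).1 hx
      refine (memA' p _).2 ⟨fun i => ?_, fun v hv => hx1 v (near_of_near_mix hu hu' hv)⟩
      have h3 : 0 ≤ x.1 i := hx0 i
      have h4 : 0 ≤ collapse (x.1 i) := hcol0 _ hx0 i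
      change 0 ≤ (1 - u) * x.1 i + u * collapse (x.1 i)
      nlinarith

end Elimination

/-- Relabelling the coordinates. -/
theorem pageEquiv_reindex {W W' : Type} [Fintype W] [Fintype W'] (σ : W ≃ W')
    (w φ : (W → ℤ) → ℚ) (hφ : Antitone φ) (w' φ' : (W' → ℤ) → ℚ)
    (hw : ∀ l, w' l = w fun i => l (σ i)) (hφ' : ∀ l, φ' l = φ fun i => l (σ i)) (n : ℤ) :
    PageEquiv (latticeFilteredChains w φ n) (latticeFilteredChains w' φ' n) := by
  have hφa : Antitone φ' := fun a b hab => by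
    rw [hφ', hφ']; exact hφ fun i => hab (σ i)
  have hS : ∀ x : W' → ℝ, (fun i => x (σ i)) ∈ sublevel w n ↔ x ∈ sublevel w' n := by
    intro x
    rw [mem_sublevel_iff, mem_sublevel_iff]
    refine and_congr ⟨fun h i => by simpa using h (σ.symm i), fun h i => h (σ i)⟩
      ⟨fun h v hv => ?_, fun h v hv => ?_⟩
    · rw [hw]; exact h _ fun i => hv (σ i)
    · have := h (fun i => v (σ.symm i)) fun i => by simpa using hv (σ.symm i)
      rw [hw] at this
      simpa using this
  have hA : ∀ p (x : W' → ℝ), (fun i => x (σ i)) ∈ filtPart φ p ↔ x ∈ filtPart φ' p := by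
    intro p x
    rw [mem_filtPart_iff hφ, mem_filtPart_iff hφa]
    refine and_congr ⟨fun h i => by simpa using h (σ.symm i), fun h i => h (σ i)⟩
      ⟨fun h v hv => ?_, fun h v hv => ?_⟩
    · rw [hφ']; exact h _ fun i => hv (σ i)
    · have := h (fun i => v (σ.symm i)) fun i => by simpa using hv (σ.symm i)
      rw [hφ'] at this
      simpa using this
  have hσ : ∀ x : W → ℝ, (fun i => (fun j => x (σ.symm j)) (σ i)) = x := fun x => by
    funext i; simp
  let F : C(↥(sublevel w n), ↥(sublevel w' n)) := ⟨fun x => ⟨fun j => x.1 (σ.symm j), by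
    rw [← hS, hσ]; exact x.2⟩, by
    refine Continuous.subtype_mk ?_ _
    exact continuous_pi fun j => (continuous_apply (σ.symm j)).comp continuous_subtype_val⟩
  let G : C(↥(sublevel w' n), ↥(sublevel w n)) := ⟨fun x => ⟨fun i => x.1 (σ i), (hS _).2 x.2⟩,
    by
    refine Continuous.subtype_mk ?_ _
    exact continuous_pi fun i => (continuous_apply (σ i)).comp continuous_subtype_val⟩
  have hFA : ∀ p, Set.MapsTo F (Subtype.val ⁻¹' filtPart φ p) (Subtype.val ⁻¹' filtPart φ' p) := by
    intro p x hx
    change (fun j => x.1 (σ.symm j)) ∈ filtPart φ' p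
    rw [← hA, hσ]; exact hx
  have hGA : ∀ p, Set.MapsTo G (Subtype.val ⁻¹' filtPart φ' p) (Subtype.val ⁻¹' filtPart φ p) :=
    fun p x hx => (hA p _).2 hx
  have hm : Monotone fun p => (Subtype.val ⁻¹' filtPart φ p : Set ↥(sublevel w n)) :=
    fun _ _ hp => Set.preimage_mono (filtPart_mono _ hp)
  have hm' : Monotone fun p => (Subtype.val ⁻¹' filtPart φ' p : Set ↥(sublevel w' n)) :=
    fun _ _ hp => Set.preimage_mono (filtPart_mono _ hp)
  have hGF : G.comp F = ContinuousMap.id _ := by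
    ext x i
    change x.1 (σ.symm (σ i)) = x.1 i
    rw [σ.symm_apply_apply]
  have hFG : F.comp G = ContinuousMap.id _ := by
    ext x i
    change x.1 (σ (σ.symm i)) = x.1 i
    rw [σ.apply_symm_apply]
  change PageEquiv (filteredSingularChains _ hm) (filteredSingularChains _ hm')
  refine ⟨filteredMap hm hm' F hFA, filteredMap hm' hm G hGA, fun k hk p m => ⟨fun x => ?_,
    fun x => ?_⟩⟩
  · rw [filteredMap_comp_page]
    refine Eq.trans ?_ (filteredMap_id_page hm k p m x)
    simp only [hGF]
  · rw [filteredMap_comp_page]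
    refine Eq.trans ?_ (filteredMap_id_page hm' k p m x)
    simp only [hFG]

end FilteredLattice

namespace FilteredLattice

/-! ## A minimax principle over the vertices of a cube -/

section Minimax

variable {V ι : Type} (lab : V → ι)

/-- The set which agrees with `K'` on the branch `b`, and with `K` elsewhere. -/
def exchange (b : ι) (K K' : Finset V) : Finset V :=
  K.filter (fun v => lab v ≠ b) ∪ K'.filter (fun v => lab v = b)

theorem mem_exchange {b : ι} {K K' : Finset V} {v : V} :
    v ∈ exchange lab b K K' ↔ if lab v = b then v ∈ K' else v ∈ K := by
  simp only [exchange, Finset.mem_union, Finset.mem_filter]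
  split_ifs with h <;> simp [h]

theorem exchange_subset {b : ι} {K K' I : Finset V} (hK : K ⊆ I) (hK' : K' ⊆ I) :
    exchange lab b K K' ⊆ I := fun v hv => by
  rw [mem_exchange] at hv
  split_ifs at hv
  exacts [hK' hv, hK hv]

theorem card_symmDiff_exchange_lt {K K' : Finset V} {v : V} (hv : v ∈ symmDiff K K') :
    (symmDiff (exchange lab (lab v) K K') K').card < (symmDiff K K').card := by
  refine Finset.card_lt_card ((Finset.ssubset_iff_of_subset fun a ha => ?_).2 ⟨v, hv, ?_⟩)
  · rw [Finset.mem_symmDiff, mem_exchange] at ha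
    rw [Finset.mem_symmDiff]
    split_ifs at ha <;> tauto
  · rw [Finset.mem_symmDiff, mem_exchange, if_pos rfl]
    tauto

/-- Suppose that functions `w K` of an integer, indexed by the subsets of `I`, have intervals as
sublevel sets for the level `n`, are additive under the exchange of branches, that changing a branch
changes the slope by at most one, and that sublevel sets of two functions which differ on a single
branch meet. Then all the sublevel sets have a common element. -/
theorem exists_common_of_exchange (I : Finset V) (w : Finset V → ℤ → ℤ) (n : ℤ)
    (hconv : ∀ K ⊆ I, ∀ a b c, a ≤ b → b ≤ c → w K a ≤ n → w K c ≤ n → w K b ≤ n)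
    (hadd : ∀ K ⊆ I, ∀ K' ⊆ I, ∀ b t,
      w (exchange lab b K K') t + w (exchange lab b K' K) t = w K t + w K' t)
    (hslope : ∀ K ⊆ I, ∀ K' ⊆ I, ∀ b, (∀ v, lab v ≠ b → (v ∈ K ↔ v ∈ K')) → ∀ t,
      (w K' (t + 1) - w K' t) - (w K (t + 1) - w K t) ≤ 1)
    (hmeet : ∀ K ⊆ I, ∀ K' ⊆ I, ∀ b, (∀ v, lab v ≠ b → (v ∈ K ↔ v ∈ K')) →
      ∃ t, w K t ≤ n ∧ w K' t ≤ n) (b₀ : ι) :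
    ∃ t, ∀ K ⊆ I, w K t ≤ n := by
  by_contra hcon
  push Not at hcon
  have hτ : ∀ K : Finset V, ∃ t, K ⊆ I → w K t ≤ n := fun K => by
    by_cases hK : K ⊆ I
    · obtain ⟨t, ht, -⟩ := hmeet K hK K hK b₀ fun _ _ => Iff.rfl
      exact ⟨t, fun _ => ht⟩
    · exact ⟨0, fun h => absurd h hK⟩
  choose τ hτ using hτ
  -- Since sublevel sets are intervals, `R K t` means that the one of `w K` is nonempty and lies
  -- strictly to the right of `t`.
  let R : Finset V → ℤ → Prop := fun K t => n < w K t ∧ ∃ t₀ > t, w K t₀ ≤ n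
  have hRτ : ∀ K ⊆ I, ∀ t, R K t → t < τ K := by
    rintro K hK t ⟨h1, t₀, h2, h3⟩
    by_contra h4
    exact absurd (hconv K hK _ t t₀ (not_lt.1 h4) h2.le (hτ K hK) h3) (not_le.2 h1)
  obtain ⟨M, hM⟩ := (I.powerset.image τ).exists_le
  obtain ⟨m, hm⟩ := (I.powerset.image τ).bddBelow
  -- The contradiction comes from the greatest `t` for which some sublevel set lies to its right.
  -- Such `t` are bounded by the points `τ K`, and one exists because left of all `τ K` a function
  -- above `n` has its sublevel set on the right.
  obtain ⟨t, ⟨KR, hKR, hR⟩, htmax⟩ := Int.exists_greatest_of_bdd (P := fun t => ∃ K ⊆ I, R K t)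
    ⟨M, fun t ⟨K, hK, h⟩ => (hRτ K hK t h).le.trans
      (hM _ (Finset.mem_image_of_mem _ (Finset.mem_powerset.2 hK)))⟩ (by
    obtain ⟨K, hK, h⟩ := hcon (m - 1)
    refine ⟨m - 1, K, hK, h, τ K, ?_, hτ K hK⟩
    have := hm (Finset.mem_coe.2 (Finset.mem_image_of_mem τ (Finset.mem_powerset.2 hK)))
    change m ≤ τ K at this
    change m - 1 < τ K
    omega)
  -- a common maximizer at `t` and `t + 1`
  let Q : ℤ → Finset V → Prop := fun t K => K ⊆ I ∧ ∀ K' ⊆ I, w K' t ≤ w K t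
  have hQ : ∀ t, ∃ K, Q t K := fun t => by
    obtain ⟨K, hK, h⟩ := I.powerset.exists_max_image (fun K => w K t)
      ⟨∅, Finset.empty_mem_powerset I⟩
    exact ⟨K, Finset.mem_powerset.1 hK, fun K' hK' => h K' (Finset.mem_powerset.2 hK')⟩
  obtain ⟨K₀, hK₀, hK₀'⟩ : ∃ K, Q t K ∧ Q (t + 1) K := by
    have key : ∀ d : ℕ, ∀ K₁ K₂, (symmDiff K₁ K₂).card = d → Q t K₁ → Q (t + 1) K₂ →
        ∃ K, Q t K ∧ Q (t + 1) K := by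
      intro d
      induction d using Nat.strong_induction_on with
      | _ d ih =>
        rintro K₁ K₂ rfl h₁ h₂
        rcases (symmDiff K₁ K₂).eq_empty_or_nonempty with h | ⟨v, hv⟩
        · have : K₁ = K₂ := symmDiff_eq_bot.1 h
          subst this
          exact ⟨K₁, h₁, h₂⟩
        have e₁ := hadd K₁ h₁.1 K₂ h₂.1 (lab v) t
        have e₂ := hadd K₁ h₁.1 K₂ h₂.1 (lab v) (t + 1)
        have s₁ := exchange_subset lab (b := lab v) h₁.1 h₂.1
        have s₂ := exchange_subset lab (b := lab v) h₂.1 h₁.1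
        have hs := hslope _ s₂ K₂ h₂.1 (lab v)
          (fun a ha => by rw [mem_exchange, if_neg ha]) t
        have m₁ := h₁.2 _ s₁
        have m₂ := h₂.2 _ s₂
        -- If replacing the branch loses at `t`, additivity and integrality make the opposite
        -- exchange gain at least one over `K₂` at `t`; the slope bound costs at most one, so the
        -- opposite exchange is still maximal at `t + 1`. Either way the two maximizers come closer.
        rcases eq_or_ne (w (exchange lab (lab v) K₁ K₂) t) (w K₁ t) with h | h
        · exact ih _ (card_symmDiff_exchange_lt lab hv) _ _ rfl
            ⟨s₁, fun K' hK' => h ▸ h₁.2 K' hK'⟩ h₂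
        · have h' : w (exchange lab (lab v) K₂ K₁) (t + 1) = w K₂ (t + 1) := by omega
          refine ih _ ?_ K₁ _ rfl h₁ ⟨s₂, fun K' hK' => h' ▸ h₂.2 K' hK'⟩
          rw [symmDiff_comm K₁ K₂] at hv ⊢
          rw [symmDiff_comm K₁]
          exact card_symmDiff_exchange_lt lab hv
    obtain ⟨K₁, h₁⟩ := hQ t
    obtain ⟨K₂, h₂⟩ := hQ (t + 1)
    exact key _ K₁ K₂ rfl h₁ h₂
  have hK₀n : n < w K₀ t := hR.1.trans_le (hK₀.2 KR hKR)
  have hK₀n' : n < w K₀ (t + 1) := by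
    obtain ⟨K, hK, h⟩ := hcon (t + 1)
    exact h.trans_le (hK₀'.2 K hK)
  -- it has a small value on the right of `t`
  have hR₀ : R K₀ t := by
    have key : ∀ d : ℕ, ∀ K ⊆ I, (symmDiff K K₀).card = d → R K t → R K₀ t := by
      intro d
      induction d using Nat.strong_induction_on with
      | _ d ih =>
        rintro K hK rfl ⟨h1, t₁, h2, h3⟩
        rcases (symmDiff K K₀).eq_empty_or_nonempty with h | ⟨v, hv⟩
        · have : K = K₀ := symmDiff_eq_bot.1 h
          subst this
          exact ⟨h1, t₁, h2, h3⟩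
        have s₁ := exchange_subset lab (b := lab v) hK hK₀.1
        have s₂ := exchange_subset lab (b := lab v) hK₀.1 hK
        have e₁ := hadd K hK K₀ hK₀.1 (lab v) t
        have m₁ := hK₀.2 _ s₂
        obtain ⟨t₀, h4, h5⟩ := hmeet K hK _ s₁ (lab v)
          (fun a ha => by rw [mem_exchange, if_neg ha])
        -- By additivity and maximality of `K₀`, moving one branch towards `K₀` does not lower the
        -- value at `t`. The new sublevel set meets the old one, which lies to the right of `t`.
        refine ih _ (card_symmDiff_exchange_lt lab hv) _ s₁ rfl ⟨by omega, t₀, ?_, h5⟩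
        by_contra h6
        exact absurd (hconv K hK _ t t₁ (not_lt.1 h6) h2.le h4 h3) (not_le.2 h1)
    exact key _ KR hKR rfl hR
  obtain ⟨-, t₀, h1, h2⟩ := hR₀
  -- `K₀` exceeds `n` at `t + 1` as well, so its sublevel set lies to the right of `t + 1`, against
  -- the choice of `t`.
  have h3 : t₀ ≠ t + 1 := by rintro rfl; omega
  have := htmax (t + 1) ⟨K₀, hK₀.1, hK₀n', t₀, by omega, h2⟩
  omega

end Minimax

/-! ## Riemann–Roch functions on lattices -/

/-- The combinatorial data of a negative definite plumbing graph: an integral symmetric form with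
nonnegative entries off the diagonal, the function `X = χ`, a linear twist `c`, which stands for the
intersection numbers with `s_h`, and a strictly positive vector `r` with negative intersection
numbers. -/
structure TwistedLattice (V : Type) [Fintype V] where
  /-- the form -/
  g : V → V → ℤ
  g_symm : ∀ a b, g a b = g b a
  g_nonneg : ∀ a b, a ≠ b → 0 ≤ g a b
  /-- the untwisted Riemann–Roch function -/
  X : (V → ℤ) → ℤ
  two_X : ∀ x, 2 * X x = ∑ a, x a * (g a a + 2) - ∑ a, x a * ∑ b, x b * g b a
  /-- the twist -/
  c : V → ℤ
  /-- a strictly antinef vector -/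
  r : V → ℤ
  r_pos : ∀ a, 0 < r a
  r_neg : ∀ a, ∑ b, r b * g b a < 0

namespace TwistedLattice

variable {V : Type} [Fintype V] (T : TwistedLattice V)

/-- The intersection number with a base element. -/
def pr (x : V → ℤ) (a : V) : ℤ := ∑ b, x b * T.g b a

/-- The twisted intersection number with a base element. -/
def N (x : V → ℤ) (a : V) : ℤ := T.pr x a + T.c a

/-- The twisted Riemann–Roch function. -/
def f (x : V → ℤ) : ℤ := T.X x - ∑ a, x a * T.c a

theorem pr_add (x y : V → ℤ) (a : V) : T.pr (x + y) a = T.pr x a + T.pr y a := by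
  simp only [pr, Pi.add_apply, add_mul, Finset.sum_add_distrib]

theorem N_add (x y : V → ℤ) (a : V) : T.N (x + y) a = T.N x a + T.pr y a := by
  unfold N; rw [pr_add]; ring

theorem pr_single (a b : V) : T.pr (Pi.single a 1) b = T.g a b := by
  simp [pr, Pi.single_apply]

theorem sum_mul_pr_comm (x y : V → ℤ) : ∑ a, x a * T.pr y a = ∑ a, y a * T.pr x a := by
  simp only [pr, Finset.mul_sum]
  rw [Finset.sum_comm]
  refine Finset.sum_congr rfl fun a _ => Finset.sum_congr rfl fun b _ => ?_
  rw [T.g_symm]; ring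

theorem X_add (x y : V → ℤ) : T.X (x + y) = T.X x + T.X y - ∑ a, y a * T.pr x a := by
  have h1 := T.two_X (x + y)
  have h2 := T.two_X x
  have h3 := T.two_X y
  have h4 : ∑ a, (x + y) a * ∑ b, (x + y) b * T.g b a = ∑ a, x a * ∑ b, x b * T.g b a +
      ∑ a, y a * ∑ b, y b * T.g b a + 2 * ∑ a, y a * T.pr x a := by
    change ∑ a, (x + y) a * T.pr (x + y) a = ∑ a, x a * T.pr x a + ∑ a, y a * T.pr y a + _
    simp only [pr_add, Pi.add_apply, mul_add, add_mul, Finset.sum_add_distrib]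
    rw [T.sum_mul_pr_comm x y]; ring
  have h6 : ∑ a, (x + y) a * (T.g a a + 2) =
      ∑ a, x a * (T.g a a + 2) + ∑ a, y a * (T.g a a + 2) := by
    simp only [Pi.add_apply, add_mul, Finset.sum_add_distrib]
  linarith

theorem X_zero : T.X 0 = 0 := by
  have := T.two_X 0
  simp at this
  exact this

theorem X_single (a : V) : T.X (Pi.single a 1) = 1 := by
  have h := T.two_X (Pi.single a 1)
  simp [Pi.single_apply] at h
  linarith

theorem X_add_single (x : V → ℤ) (a : V) : T.X (x + Pi.single a 1) = T.X x + 1 - T.pr x a := by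
  rw [X_add, X_single]; simp [Pi.single_apply]

theorem f_add (x y : V → ℤ) : T.f (x + y) = T.f x + T.X y - ∑ a, y a * T.N x a := by
  simp only [f, X_add, N, mul_add, Finset.sum_add_distrib, Pi.add_apply, add_mul]
  ring

theorem f_add_single (x : V → ℤ) (a : V) : T.f (x + Pi.single a 1) = T.f x + 1 - T.N x a := by
  rw [f_add, X_single]; simp [Pi.single_apply]

theorem pr_nonneg {x : V → ℤ} {a : V} (hx : 0 ≤ x) (ha : x a = 0) : 0 ≤ T.pr x a := by
  refine Finset.sum_nonneg fun b _ => ?_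
  rcases eq_or_ne b a with rfl | h
  · rw [ha, zero_mul]
  · exact mul_nonneg (hx b) (T.g_nonneg _ _ h)

theorem N_mono {x y : V → ℤ} {a : V} (h : x ≤ y) (ha : x a = y a) : T.N x a ≤ T.N y a := by
  have h1 : y = x + (y - x) := by abel
  have h2 := T.pr_nonneg (x := y - x) (a := a) (sub_nonneg.2 h) (by simp [ha])
  rw [h1, N_add]
  linarith

/-- At `a` the infimum agrees with the smaller of the two vectors, and lowering the other
coordinates lowers the intersection number because the entries off the diagonal are nonnegative.
Closure under infima is what provides least antinef elements. -/
theorem N_inf {x y : V → ℤ} {a : V} (hx : T.N x a ≤ 0) (hy : T.N y a ≤ 0) : T.N (x ⊓ y) a ≤ 0 := by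
  rcases le_total (x a) (y a) with h | h
  · exact (T.N_mono inf_le_left (by simp [h])).trans hx
  · exact (T.N_mono inf_le_right (by simp [h])).trans hy

/-- The vectors with the given coordinates outside of `A` which are antinef on `A`. -/
def fiber (A : Finset V) (l : V → ℤ) : Set (V → ℤ) :=
  {x | (∀ b, b ∉ A → x b = l b) ∧ ∀ a ∈ A, T.N x a ≤ 0}

theorem fiber_nonempty (A : Finset V) (l : V → ℤ) : (T.fiber A l).Nonempty := by
  let y : V → ℤ := fun b => if b ∈ A then 0 else l b
  set k : ℤ := ∑ a, |T.N y a| with hk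
  have hk0 : 0 ≤ k := Finset.sum_nonneg fun _ _ => abs_nonneg _
  -- The multiple `k` dominates every `T.N y a`, while `k * r` contributes at most `-k`; cutting it
  -- off outside `A` only omits nonnegative terms.
  refine ⟨fun b => if b ∈ A then k * T.r b else l b, fun b hb => if_neg hb, fun a ha => ?_⟩
  have h1 : (fun b => if b ∈ A then k * T.r b else l b) =
      y + fun b => if b ∈ A then k * T.r b else 0 := by
    funext b; simp only [y, Pi.add_apply]; split_ifs <;> ring
  rw [h1, N_add]
  have h2 : T.pr (fun b => if b ∈ A then k * T.r b else 0) a ≤ k * T.pr T.r a := by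
    unfold pr
    rw [Finset.mul_sum]
    refine Finset.sum_le_sum fun b _ => ?_
    dsimp only
    split_ifs with hb
    · linarith
    · have hba : b ≠ a := fun h => hb (h ▸ ha)
      have := mul_nonneg (mul_nonneg hk0 (T.r_pos b).le) (T.g_nonneg b a hba)
      linarith
  have h3 : T.pr T.r a ≤ -1 := by have := T.r_neg a; unfold pr; omega
  have h4 : T.N y a ≤ k := (le_abs_self _).trans
    (Finset.single_le_sum (f := fun a => |T.N y a|) (fun _ _ => abs_nonneg _) (Finset.mem_univ a))
  nlinarith

/-- A minimum principle: let `a` minimize `x b / r b`. If `x a < 0` and `a ∈ A`, comparison of `x`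
with the multiple of `r` that agrees with it at `a` turns antinefness at `a` into a lower bound for
this ratio; if `a ∉ A`, the coordinate is prescribed. The bound on the least ratio bounds all
coordinates. -/
theorem fiber_bddBelow (A : Finset V) (l : V → ℤ) : BddBelow (T.fiber A l) := by
  set k : ℤ := ∑ a, (|T.c a| + |l a|) with hk
  have hka : ∀ a, |T.c a| + |l a| ≤ k := fun a =>
    Finset.single_le_sum (f := fun a => |T.c a| + |l a|)
      (fun _ _ => add_nonneg (abs_nonneg _) (abs_nonneg _)) (Finset.mem_univ a)
  refine ⟨fun b => -k * T.r b, fun x hx i => ?_⟩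
  obtain ⟨a, -, ha⟩ := Finset.univ.exists_min_image (fun b => (x b : ℚ) / T.r b) ⟨i, Finset.mem_univ i⟩
  have hcross : ∀ b, x a * T.r b ≤ T.r a * x b := fun b => by
    have h1 := ha b (Finset.mem_univ b)
    rw [div_le_div_iff₀ (by exact_mod_cast T.r_pos a) (by exact_mod_cast T.r_pos b)] at h1
    have h2 : x a * T.r b ≤ x b * T.r a := by exact_mod_cast h1
    linarith
  have hra := T.r_pos a
  have hri := T.r_pos i
  have hk0 : 0 ≤ k := le_trans (add_nonneg (abs_nonneg _) (abs_nonneg _)) (hka a)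
  suffices h : -k * T.r a ≤ x a by
    have h1 := hcross i
    have h2 : -k * T.r a * T.r i ≤ T.r a * x i := le_trans (by nlinarith) h1
    by_contra h3
    simp only [not_le] at h3
    nlinarith
  rcases le_or_gt 0 (x a) with h0 | h0
  · nlinarith
  by_cases haA : a ∈ A
  · have h1 := hx.2 a haA
    have h2 : x a * T.pr T.r a ≤ T.r a * T.pr x a := by
      unfold pr
      rw [Finset.mul_sum, Finset.mul_sum]
      refine Finset.sum_le_sum fun b _ => ?_
      rcases eq_or_ne b a with rfl | hb
      · linarith
      · have := mul_le_mul_of_nonneg_right (hcross b) (T.g_nonneg b a hb)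
        linarith
    have h3 : T.pr T.r a ≤ -1 := by have := T.r_neg a; unfold pr; omega
    have h4 := hka a
    have h5 := neg_abs_le (T.c a)
    have h6 := abs_nonneg (l a)
    unfold N at h1
    have h7 : -k ≤ T.c a := by linarith
    have h8 : - x a ≤ x a * T.pr T.r a := by nlinarith
    have h9 : T.r a * T.pr x a ≤ T.r a * (- T.c a) := by nlinarith
    nlinarith
  · have h4 := hka a
    have h5 := neg_abs_le (l a)
    have h6 := abs_nonneg (T.c a)
    rw [hx.1 a haA]
    nlinarith

/-- An element with the least coordinate sum is least, since its infimum with any other element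
stays in the fiber. -/
theorem exists_isLeast_fiber (A : Finset V) (l : V → ℤ) : ∃ x, IsLeast (T.fiber A l) x := by
  obtain ⟨m, hm⟩ := T.fiber_bddBelow A l
  obtain ⟨_, ⟨x, hx, rfl⟩, h⟩ := Int.exists_least_of_bdd (P := fun z => ∃ x ∈ T.fiber A l, ∑ i, x i = z)
    ⟨∑ i, m i, by
      rintro _ ⟨x, hx, rfl⟩
      exact Finset.sum_le_sum fun i _ => hm hx i⟩
    (by
      obtain ⟨x, hx⟩ := T.fiber_nonempty A l
      exact ⟨_, x, hx, rfl⟩)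
  refine ⟨x, hx, fun y hy => ?_⟩
  have hxy : x ⊓ y ∈ T.fiber A l :=
    ⟨fun b hb => by simp [hx.1 b hb, hy.1 b hb], fun a ha => T.N_inf (hx.2 a ha) (hy.2 a ha)⟩
  have h1 := h _ ⟨_, hxy, rfl⟩
  have h2 : ∀ i ∈ Finset.univ, (x ⊓ y) i ≤ x i := fun i _ => inf_le_left
  have h3 := (Finset.sum_eq_sum_iff_of_le h2).1 (le_antisymm (Finset.sum_le_sum h2) h1)
  exact fun i => by
    rw [← h3 i (Finset.mem_univ i)]
    exact inf_le_right

/-- The least vector with the given coordinates outside of `A` which is antinef on `A`. -/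
def lift (A : Finset V) (l : V → ℤ) : V → ℤ := (T.exists_isLeast_fiber A l).choose

theorem isLeast_lift (A : Finset V) (l : V → ℤ) : IsLeast (T.fiber A l) (T.lift A l) :=
  (T.exists_isLeast_fiber A l).choose_spec

variable {T} {A : Finset V} {l l' : V → ℤ}

theorem lift_off {b : V} (hb : b ∉ A) : T.lift A l b = l b := (T.isLeast_lift A l).1.1 b hb

theorem N_lift {a : V} (ha : a ∈ A) : T.N (T.lift A l) a ≤ 0 := (T.isLeast_lift A l).1.2 a ha

theorem lift_le {x : V → ℤ} (h1 : ∀ b, b ∉ A → x b = l b) (h2 : ∀ a ∈ A, T.N x a ≤ 0) :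
    T.lift A l ≤ x := (T.isLeast_lift A l).2 ⟨h1, h2⟩

theorem lift_mono (h : ∀ b, b ∉ A → l b ≤ l' b) : T.lift A l ≤ T.lift A l' := by
  refine le_trans (lift_le (x := T.lift A l ⊓ T.lift A l') (fun b hb => ?_) fun a ha =>
    T.N_inf (N_lift ha) (N_lift ha)) inf_le_right
  simp [lift_off hb, h b hb]

end TwistedLattice
end FilteredLattice

/-! ### Relative rationality and generalized Laufer sequences -/

namespace FilteredLattice
namespace TwistedLattice

variable {V : Type} [Fintype V] (T : TwistedLattice V)

/-- Rationality relative to `D`: `χ ≥ 1` on the nonzero effective cycles which are reduced outside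
of `D`. -/
def IsRationalOn (D : Finset V) : Prop :=
  ∀ y : V → ℤ, 0 ≤ y → y ≠ 0 → (∀ a, a ∉ D → y a ≤ 1) → 1 ≤ T.X y

variable {T} {A D : Finset V} {l l' : V → ℤ} {j : V}

theorem IsRationalOn.mono (h : T.IsRationalOn D) (hA : A ⊆ D) : T.IsRationalOn A :=
  fun y h0 h1 h2 => h y h0 h1 fun a ha => h2 a fun h => ha (hA h)

/-- Otherwise `p` would be antinef on `A`: where it agrees with the lift this follows by
monotonicity. This is the generalized Laufer step, since adding `E_a` with `T.N p a ≥ 1` does not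
increase `f`. -/
theorem exists_of_lt_lift {p : V → ℤ} (hp : ∀ b, b ∉ A → p b = l b) (h : p ≤ T.lift A l)
    (hne : p ≠ T.lift A l) : ∃ a ∈ A, p a < T.lift A l a ∧ 1 ≤ T.N p a := by
  by_contra hcon
  push Not at hcon
  refine hne (le_antisymm h (lift_le hp fun a ha => ?_))
  rcases (h a).lt_or_eq with h1 | h1
  · have := hcon a ha h1; omega
  · exact (T.N_mono h h1).trans (N_lift ha)

/-- If every possible descent met an intersection number at least `2`, summing over the support of
`y = p - v` would give `2χ(y) ≤ 0`, while rationality gives `χ(y) ≥ 1`. -/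
theorem exists_of_lift_lt (hD : T.IsRationalOn D) {p : V → ℤ} (hp : ∀ b, b ∉ D → p b = l b)
    (h : T.lift D l ≤ p) (hne : p ≠ T.lift D l) :
    ∃ a ∈ D, T.lift D l a < p a ∧ T.N (p - Pi.single a 1) a ≤ 1 := by
  set v := T.lift D l with hv
  have hy0 : 0 ≤ p - v := sub_nonneg.2 h
  have h1 := hD (p - v) hy0 (sub_ne_zero.2 hne) fun a ha => by
    simp [hp a ha, hv, lift_off ha]
  by_contra hcon
  push Not at hcon
  have h2 : ∀ a, (p - v) a * (T.g a a + 2) ≤ (p - v) a * T.pr (p - v) a := by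
    intro a
    rcases (hy0 a).lt_or_eq with h3 | h3
    · have h3' : v a < p a := by simpa using h3
      have haD : a ∈ D := by
        by_contra ha
        rw [hp a ha, hv, lift_off ha] at h3'
        omega
      have h4 := hcon a haD h3'
      have h5 : T.N p a = T.N (p - Pi.single a 1) a + T.g a a := by
        rw [← T.pr_single a a, ← N_add, sub_add_cancel]
      have h6 : T.N p a = T.N v a + T.pr (p - v) a := by rw [← N_add, add_sub_cancel]
      have h7 : T.N v a ≤ 0 := N_lift haD
      exact mul_le_mul_of_nonneg_left (by linarith) h3.le
    · rw [← h3]; simp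
  have h3 := T.two_X (p - v)
  have h4 := Finset.sum_le_sum fun a (_ : a ∈ Finset.univ) => h2 a
  unfold pr at h4
  linarith

theorem f_sub_single_le {p : V → ℤ} {a : V} (h : T.N (p - Pi.single a 1) a ≤ 1) :
    T.f (p - Pi.single a 1) ≤ T.f p := by
  have := T.f_add_single (p - Pi.single a 1) a
  rw [sub_add_cancel] at this
  omega

/-- Below the lift, one can move upwards without increasing `f`. -/
theorem exists_upward {p : V → ℤ} (hp : ∀ b, b ∉ D → p b = l b) (h : p ≤ T.lift D l) {t : ℤ}
    (h1 : p j ≤ t) (h2 : t ≤ T.lift D l j) :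
    ∃ q, (∀ b, b ∉ D → q b = l b) ∧ q ≤ T.lift D l ∧ q j = t ∧ T.f q ≤ T.f p := by
  obtain ⟨d, hd⟩ : ∃ d : ℕ, ∑ i, (T.lift D l i - p i) = d :=
    ⟨_, (Int.toNat_of_nonneg (Finset.sum_nonneg fun i _ => sub_nonneg.2 (h i))).symm⟩
  induction d generalizing p with
  | zero =>
    have h3 := (Finset.sum_eq_zero_iff_of_nonneg fun i _ => sub_nonneg.2 (h i)).1 (by simpa using hd)
    exact ⟨p, hp, h, by have := h3 j (Finset.mem_univ j); omega, le_rfl⟩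
  | succ d ih =>
    rcases h1.eq_or_lt with h3 | h3
    · exact ⟨p, hp, h, h3, le_rfl⟩
    obtain ⟨a, ha, h4, h5⟩ := exists_of_lt_lift hp h (fun he => by rw [he] at h3; omega)
    have k1 : ∀ b, b ∉ D → (p + Pi.single a 1 : V → ℤ) b = l b := fun b hb => by
      have : b ≠ a := fun h => hb (h ▸ ha)
      simp [this, hp b hb]
    have k2 : p + Pi.single a 1 ≤ T.lift D l := fun i => by
      rcases eq_or_ne i a with rfl | hi
      · simp; omega
      · simpa [hi] using h i
    have k3 : (p + Pi.single a 1 : V → ℤ) j ≤ t := by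
      rcases eq_or_ne j a with rfl | hi
      · simp; omega
      · simpa [hi] using h1
    have k4 : ∑ i, (T.lift D l i - (p + Pi.single a 1 : V → ℤ) i) = d := by
      have : ∑ i, (T.lift D l i - (p + Pi.single a 1 : V → ℤ) i) = ∑ i, (T.lift D l i - p i) - 1 := by
        simp [Finset.sum_add_distrib, Pi.single_apply]; ring
      rw [this, hd]; push_cast; ring
    obtain ⟨q, q1, q2, q3, q4⟩ := ih k1 k2 k3 k4
    refine ⟨q, q1, q2, q3, q4.trans ?_⟩
    rw [f_add_single]; omega

/-- Above the lift, one can move downwards without increasing `f`. -/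
theorem exists_downward (hD : T.IsRationalOn D) {p : V → ℤ} (hp : ∀ b, b ∉ D → p b = l b)
    (h : T.lift D l ≤ p) {t : ℤ} (h1 : T.lift D l j ≤ t) (h2 : t ≤ p j) :
    ∃ q, (∀ b, b ∉ D → q b = l b) ∧ T.lift D l ≤ q ∧ q j = t ∧ T.f q ≤ T.f p := by
  obtain ⟨d, hd⟩ : ∃ d : ℕ, ∑ i, (p i - T.lift D l i) = d :=
    ⟨_, (Int.toNat_of_nonneg (Finset.sum_nonneg fun i _ => sub_nonneg.2 (h i))).symm⟩
  induction d generalizing p with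
  | zero =>
    have h3 := (Finset.sum_eq_zero_iff_of_nonneg fun i _ => sub_nonneg.2 (h i)).1 (by simpa using hd)
    exact ⟨p, hp, h, by have := h3 j (Finset.mem_univ j); omega, le_rfl⟩
  | succ d ih =>
    rcases h2.eq_or_lt with h3 | h3
    · exact ⟨p, hp, h, h3.symm, le_rfl⟩
    obtain ⟨a, ha, h4, h5⟩ := exists_of_lift_lt hD hp h (fun he => by rw [he] at h3; omega)
    have k1 : ∀ b, b ∉ D → (p - Pi.single a 1 : V → ℤ) b = l b := fun b hb => by
      have : b ≠ a := fun h => hb (h ▸ ha)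
      simp [this, hp b hb]
    have k2 : T.lift D l ≤ p - Pi.single a 1 := fun i => by
      rcases eq_or_ne i a with rfl | hi
      · simp; omega
      · simpa [hi] using h i
    have k3 : t ≤ (p - Pi.single a 1 : V → ℤ) j := by
      rcases eq_or_ne j a with rfl | hi
      · simp; omega
      · simpa [hi] using h2
    have k4 : ∑ i, ((p - Pi.single a 1 : V → ℤ) i - T.lift D l i) = d := by
      have : ∑ i, ((p - Pi.single a 1 : V → ℤ) i - T.lift D l i) = ∑ i, (p i - T.lift D l i) - 1 := by
        simp [Finset.sum_sub_distrib, Pi.single_apply]; ring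
      rw [this, hd]; push_cast; ring
    obtain ⟨q, q1, q2, q3, q4⟩ := ih k1 k2 k3 k4
    exact ⟨q, q1, q2, q3, q4.trans (f_sub_single_le h5)⟩

theorem f_lift_le_of_le {p : V → ℤ} (hp : ∀ b, b ∉ D → p b = l b) (h : p ≤ T.lift D l) :
    T.f (T.lift D l) ≤ T.f p := by
  obtain ⟨d, hd⟩ : ∃ d : ℕ, ∑ i, (T.lift D l i - p i) = d :=
    ⟨_, (Int.toNat_of_nonneg (Finset.sum_nonneg fun i _ => sub_nonneg.2 (h i))).symm⟩
  induction d generalizing p with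
  | zero =>
    have h3 := (Finset.sum_eq_zero_iff_of_nonneg fun i _ => sub_nonneg.2 (h i)).1 (by simpa using hd)
    have : T.lift D l = p := funext fun i => sub_eq_zero.1 (h3 i (Finset.mem_univ i))
    rw [this]
  | succ d ih =>
    obtain ⟨a, ha, h4, h5⟩ := exists_of_lt_lift hp h (fun he => by
      simp [← he] at hd; omega)
    refine (ih (p := p + Pi.single a 1) (fun b hb => ?_) (fun i => ?_) ?_).trans ?_
    · have : b ≠ a := fun h => hb (h ▸ ha)
      simp [this, hp b hb]
    · rcases eq_or_ne i a with rfl | hi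
      · simp; omega
      · simpa [hi] using h i
    · have : ∑ i, (T.lift D l i - (p + Pi.single a 1 : V → ℤ) i) = ∑ i, (T.lift D l i - p i) - 1 := by
        simp [Finset.sum_add_distrib, Pi.single_apply]; ring
      rw [this, hd]; push_cast; ring
    · rw [f_add_single]; omega

theorem f_lift_le_of_ge (hD : T.IsRationalOn D) {p : V → ℤ} (hp : ∀ b, b ∉ D → p b = l b)
    (h : T.lift D l ≤ p) : T.f (T.lift D l) ≤ T.f p := by
  obtain ⟨d, hd⟩ : ∃ d : ℕ, ∑ i, (p i - T.lift D l i) = d :=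
    ⟨_, (Int.toNat_of_nonneg (Finset.sum_nonneg fun i _ => sub_nonneg.2 (h i))).symm⟩
  induction d generalizing p with
  | zero =>
    have h3 := (Finset.sum_eq_zero_iff_of_nonneg fun i _ => sub_nonneg.2 (h i)).1 (by simpa using hd)
    have : p = T.lift D l := funext fun i => sub_eq_zero.1 (h3 i (Finset.mem_univ i))
    rw [this]
  | succ d ih =>
    obtain ⟨a, ha, h4, h5⟩ := exists_of_lift_lt hD hp h (fun he => by
      simp [← he] at hd; omega)
    refine (ih (p := p - Pi.single a 1) (fun b hb => ?_) (fun i => ?_) ?_).trans (f_sub_single_le h5)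
    · have : b ≠ a := fun h => hb (h ▸ ha)
      simp [this, hp b hb]
    · rcases eq_or_ne i a with rfl | hi
      · simp; omega
      · simpa [hi] using h i
    · have : ∑ i, ((p - Pi.single a 1 : V → ℤ) i - T.lift D l i) = ∑ i, (p i - T.lift D l i) - 1 := by
        simp [Finset.sum_sub_distrib, Pi.single_apply]; ring
      rw [this, hd]; push_cast; ring

/-- The differences of `x` and `y` with their infimum have disjoint supports, so their intersection
number is nonnegative. This handles vectors that are not comparable with the lift. -/
theorem f_submodular (x y : V → ℤ) : T.f (x ⊓ y) + T.f (x ⊔ y) ≤ T.f x + T.f y := by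
  have hx : x = x ⊓ y + (x - x ⊓ y) := by abel
  have hy : y = x ⊓ y + (y - x ⊓ y) := by abel
  have hs : x ⊔ y = x + (y - x ⊓ y) := by
    funext i
    simp only [Pi.sup_apply, Pi.add_apply, Pi.sub_apply, Pi.inf_apply]
    rcases le_total (x i) (y i) with h | h <;> simp [h]
  have h1 : T.f (x ⊔ y) = T.f x + T.X (y - x ⊓ y) - ∑ a, (y - x ⊓ y) a * T.N x a := by rw [hs]; exact T.f_add x (y - x ⊓ y)
  have h2 := T.f_add (x ⊓ y) (y - x ⊓ y)
  rw [← hy] at h2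
  have h3 : ∑ a, (y - x ⊓ y) a * T.N (x ⊓ y) a ≤ ∑ a, (y - x ⊓ y) a * T.N x a := by
    refine Finset.sum_le_sum fun a _ => ?_
    rcases le_total (x a) (y a) with h | h
    · exact mul_le_mul_of_nonneg_left (T.N_mono inf_le_left (by simp [h])) (by simp [h])
    · simp [h]
  linarith

/-- The lift minimizes `f`. -/
theorem f_lift_le (hD : T.IsRationalOn D) {p : V → ℤ} (hp : ∀ b, b ∉ D → p b = l b) :
    T.f (T.lift D l) ≤ T.f p := by
  have h1 := T.f_submodular p (T.lift D l)
  have h2 := f_lift_le_of_le (T := T) (D := D) (l := l) (p := p ⊓ T.lift D l)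
    (fun b hb => by simp [hp b hb, lift_off hb]) inf_le_right
  have h3 := f_lift_le_of_ge (l := l) (p := p ⊔ T.lift D l) hD
    (fun b hb => by simp [hp b hb, lift_off hb]) le_sup_right
  linarith

/-! ### Minima on the slices of one coordinate -/

/-- The minimum of `f` over the vectors with the given coordinates outside of `A` and the given
coordinate at `j`. -/
def sliceMin (T : TwistedLattice V) (A : Finset V) (j : V) (l : V → ℤ) (t : ℤ) : ℤ :=
  T.f (T.lift A (Function.update l j t))

theorem lift_update_self (hj : j ∉ A) (t : ℤ) : T.lift A (Function.update l j t) j = t := by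
  rw [lift_off hj, Function.update_self]

theorem lift_update_off {t : ℤ} {b : V} (hb : b ∉ insert j A) :
    T.lift A (Function.update l j t) b = l b := by
  rw [Finset.mem_insert, not_or] at hb
  rw [lift_off hb.2, Function.update_of_ne hb.1]

theorem sliceMin_le (hA : T.IsRationalOn A) {t : ℤ} {p : V → ℤ}
    (hp : ∀ b, b ∉ insert j A → p b = l b) (hpj : p j = t) : T.sliceMin A j l t ≤ T.f p := by
  refine f_lift_le hA fun b hb => ?_
  rcases eq_or_ne b j with rfl | h
  · rw [Function.update_self, hpj]
  · rw [Function.update_of_ne h, hp b (by simp [h, hb])]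

theorem lift_le_sliceMin (hD : T.IsRationalOn (insert j A)) (t : ℤ) :
    T.f (T.lift (insert j A) l) ≤ T.sliceMin A j l t :=
  f_lift_le hD fun _ hb => lift_update_off hb

/-- When `t` is at most the `j`-coordinate of the full lift, the infimum of the two lifts has the
coordinates prescribed on the slice and is antinef on `A`, so it competes with the slice lift. The
opposite comparison in `le_lift_update` uses the same infimum as a competitor of the full lift. -/
theorem lift_update_le {t : ℤ} (h : t ≤ T.lift (insert j A) l j) :
    T.lift A (Function.update l j t) ≤ T.lift (insert j A) l := by
  refine le_trans (lift_le (x := T.lift A (Function.update l j t) ⊓ T.lift (insert j A) l)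
    (fun b hb => ?_) fun a ha => T.N_inf (N_lift ha) (N_lift (Finset.mem_insert_of_mem ha)))
    inf_le_right
  rcases eq_or_ne b j with rfl | hbj
  · simp [lift_off hb, h]
  · simp [lift_off hb, Function.update_of_ne hbj, lift_off (show b ∉ insert j A by simp [hbj, hb])]

theorem le_lift_update (hj : j ∉ A) {t : ℤ} (h : T.lift (insert j A) l j ≤ t) :
    T.lift (insert j A) l ≤ T.lift A (Function.update l j t) := by
  refine le_trans (lift_le (x := T.lift A (Function.update l j t) ⊓ T.lift (insert j A) l)
    (fun b hb => ?_) fun a ha => ?_) inf_le_left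
  · simp [lift_update_off hb, lift_off hb]
  · rcases Finset.mem_insert.1 ha with rfl | ha'
    · exact (T.N_mono inf_le_right (by simp [lift_off hj, h])).trans
        (N_lift (Finset.mem_insert_self _ _))
    · exact T.N_inf (N_lift ha') (N_lift ha)

/-- The sublevel sets of `sliceMin` are intervals. -/
theorem sliceMin_ordConnected (hj : j ∉ A) (hD : T.IsRationalOn (insert j A)) {n a b c : ℤ}
    (hab : a ≤ b) (hbc : b ≤ c) (ha : T.sliceMin A j l a ≤ n) (hc : T.sliceMin A j l c ≤ n) :
    T.sliceMin A j l b ≤ n := by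
  have hA := hD.mono (Finset.subset_insert j A)
  -- On the left of the `j`-coordinate of the full lift, a path climbs from the minimizer at `a`
  -- towards the full lift and passes height `b`; on the right, a path descends from the minimizer
  -- at `c`.
  rcases le_total b (T.lift (insert j A) l j) with h | h
  · obtain ⟨q, q1, -, q3, q4⟩ := exists_upward (T := T) (D := insert j A) (l := l) (j := j) (t := b)
      (fun _ hb => lift_update_off hb) (lift_update_le (hab.trans h))
      (by rw [lift_update_self hj]; exact hab) h
    exact (sliceMin_le hA q1 q3).trans (q4.trans ha)
  · obtain ⟨q, q1, -, q3, q4⟩ := exists_downward (T := T) (D := insert j A) (l := l) (j := j) (t := b)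
      hD (fun _ hb => lift_update_off hb) (le_lift_update hj (h.trans hbc)) h
      (by rw [lift_update_self hj]; exact hbc)
    exact (sliceMin_le hA q1 q3).trans (q4.trans hc)

/-- The slope of `sliceMin`. -/
theorem sliceMin_succ (hj : j ∉ A) (hD : T.IsRationalOn (insert j A)) (t : ℤ) :
    T.sliceMin A j l (t + 1) =
      T.sliceMin A j l t + 1 - T.N (T.lift A (Function.update l j t)) j := by
  have hA := hD.mono (Finset.subset_insert j A)
  set u := T.lift A (Function.update l j t) with hu
  set u' := T.lift A (Function.update l j (t + 1)) with hu'
  have huj : u j = t := lift_update_self hj t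
  have huj' : u' j = t + 1 := lift_update_self hj (t + 1)
  apply le_antisymm
  · have h : T.sliceMin A j l (t + 1) ≤ T.f (u + Pi.single j 1) := by
      refine sliceMin_le hA (fun b hb => ?_) (by simp [huj])
      have : b ≠ j := fun h => hb (by simp [h])
      simp [this, hu, lift_update_off hb]
    rw [f_add_single] at h
    exact h
  · have hle : u ≤ u' := lift_mono fun b hb => by
      rcases eq_or_ne b j with rfl | h
      · simp
      · simp [h]
    have hy0 : 0 ≤ u' - u := sub_nonneg.2 hle
    -- For the lower bound, the difference of the two lifts is effective, equals `1` at `j` and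
    -- vanishes outside `insert j A`, so its `χ` is at least `1`. In the linear term only `j` can
    -- contribute positively, as `u` is antinef on `A`.
    have hX := hD (u' - u) hy0 (fun h => by
      have := congrFun h j
      simp [huj, huj'] at this) (fun b hb => by
        simp [hu, hu', lift_update_off hb])
    have h1 := T.f_add u (u' - u)
    rw [add_sub_cancel] at h1
    have h2 : ∑ a, (u' - u) a * T.N u a ≤ T.N u j := by
      have h3 : T.N u j = ∑ a, if a = j then T.N u a else 0 := by simp
      rw [h3]
      refine Finset.sum_le_sum fun a _ => ?_
      split_ifs with haj
      · subst haj
        simp [huj, huj']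
      · by_cases haA : a ∈ A
        · exact mul_nonpos_of_nonneg_of_nonpos (hy0 a) (N_lift haA)
        · have : a ∉ insert j A := by simp [haj, haA]
          simp [hu, hu', lift_update_off this]
    change T.f u + 1 - T.N u j ≤ T.f u'
    linarith

/-- The connected component of the support of a generalized Laufer step. -/
theorem exists_component {z u : V → ℤ} (hz : ∀ a ∈ A, T.N z a ≤ 0) (hu : ∀ a ∈ A, T.N u a ≤ 0)
    (hmin : ∀ x, (∀ b, b ∉ A → x b = u b) → (∀ a ∈ A, T.N x a ≤ 0) → u ≤ x) (hzu : z ≤ u)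
    (hred : ∀ b, b ∉ A → u b - z b ≤ 1) (i : V) (hi : z i < u i) :
    ∃ C : Finset V, (∀ b ∈ C, z b < u b) ∧ (∀ b ∈ C, ∀ b', b' ∉ C → z b' < u b' → T.g b b' = 0) ∧
      i ∈ C ∧ T.X (fun b => if b ∈ C then u b - z b else 0) ≤ 1 := by
  -- a maximal reduced cycle with `χ ≤ 1`
  obtain ⟨C, hC, hCmax⟩ := (Finset.univ.filter fun C : Finset V => (∀ b ∈ C, z b < u b) ∧ i ∈ C ∧
    T.X (sumE C) ≤ 1).exists_max_image Finset.card ⟨{i}, by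
      have : sumE {i} = (Pi.single i 1 : V → ℤ) := by
        funext b; simp [sumE, Pi.single_apply]
      simp [hi, this, T.X_single]⟩
  simp only [Finset.mem_filter, Finset.mem_univ, true_and] at hC hCmax
  obtain ⟨hC1, hC2, hC3⟩ := hC
  -- A vertex of the support adjacent to `C` could be added without raising `χ`, contrary to the
  -- maximality of `C`.
  have hclosed : ∀ b ∈ C, ∀ b', b' ∉ C → z b' < u b' → T.g b b' = 0 := by
    intro b hb b' hb' hbu
    by_contra hg
    have hbb : b ≠ b' := fun h => hb' (h ▸ hb)
    have hg1 : 1 ≤ T.g b b' := by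
      have := T.g_nonneg b b' hbb; omega
    have h1 : 1 ≤ T.pr (sumE C) b' := by
      unfold pr
      refine hg1.trans ?_
      have h2 : T.g b b' = sumE C b * T.g b b' := by simp [sumE, hb]
      rw [h2]
      refine Finset.single_le_sum (f := fun b => sumE C b * T.g b b') (fun a _ => ?_)
        (Finset.mem_univ b)
      simp only [sumE]
      split_ifs with ha
      · rw [one_mul]; exact T.g_nonneg _ _ fun h => hb' (h ▸ ha)
      · simp
    have h2 : sumE (insert b' C) = sumE C + Pi.single b' 1 := by
      funext a
      simp only [sumE, Finset.mem_insert, Pi.add_apply, Pi.single_apply]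
      by_cases hab : a = b'
      · subst hab; simp [hb']
      · simp [hab]
    have h3 := hCmax (insert b' C) ⟨fun a ha => by
      rcases Finset.mem_insert.1 ha with rfl | ha
      exacts [hbu, hC1 a ha], Finset.mem_insert_of_mem hC2, by rw [h2, X_add_single]; omega⟩
    rw [Finset.card_insert_of_notMem hb'] at h3
    omega
  refine ⟨C, hC1, hclosed, hC2, ?_⟩
  set yC : V → ℤ := fun b => if b ∈ C then u b - z b else 0 with hyC
  have hCy : sumE C ≤ yC := fun b => by
    simp only [sumE, hyC]
    split_ifs with h
    · have := hC1 b h; omega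
    · exact le_rfl
  -- A maximal cycle with `χ ≤ 1` between the reduced cycle and the full step on `C`. It must be the
  -- full step: otherwise one more Laufer step stays in the range and does not raise `χ`.
  obtain ⟨y, hy, hymax⟩ := ((Finset.Icc (sumE C) yC).filter fun y => T.X y ≤ 1).exists_max_image
    (fun y => ∑ b, y b) ⟨sumE C, by simp [hCy, hC3]⟩
  simp only [Finset.mem_filter, Finset.mem_Icc] at hy hymax
  obtain ⟨⟨hy1, hy2⟩, hy3⟩ := hy
  suffices h : y = yC by rw [← h]; exact hy3
  by_contra hne
  have hyC0 : ∀ b, b ∉ C → y b = 0 := fun b hb => by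
    have h1 := hy1 b
    have h2 := hy2 b
    simp only [sumE, hyC, if_neg hb] at h1 h2
    omega
  set rest : V → ℤ := fun b => if b ∈ C then 0 else u b - z b with hrest
  set x : V → ℤ := z + rest + y with hx
  have hxu : x ≤ u := fun b => by
    have h2 := hy2 b
    simp only [hx, hrest, hyC, Pi.add_apply] at h2 ⊢
    split_ifs at h2 ⊢ <;> omega
  -- Outside `A` the step is at most one, so the reduced cycle on `C` already has its final
  -- coordinates there, and minimality of `u` can be applied to `x`.
  have hxA : ∀ b, b ∉ A → x b = u b := fun b hb => by
    have h1 := hy1 b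
    have h2 := hy2 b
    have h3 := hred b hb
    simp only [hx, hrest, hyC, sumE, Pi.add_apply] at h1 h2 ⊢
    split_ifs at h1 h2 ⊢ <;> omega
  obtain ⟨a, ha, haN⟩ : ∃ a ∈ A, 0 < T.N x a := by
    by_contra hcon
    push Not at hcon
    refine hne (funext fun b => ?_)
    have h4 : x b = u b := le_antisymm (hxu b) (hmin x hxA hcon b)
    have h2 := hy2 b
    simp only [hx, hrest, hyC, Pi.add_apply] at h2 h4 ⊢
    split_ifs at h2 h4 ⊢ with h
    · omega
    · exact hyC0 b h
  have hlt : x a < u a := by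
    refine lt_of_le_of_ne (hxu a) fun h => ?_
    have := (T.N_mono hxu h).trans (hu a ha)
    omega
  have haC : a ∈ C := by
    by_contra h
    simp only [hx, hrest, Pi.add_apply, if_neg h, hyC0 a h] at hlt
    omega
  -- `z` is antinef at `a`, and the part of the step outside `C` has no edge to `C`, so the positive
  -- intersection number must come from `y`.
  have hpr : 1 ≤ T.pr y a := by
    have h1 : T.N x a = T.N z a + T.pr rest a + T.pr y a := by rw [hx, N_add, N_add]
    have h2 : T.pr rest a = 0 := by
      refine Finset.sum_eq_zero fun b _ => ?_
      simp only [hrest]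
      split_ifs with hb
      · simp
      · rcases (hzu b).eq_or_lt with h | h
        · simp [h]
        · rw [T.g_symm, hclosed a haC b hb h, mul_zero]
    have := hz a ha
    omega
  have h1 := hymax (y + Pi.single a 1) ⟨⟨hy1.trans (le_add_of_nonneg_right
    (Pi.single_nonneg.2 zero_le_one)), fun b => ?_⟩, by rw [X_add_single]; omega⟩
  · simp [Finset.sum_add_distrib, Pi.single_apply] at h1
  · rcases eq_or_ne b a with rfl | hb
    · simp only [hx, hrest, Pi.add_apply, if_pos haC] at hlt
      simp only [hyC, if_pos haC, Pi.add_apply, Pi.single_eq_same]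
      omega
    · simpa [hb] using hy2 b

end TwistedLattice
end FilteredLattice

/-! ### Branches at a vertex and the common slice over a cube -/

namespace FilteredLattice

theorem exchange_exchange {V ι : Type} {lab : V → ι} {b : ι} (K K' : Finset V) :
    exchange lab b (exchange lab b K K') (exchange lab b K' K) = K := by
  ext v
  simp only [mem_exchange]
  split_ifs <;> rfl

namespace TwistedLattice

variable {V ι : Type} [Fintype V] {T : TwistedLattice V}

/-- The labelling `lab` separates the branches at the vertex `j`. -/
structure IsBranching (T : TwistedLattice V) (j : V) (lab : V → ι) : Prop where
  lab_eq : ∀ a b, a ≠ j → b ≠ j → T.g a b ≠ 0 → lab a = lab b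
  eq_of_lab_eq : ∀ a b, a ≠ j → b ≠ j → T.g a j ≠ 0 → T.g b j ≠ 0 → lab a = lab b → a = b

/-- The vector which agrees with `x'` on the branch `b`, and with `x` elsewhere. -/
def glue {V ι : Type} (lab : V → ι) (b : ι) (x x' : V → ℤ) : V → ℤ := fun a => if lab a = b then x' a else x a

theorem glue_apply_of_eq {V ι : Type} {lab : V → ι} {b : ι} {x x' : V → ℤ} {a : V} (h : x a = x' a) : glue lab b x x' a = x a := by
  unfold glue; split_ifs <;> simp [h]

variable {A : Finset V} {l l' z u x x' : V → ℤ} {j : V} {lab : V → ι} {b : ι}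

theorem N_congr {a : V} (h : ∀ i, T.g i a ≠ 0 → x i = x' i) : T.N x a = T.N x' a := by
  unfold N pr
  congr 1
  refine Finset.sum_congr rfl fun i _ => ?_
  by_cases hi : T.g i a = 0
  · rw [hi, mul_zero, mul_zero]
  · rw [h i hi]

/-- Away from `j` all neighbours of a vertex lie on its own branch, and at `j` the glued vectors
agree, so the intersection number sees only one of them. -/
theorem N_glue (hb : T.IsBranching j lab) (hx : x j = x' j) {a : V} (ha : a ≠ j) :
    T.N (glue lab b x x') a = if lab a = b then T.N x' a else T.N x a := by
  have key : ∀ i, T.g i a ≠ 0 → glue lab b x x' i = if lab a = b then x' i else x i := by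
    intro i hi
    rcases eq_or_ne i j with rfl | hij
    · rw [glue_apply_of_eq hx, hx, ite_self]
    · rw [glue, hb.lab_eq i a hij ha hi]
  split_ifs with h
  · exact N_congr fun i hi => by rw [key i hi, if_pos h]
  · exact N_congr fun i hi => by rw [key i hi, if_neg h]

/-- The difference of `x` and `x'` splits into its parts on and off the branch. Both vanish at `j`,
the only link between them, so they are orthogonal and `f` has no mixed term. -/
theorem f_glue (hb : T.IsBranching j lab) (hx : x j = x' j) :
    T.f (glue lab b x x') + T.f (glue lab b x' x) = T.f x + T.f x' := by
  set d : V → ℤ := fun a => if lab a = b then x' a - x a else 0 with hd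
  set d' : V → ℤ := fun a => if lab a = b then 0 else x' a - x a with hd'
  have h1 : glue lab b x x' = x + d := by
    funext a; simp only [glue, hd, Pi.add_apply]; split_ifs <;> ring
  have h2 : glue lab b x' x = x + d' := by
    funext a; simp only [glue, hd', Pi.add_apply]; split_ifs <;> ring
  have h3 : x' = x + (d + d') := by
    funext a; simp only [hd, hd', Pi.add_apply]; split_ifs <;> ring
  have h4 : ∑ a, d' a * T.pr d a = 0 := by
    refine Finset.sum_eq_zero fun a _ => ?_
    by_cases ha : lab a = b
    · simp [hd', ha]
    rcases eq_or_ne a j with rfl | haj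
    · simp [hd', hx]
    refine mul_eq_zero_of_right _ (Finset.sum_eq_zero fun i _ => ?_)
    by_cases hi : lab i = b
    · rcases eq_or_ne i j with rfl | hij
      · simp [hd, hx]
      · have : T.g i a = 0 := by
          by_contra hg
          exact ha ((hb.lab_eq i a hij haj hg).symm.trans hi)
        rw [this, mul_zero]
    · simp [hd, hi]
  have h5 : T.f x' = T.f x + T.X (d + d') - ∑ a, (d + d') a * T.N x a := by
    conv_lhs => rw [h3]
    rw [f_add]
  rw [h1, h2, h5, f_add, f_add, X_add, h4]
  simp only [Pi.add_apply, add_mul, Finset.sum_add_distrib]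
  ring

/-- A lift does not change on a branch where the data do not change. -/
theorem lift_eq_off_branch (hb : T.IsBranching j lab) (hj : j ∉ A) (hz : ∀ a ∈ A, T.N z a ≤ 0)
    (hzj : z j = T.lift A l j) (hzu : z ≤ T.lift A l)
    (hzl : ∀ a, a ∉ A → lab a ≠ b → z a = l a) {a : V} (ha : lab a ≠ b) :
    T.lift A l a = z a := by
  refine le_antisymm ?_ (hzu a)
  -- Taking the lift on the branch `b` and `z` elsewhere gives an admissible competitor, so
  -- minimality bounds the lift by `z` off the branch.
  have h := lift_le (T := T) (A := A) (l := l) (x := glue lab b z (T.lift A l)) (fun i hi => ?_)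
    (fun i hi => ?_) a
  · simpa [glue, ha] using h
  · unfold glue
    split_ifs with h
    exacts [lift_off hi, hzl i hi h]
  · rw [N_glue hb hzj (fun h => hj (h ▸ hi))]
    split_ifs
    exacts [N_lift hi, hz i hi]

/-- The part of a generalized Laufer step which is adjacent to `j`. -/
theorem exists_adjacent_part (hb : T.IsBranching j lab) (hj : j ∉ A) (hz : ∀ a ∈ A, T.N z a ≤ 0)
    (hzj : z j = T.lift A l j) (hzu : z ≤ T.lift A l) (hzl : ∀ a, a ∉ A → lab a ≠ b → z a = l a)
    (hred : ∀ a, a ∉ A → l a - z a ≤ 1) :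
    ∃ y : V → ℤ, 0 ≤ y ∧ y j = 0 ∧ (∀ a, a ∉ A → y a ≤ 1) ∧ T.X y ≤ 1 ∧
      T.pr y j = T.pr (T.lift A l - z) j ∧ ∀ a ∈ A, T.N (T.lift A l) a ≤ T.pr y a := by
  set u := T.lift A l with hu
  have hoff : ∀ a, lab a ≠ b → u a = z a := fun a ha =>
    lift_eq_off_branch hb hj hz hzj hzu hzl ha
  by_cases h0 : ∀ i, T.g i j ≠ 0 → u i = z i
  · refine ⟨0, le_rfl, rfl, fun _ _ => by simp, by rw [X_zero]; omega, ?_, fun a ha => ?_⟩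
    · refine Finset.sum_congr rfl fun i _ => ?_
      by_cases hi : T.g i j = 0
      · rw [hi, mul_zero, mul_zero]
      · simp [h0 i hi]
    · simpa [pr] using N_lift ha
  push Not at h0
  obtain ⟨i, hij, hi⟩ := h0
  have hij' : i ≠ j := by rintro rfl; exact hi hzj.symm
  have hlab : lab i = b := by by_contra h; exact hi (hoff i h)
  -- The branch contains only one neighbour `i` of `j`, so the part of the step around `i` carries
  -- its whole intersection number with `j`.
  obtain ⟨C, hC1, hC2, hC3, hC4⟩ := exists_component (T := T) (A := A) (z := z) (u := u) hz
    (fun a ha => N_lift ha) (fun x hx hx' => lift_le (fun c hc => by rw [hx c hc, hu, lift_off hc]) hx')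
    hzu (fun c hc => by rw [hu, lift_off hc]; exact hred c hc) i (lt_of_le_of_ne (hzu i) (Ne.symm hi))
  have hjC : j ∉ C := fun h => by have := hC1 j h; omega
  refine ⟨_, fun a => ?_, if_neg hjC, fun a ha => ?_, hC4, ?_, fun a ha => ?_⟩
  · dsimp only
    split_ifs
    · simpa using hzu a
    · exact le_rfl
  · split_ifs
    · rw [hu, lift_off ha]; exact hred a ha
    · omega
  · refine Finset.sum_congr rfl fun a _ => ?_
    dsimp only
    split_ifs with h
    · rfl
    · by_cases hg : T.g a j = 0
      · rw [hg, mul_zero, mul_zero]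
      rcases eq_or_ne a j with rfl | haj
      · simp [hzj]
      have : lab a ≠ b := fun hab =>
        h (hb.eq_of_lab_eq a i haj hij' hg hij (hab.trans hlab.symm) ▸ hC3)
      simp [hoff a this]
  · by_cases haC : a ∈ C
    · have h1 : T.N u a = T.N z a + T.pr (u - z) a := by rw [← N_add, add_sub_cancel]
      have h2 : T.pr (u - z) a = T.pr (fun c => if c ∈ C then u c - z c else 0) a := by
        refine Finset.sum_congr rfl fun c _ => ?_
        dsimp only
        split_ifs with h
        · rfl
        · rcases (hzu c).eq_or_lt with h' | h'
          · simp [h']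
          · rw [T.g_symm, hC2 a haC c h h', mul_zero, mul_zero]
      have := hz a ha
      omega
    · refine (N_lift ha).trans (T.pr_nonneg (fun c => ?_) (if_neg haC))
      dsimp only
      split_ifs
      · simpa using hzu c
      · exact le_rfl

/-- With `y` the adjacent part of the step, rationality gives `1 ≤ χ(y + E_j) = χ(y) + 1 - (y,
E_j)`, so `(y, E_j) ≤ χ(y) ≤ 1`. This is the slope bound needed in the minimax principle. -/
theorem N_lift_le_add_one (hb : T.IsBranching j lab) (hj : j ∉ A)
    (hD : T.IsRationalOn (insert j A)) (hz : ∀ a ∈ A, T.N z a ≤ 0)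
    (hzj : z j = T.lift A l j) (hzu : z ≤ T.lift A l) (hzl : ∀ a, a ∉ A → lab a ≠ b → z a = l a)
    (hred : ∀ a, a ∉ A → l a - z a ≤ 1) : T.N (T.lift A l) j ≤ T.N z j + 1 := by
  obtain ⟨y, hy0, hyj, hy1, hyX, hyp, -⟩ := exists_adjacent_part hb hj hz hzj hzu hzl hred
  have h1 := hD (y + Pi.single j 1) (add_nonneg hy0 (Pi.single_nonneg.2 zero_le_one))
    (fun h => by have := congrFun h j; simp [hyj] at this) (fun a ha => by
      rw [Finset.mem_insert, not_or] at ha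
      simpa [ha.1] using hy1 a ha.2)
  rw [X_add_single] at h1
  have h2 : T.N (T.lift A l) j = T.N z j + T.pr (T.lift A l - z) j := by
    rw [← N_add, add_sub_cancel]
  omega

/-- With `y` the adjacent part of the step, `χ(y) ≤ 1 ≤ χ(y + y')` yields `χ(y') ≥ (y, y')`. The
intersection numbers of the lift are at most those of `y` on `insert j A`, so adding `y'` cannot
lower `f`. This is what makes two sublevel intervals meet. -/
theorem f_lift_le_add (hb : T.IsBranching j lab) (hj : j ∉ A)
    (hD : T.IsRationalOn (insert j A)) (hz : ∀ a ∈ insert j A, T.N z a ≤ 0)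
    (hzj : z j = T.lift A l j) (hzu : z ≤ T.lift A l) (hzl : ∀ a, a ∉ A → lab a ≠ b → z a = l a)
    (hred : ∀ a, a ∉ A → l a - z a ≤ 1) {y' : V → ℤ} (hy' : 0 ≤ y')
    (hyD : ∀ a, a ∉ insert j A → y' a = 0) : T.f (T.lift A l) ≤ T.f (T.lift A l + y') := by
  obtain ⟨y, hy0, hyj, hy1, hyX, hyp, hyN⟩ := exists_adjacent_part hb hj
    (fun a ha => hz a (Finset.mem_insert_of_mem ha)) hzj hzu hzl hred
  by_cases h0 : y' = 0
  · rw [h0, add_zero]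
  have h1 := hD (y + y') (add_nonneg hy0 hy') (fun h => h0 (le_antisymm (fun a => by
      have h2 := congrFun h a
      have h3 := hy0 a
      simp only [Pi.add_apply, Pi.zero_apply] at h2 h3 ⊢
      omega) hy')) (fun a ha => by
      have h2 := hyD a ha
      rw [Finset.mem_insert, not_or] at ha
      simpa [h2] using hy1 a ha.2)
  rw [X_add] at h1
  have h2 : ∑ a, y' a * T.N (T.lift A l) a ≤ ∑ a, y' a * T.pr y a := by
    refine Finset.sum_le_sum fun a _ => ?_
    by_cases ha : a ∈ insert j A
    · refine mul_le_mul_of_nonneg_left ?_ (hy' a)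
      rcases Finset.mem_insert.1 ha with rfl | haA
      · have h3 : T.N (T.lift A l) a = T.N z a + T.pr (T.lift A l - z) a := by
          rw [← N_add, add_sub_cancel]
        have := hz a ha
        omega
      · exact hyN a haA
    · simp [hyD a ha]
  rw [f_add]
  omega

theorem sliceMin_exchange_le (hb : T.IsBranching j lab) (hj : j ∉ A) (hA : T.IsRationalOn A)
    (K K' : Finset V) (t : ℤ) :
    T.sliceMin A j (l + sumE (exchange lab b K K')) t +
      T.sliceMin A j (l + sumE (exchange lab b K' K)) t ≤
    T.sliceMin A j (l + sumE K) t + T.sliceMin A j (l + sumE K') t := by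
  have key : ∀ K K', T.sliceMin A j (l + sumE (exchange lab b K K')) t ≤
      T.f (glue lab b (T.lift A (Function.update (l + sumE K) j t))
        (T.lift A (Function.update (l + sumE K') j t))) := fun K K' => by
    refine f_lift_le hA fun a ha => ?_
    rcases eq_or_ne a j with rfl | haj
    · rw [glue_apply_of_eq] <;> simp [lift_off hj]
    · simp only [glue, lift_off ha, Function.update_of_ne haj, Pi.add_apply, sumE, mem_exchange]
      split_ifs <;> rfl
  have h := f_glue (T := T) (b := b) hb (x := T.lift A (Function.update (l + sumE K) j t))
    (x' := T.lift A (Function.update (l + sumE K') j t))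
    (by rw [lift_update_self hj, lift_update_self hj])
  have h1 := key K K'
  have h2 := key K' K
  simp only [sliceMin] at *
  omega

/-- If all vertices of a cube have reduced weight at most `n`, then a common value of the coordinate
at `j` realizes this bound. -/
theorem exists_common_slice (hb : T.IsBranching j lab) (hj : j ∉ A)
    (hD : T.IsRationalOn (insert j A)) (I : Finset V) (n : ℤ)
    (h : ∀ K ⊆ I, T.f (T.lift (insert j A) (l + sumE K)) ≤ n) :
    ∃ t, ∀ K ⊆ I, T.sliceMin A j (l + sumE K) t ≤ n := by
  have hA := hD.mono (Finset.subset_insert j A)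
  have hK₀ : ∀ (b : ι) (K : Finset V), K.filter (fun v => lab v ≠ b) ⊆ K :=
    fun b K => Finset.filter_subset _ _
  have hmono : ∀ {K K' : Finset V}, K ⊆ K' → l + sumE K ≤ l + sumE K' := fun {K K'} hK a => by
    simp only [Pi.add_apply, sumE]
    split_ifs with h1 h2
    exacts [le_rfl, absurd (hK h1) h2, by omega, le_rfl]
  have hupd : ∀ {K K' : Finset V} (t : ℤ), K ⊆ K' →
      Function.update (l + sumE K) j t ≤ Function.update (l + sumE K') j t := fun t hK a => by
    rcases eq_or_ne a j with rfl | haj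
    · simp
    · rw [Function.update_of_ne haj, Function.update_of_ne haj]
      exact hmono hK a
  have hdiff : ∀ (K K' : Finset V) (a : V), (l + sumE K) a - (l + sumE K') a ≤ 1 :=
    fun K K' a => by
      simp only [Pi.add_apply, sumE]
      split_ifs <;> omega
  have hagree : ∀ (b : ι) (K : Finset V) (a : V), lab a ≠ b →
      (l + sumE (K.filter fun v => lab v ≠ b)) a = (l + sumE K) a := fun b K a ha => by
    simp [sumE, ha]
  refine exists_common_of_exchange lab I (fun K t => T.sliceMin A j (l + sumE K) t) n
    (fun K _ a b c => sliceMin_ordConnected hj hD) (fun K _ K' _ b t => ?_)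
    (fun K hK K' hK' b hKK t => ?_) (fun K hK K' hK' b hKK => ?_) (lab j)
  · refine le_antisymm (sliceMin_exchange_le hb hj hA K K' t) ?_
    -- The exchange is undone by a second one, so the inequality for the exchanged pair is the
    -- reverse inequality.
    have := sliceMin_exchange_le (l := l) (b := b) hb hj hA (exchange lab b K K')
      (exchange lab b K' K) t
    rwa [exchange_exchange, exchange_exchange] at this
  · have hfil : K.filter (fun v => lab v ≠ b) = K'.filter (fun v => lab v ≠ b) := by
      ext v
      simp only [Finset.mem_filter]
      exact ⟨fun h => ⟨(hKK v h.2).1 h.1, h.2⟩, fun h => ⟨(hKK v h.2).2 h.1, h.2⟩⟩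
    rw [sliceMin_succ hj hD, sliceMin_succ hj hD]
    -- Both slopes are compared with that of the common part of `K` and `K'` off the branch: passing
    -- to `K` raises the intersection number with `E_j` by at most one, and passing to `K'` does not
    -- lower it.
    set z := T.lift A (Function.update (l + sumE (K.filter fun v => lab v ≠ b)) j t) with hz
    have h1 : T.N (T.lift A (Function.update (l + sumE K) j t)) j ≤ T.N z j + 1 := by
      refine N_lift_le_add_one (b := b) hb hj hD (fun a ha => N_lift ha)
        (by rw [hz, lift_update_self hj, lift_update_self hj])
        (lift_mono fun a _ => hupd t (hK₀ b K) a) (fun a ha hab => ?_) (fun a ha => ?_)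
      · rw [hz, lift_off ha]
        rcases eq_or_ne a j with rfl | haj
        · simp
        · rw [Function.update_of_ne haj, Function.update_of_ne haj, hagree b K a hab]
      · rw [hz, lift_off ha]
        rcases eq_or_ne a j with rfl | haj
        · simp
        · rw [Function.update_of_ne haj, Function.update_of_ne haj]
          exact hdiff _ _ _
    have h2 : T.N z j ≤ T.N (T.lift A (Function.update (l + sumE K') j t)) j := by
      refine T.N_mono (lift_mono fun a _ => ?_)
        (by rw [hz, lift_update_self hj, lift_update_self hj])
      rw [hfil]
      exact hupd t (hK₀ b K') a
    omega
  · have hfil : K.filter (fun v => lab v ≠ b) = K'.filter (fun v => lab v ≠ b) := by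
      ext v
      simp only [Finset.mem_filter]
      exact ⟨fun h => ⟨(hKK v h.2).1 h.1, h.2⟩, fun h => ⟨(hKK v h.2).2 h.1, h.2⟩⟩
    -- The `j`-coordinate of the full lift of the common part off the branch is a meeting point. At
    -- this height the slice lift of `K` lies below the full lift of `K`, and `f_lift_le_add`
    -- compares their values.
    have key : ∀ K ⊆ I, T.sliceMin A j (l + sumE K)
        (T.lift (insert j A) (l + sumE (K.filter fun v => lab v ≠ b)) j) ≤ n := by
      intro K hK
      refine le_trans ?_ (h K hK)
      set z := T.lift (insert j A) (l + sumE (K.filter fun v => lab v ≠ b)) with hz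
      set v := T.lift (insert j A) (l + sumE K) with hv
      have hzv : z ≤ v := lift_mono fun a _ => hmono (hK₀ b K) a
      have huv : T.lift A (Function.update (l + sumE K) j (z j)) ≤ v := lift_update_le (hzv j)
      have h1 := f_lift_le_add (T := T) (b := b) (z := z)
        (l := Function.update (l + sumE K) j (z j))
        (y' := v - T.lift A (Function.update (l + sumE K) j (z j))) hb hj hD
        (fun a ha => N_lift ha) (lift_update_self hj _).symm
        ((le_lift_update hj le_rfl).trans (lift_mono fun a _ => hupd _ (hK₀ b K) a))
        (fun a ha hab => ?_) (fun a ha => ?_) (sub_nonneg.2 huv) (fun a ha => ?_)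
      · rwa [add_sub_cancel] at h1
      · rcases eq_or_ne a j with rfl | haj
        · simp
        · rw [Function.update_of_ne haj, hz, lift_off (by simp [haj, ha]), hagree b K a hab]
      · rcases eq_or_ne a j with rfl | haj
        · simp
        · rw [Function.update_of_ne haj, hz, lift_off (by simp [haj, ha])]
          exact hdiff _ _ _
      · rw [Pi.sub_apply, hv, lift_off ha, lift_update_off ha, sub_self]
    exact ⟨_, key K hK, by rw [hfil]; exact key K' hK'⟩

/-- A negative common height can be replaced by `0`: for each `K` it lies between that height and
the nonnegative `j`-coordinate of the full lift, both of which are in the sublevel interval. -/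
theorem exists_common_nonneg_slice (hb : T.IsBranching j lab) (hj : j ∉ A)
    (hD : T.IsRationalOn (insert j A)) (I : Finset V) (n : ℤ)
    (h : ∀ K ⊆ I, T.f (T.lift (insert j A) (l + sumE K)) ≤ n)
    (hpos : ∀ K ⊆ I, 0 ≤ T.lift (insert j A) (l + sumE K) j) :
    ∃ t, 0 ≤ t ∧ ∀ K ⊆ I, T.sliceMin A j (l + sumE K) t ≤ n := by
  obtain ⟨t, ht⟩ := exists_common_slice hb hj hD I n h
  rcases le_total 0 t with h0 | h0
  · exact ⟨t, h0, ht⟩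
  · refine ⟨0, le_rfl, fun K hK => sliceMin_ordConnected hj hD h0 (hpos K hK) (ht K hK) ?_⟩
    exact (sliceMin_le (hD.mono (Finset.subset_insert j A)) (fun _ hb => lift_off hb) rfl).trans
      (h K hK)

/-- Lifts of effective vectors are effective, if antinef vectors are. -/
theorem lift_nonneg (hc : ∀ a, T.c a ≤ 0) (hpos : ∀ x, (∀ a, T.N x a ≤ 0) → 0 ≤ x)
    (hl : ∀ a, a ∉ A → 0 ≤ l a) : 0 ≤ T.lift A l := by
  set v := T.lift A l with hv
  -- The zero vector is antinef because `c ≤ 0`, and the infimum with it is antinef also outside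
  -- `A`, where `v` is nonnegative.
  have h0 : 0 ≤ v ⊓ 0 := hpos _ fun a => by
    have hN0 : T.N 0 a ≤ 0 := by simpa [N, pr] using hc a
    by_cases ha : a ∈ A
    · exact T.N_inf (N_lift ha) hN0
    · have : 0 ≤ v a := by rw [hv, lift_off ha]; exact hl a ha
      exact (T.N_mono (y := 0) inf_le_right (by simp [this])).trans hN0
  exact h0.trans inf_le_left

end TwistedLattice
end FilteredLattice

namespace FilteredLattice
open CategoryTheory Matrix
namespace ResolutionGraph

variable {V : Type} [Fintype V] (Γ : ResolutionGraph V)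

/-! ## The lattice of a resolution graph -/

/-- The intersection numbers of the base elements. -/
def g (a b : V) : ℤ := if a = b then Γ.e a else if Γ.graph.Adj a b then 1 else 0

theorem g_self (a : V) : Γ.g a a = Γ.e a := if_pos rfl

theorem g_of_ne {a b : V} (h : a ≠ b) : Γ.g a b = if Γ.graph.Adj a b then 1 else 0 := if_neg h

theorem g_symm (a b : V) : Γ.g a b = Γ.g b a := by
  rcases eq_or_ne a b with rfl | h
  · rfl
  · rw [g_of_ne _ h, g_of_ne _ h.symm, SimpleGraph.adj_comm]

theorem g_nonneg {a b : V} (h : a ≠ b) : 0 ≤ Γ.g a b := by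
  rw [g_of_ne _ h]; split_ifs <;> simp

theorem adj_of_g_ne_zero {a b : V} (h : a ≠ b) (hg : Γ.g a b ≠ 0) : Γ.graph.Adj a b := by
  rw [g_of_ne _ h] at hg
  by_contra hcon
  exact hg (if_neg hcon)

theorem form_apply (a b : V) : Γ.form a b = Γ.g a b := by
  simp only [form, Matrix.of_apply, g]
  split_ifs <;> simp

/-- The intersection number with a base element. -/
def deg (x : V → ℤ) (a : V) : ℤ := ∑ b, x b * Γ.g b a

theorem deg_add (x y : V → ℤ) (a : V) : Γ.deg (x + y) a = Γ.deg x a + Γ.deg y a := by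
  simp only [deg, Pi.add_apply, add_mul, Finset.sum_add_distrib]

theorem sum_mul_deg_comm (x y : V → ℤ) : ∑ a, x a * Γ.deg y a = ∑ a, y a * Γ.deg x a := by
  simp only [deg, Finset.mul_sum]
  rw [Finset.sum_comm]
  refine Finset.sum_congr rfl fun a _ => Finset.sum_congr rfl fun b _ => ?_
  rw [Γ.g_symm]; ring

theorem deg_mulVec (x : V → ℤ) : Γ.deg x = (Matrix.of Γ.g).mulVec x := by
  funext a
  simp only [deg, Matrix.mulVec, dotProduct, Matrix.of_apply]
  exact Finset.sum_congr rfl fun b _ => by rw [Γ.g_symm, mul_comm]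

theorem sum_mul_deg_neg {x : V → ℤ} (hx : x ≠ 0) : ∑ a, x a * Γ.deg x a < 0 := by
  have h := Γ.negDef x hx
  rw [deg_mulVec]
  exact h

/-- Antinef vectors are effective. -/
theorem nonneg_of_deg_nonpos {x : V → ℤ} (h : ∀ a, Γ.deg x a ≤ 0) : 0 ≤ x := by
  set m : V → ℤ := fun a => max (-x a) 0 with hm
  set p : V → ℤ := fun a => max (x a) 0 with hp
  have hx : p = x + m := by
    funext a; simp only [hp, hm, Pi.add_apply]; omega
  have hm0 : m = 0 := by
    by_contra h0
    have h2 := Γ.sum_mul_deg_neg h0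
    -- The positive part `p` and the negative part `m` have disjoint supports, so `(m, p) ≥ 0`; with
    -- `(m, x) ≤ 0` this gives `(m, m) ≥ 0`, against negative definiteness.
    have h3 : 0 ≤ ∑ a, m a * Γ.deg p a := by
      refine Finset.sum_nonneg fun a _ => ?_
      by_cases ha : m a = 0
      · rw [ha, zero_mul]
      have hma : 0 ≤ m a := le_max_right _ _
      refine mul_nonneg hma (Finset.sum_nonneg fun b _ => ?_)
      rcases eq_or_ne b a with rfl | hb
      · have : p b = 0 := by simp only [hm, hp] at ha ⊢; omega
        rw [this, zero_mul]
      · exact mul_nonneg (le_max_right _ _) (Γ.g_nonneg hb)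
    have h4 : ∑ a, m a * Γ.deg p a = ∑ a, m a * Γ.deg x a + ∑ a, m a * Γ.deg m a := by
      rw [hx]; simp only [deg_add, mul_add, Finset.sum_add_distrib]
    have h5 : ∑ a, m a * Γ.deg x a ≤ 0 := Finset.sum_nonpos fun a _ =>
      mul_nonpos_of_nonneg_of_nonpos (le_max_right _ _) (h a)
    omega
  intro a
  have := congrFun hm0 a
  simp only [hm, Pi.zero_apply] at this ⊢
  omega

theorem det_ne_zero : (Matrix.of Γ.g).det ≠ 0 := by
  intro h
  obtain ⟨v, hv, h0⟩ := Matrix.exists_mulVec_eq_zero_iff.2 h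
  have := Γ.sum_mul_deg_neg hv
  rw [deg_mulVec, h0] at this
  simp at this

theorem exists_strictly_antinef : ∃ r : V → ℤ, (∀ a, 0 < r a) ∧ ∀ a, ∑ b, r b * Γ.g b a < 0 := by
  set M := Matrix.of Γ.g with hM
  -- By Cramer's rule all intersection numbers of this integral vector equal `-|det M|`.
  set r : V → ℤ := M.adjugate.mulVec fun _ => -M.det.sign with hr
  have h1 : ∀ a, Γ.deg r a < 0 := fun a => by
    rw [deg_mulVec, hr, Matrix.mulVec_mulVec, Matrix.mul_adjugate, Matrix.smul_mulVec,
      Matrix.one_mulVec]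
    simp only [Pi.smul_apply, smul_eq_mul, mul_neg]
    have : 0 < |M.det| := abs_pos.2 Γ.det_ne_zero
    rw [mul_comm, Int.sign_mul_self_eq_abs]
    omega
  have h0 := Γ.nonneg_of_deg_nonpos fun a => (h1 a).le
  refine ⟨r, fun a => lt_of_le_of_ne (h0 a) fun h => ?_, h1⟩
  refine absurd (h1 a) (not_lt.2 (Finset.sum_nonneg fun b _ => ?_))
  rcases eq_or_ne b a with rfl | hb
  · rw [← h]; simp
  · exact mul_nonneg (h0 b) (Γ.g_nonneg hb)

/-- Twice the Riemann–Roch function. -/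
def twoX (x : V → ℤ) : ℤ := ∑ a, x a * (Γ.g a a + 2) - ∑ a, x a * Γ.deg x a

theorem twoX_add (x y : V → ℤ) : Γ.twoX (x + y) = Γ.twoX x + Γ.twoX y - 2 * ∑ a, y a * Γ.deg x a := by
  have := Γ.sum_mul_deg_comm x y
  simp only [twoX, deg_add, Pi.add_apply, mul_add, add_mul, Finset.sum_add_distrib]
  linarith

/-- Parity is additive up to twice an intersection number, and for `t E_a` the correction contains
the even factor `t (t - 1)`. Integrality of `χ` is essential in the minimax argument. -/
theorem even_twoX (x : V → ℤ) : Even (Γ.twoX x) := by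
  rw [← Finset.univ_sum_single x]
  refine Finset.sum_induction _ (fun x => Even (Γ.twoX x)) (fun x y hx hy => ?_) (by simp [twoX])
    fun a _ => ?_
  · rw [twoX_add]
    exact (hx.add hy).sub (even_two_mul _)
  · have : Γ.twoX (Pi.single a (x a)) = 2 * x a - x a * (x a - 1) * Γ.g a a := by
      simp [twoX, deg, Pi.single_apply]; ring
    rw [this]
    exact (even_two_mul _).sub ((Int.even_mul_pred_self _).mul_right _)

/-- The lattice of the graph, twisted by `c`. -/
def twisted (c : V → ℤ) : TwistedLattice V where
  g := Γ.g
  g_symm := Γ.g_symm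
  g_nonneg _ _ h := Γ.g_nonneg h
  X x := Γ.twoX x / 2
  two_X x := Int.mul_ediv_cancel' (Γ.even_twoX x).two_dvd
  c := c
  r := Γ.exists_strictly_antinef.choose
  r_pos := Γ.exists_strictly_antinef.choose_spec.1
  r_neg := Γ.exists_strictly_antinef.choose_spec.2

theorem two_twisted_X (c x : V → ℤ) : 2 * (Γ.twisted c).X x = Γ.twoX x := (Γ.twisted c).two_X x

theorem pair_comm (x y : V → ℚ) : Γ.pair x y = Γ.pair y x := by
  unfold pair
  rw [dotProduct_comm, ← Matrix.vecMul_transpose, ← Matrix.dotProduct_mulVec]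
  congr 2
  ext a b
  rw [Matrix.transpose_apply, form_apply, form_apply, g_symm]

theorem pair_E (x : V → ℚ) (a : V) : Γ.pair x (E a) = ∑ b, x b * Γ.g b a := by
  simp only [pair, dotProduct, Matrix.mulVec, form_apply, E]
  simp

theorem pair_add_left (x y z : V → ℚ) : Γ.pair (x + y) z = Γ.pair x z + Γ.pair y z := by
  simp [pair, add_dotProduct]

theorem pair_add_right (x y z : V → ℚ) : Γ.pair x (y + z) = Γ.pair x y + Γ.pair x z := by
  simp [pair, Matrix.mulVec_add, dotProduct_add]

theorem pair_eq_sum (x y : V → ℚ) : Γ.pair x y = ∑ a, y a * Γ.pair x (E a) := by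
  rw [pair_comm]
  unfold pair dotProduct
  refine Finset.sum_congr rfl fun a _ => ?_
  congr 1
  rw [Matrix.mulVec, dotProduct]
  refine (Finset.sum_congr rfl fun b _ => ?_).trans (Γ.pair_E x a).symm
  rw [form_apply, g_symm, mul_comm]

theorem pair_toQ_E (x : V → ℤ) (a : V) : Γ.pair (toQ x) (E a) = Γ.deg x a := by
  rw [pair_E]; simp [deg, toQ]

theorem pair_toQ_toQ (x y : V → ℤ) : Γ.pair (toQ x) (toQ y) = (∑ a, y a * Γ.deg x a : ℤ) := by
  rw [pair_eq_sum]
  simp [pair_toQ_E, toQ]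

theorem isUnit_det_form : IsUnit Γ.form.det := by
  have h : Γ.form = (Matrix.of Γ.g).map (Int.castRingHom ℚ) := by
    ext a b; simp [form_apply]
  have h2 : Γ.form.det = ((Matrix.of Γ.g).det : ℚ) := by
    rw [h]; exact (RingHom.map_det (Int.castRingHom ℚ) (Matrix.of Γ.g)).symm
  rw [h2, isUnit_iff_ne_zero]
  exact_mod_cast Γ.det_ne_zero

theorem pair_ZK (x : V → ℚ) : Γ.pair x Γ.ZK = ∑ a, x a * ((Γ.e a : ℚ) + 2) := by
  unfold pair ZK
  rw [Matrix.mulVec_mulVec, Matrix.mul_nonsing_inv _ Γ.isUnit_det_form, Matrix.one_mulVec]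
  rfl

theorem chi_eq_X (c x : V → ℤ) :
    -(1 / 2) * Γ.pair (toQ x) (toQ x - Γ.ZK) = ((Γ.twisted c).X x : ℚ) := by
  have h := Γ.two_twisted_X c x
  have h2 : Γ.pair (toQ x) (toQ x - Γ.ZK) = Γ.pair (toQ x) (toQ x) - Γ.pair (toQ x) Γ.ZK := by
    simp [pair, Matrix.mulVec_sub, dotProduct_sub]
  have h3 : (2 : ℚ) * ((Γ.twisted c).X x : ℚ) = (Γ.twoX x : ℚ) := by exact_mod_cast h
  rw [h2, pair_ZK, pair_toQ_toQ]
  have h4 : (Γ.twoX x : ℚ) = ∑ a, toQ x a * ((Γ.e a : ℚ) + 2) - ((∑ a, x a * Γ.deg x a : ℤ) : ℚ) := by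
    unfold twoX
    push_cast
    simp [toQ, g_self]
  linarith

/-! ## The representative `s_h` -/

/-- The intersection numbers of an element of the dual lattice are integers. -/
theorem exists_int_of_mem_dualLattice {x : V → ℚ} (hx : x ∈ Γ.dualLattice) (a : V) :
    ∃ m : ℤ, Γ.pair x (E a) = m := by
  obtain ⟨m, hm⟩ := hx (Pi.single a 1)
  refine ⟨m, ?_⟩
  rw [← hm]
  congr 1
  funext b
  simp [E, toQ, Pi.single_apply]

theorem toQ_mem_dualLattice (z : V → ℤ) : toQ z ∈ Γ.dualLattice := fun l => by
  rw [pair_toQ_toQ]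
  exact ⟨_, rfl⟩

theorem mem_classSet_iff {h : Γ.H} {x y : V → ℚ} (hx : x ∈ Γ.classSet h) :
    y ∈ Γ.classSet h ↔ ∃ z : V → ℤ, y = x + toQ z := by
  obtain ⟨hx, rfl⟩ := hx
  constructor
  · rintro ⟨hy, h⟩
    rw [eq_comm, QuotientAddGroup.eq] at h
    obtain ⟨z, hz⟩ := h
    refine ⟨z, ?_⟩
    have : toQ z = -x + y := hz
    rw [this]; abel
  · rintro ⟨z, rfl⟩
    refine ⟨add_mem hx (Γ.toQ_mem_dualLattice z), ?_⟩
    rw [eq_comm, QuotientAddGroup.eq]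
    refine ⟨z, ?_⟩
    change toQ z = -x + (x + toQ z)
    abel

theorem classSet_nonempty (h : Γ.H) : (Γ.classSet h).Nonempty := by
  obtain ⟨⟨x, hx⟩, rfl⟩ := QuotientAddGroup.mk_surjective h
  exact ⟨x, hx, rfl⟩

/-- Relative to any representative of the class, with its intersection numbers as the twist, the
least element is the lift in which no coordinate is prescribed. -/
theorem exists_isLeast_cone_class (h : Γ.H) :
    ∃ x, IsLeast (Γ.lipmanCone ∩ Γ.classSet h) x := by
  obtain ⟨x, hx⟩ := Γ.classSet_nonempty h
  choose c hc using Γ.exists_int_of_mem_dualLattice hx.1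
  have hN : ∀ (z : V → ℤ) a, Γ.pair (x + toQ z) (E a) = ((Γ.twisted c).N z a : ℤ) := fun z a => by
    rw [pair_add_left, hc, pair_toQ_E, TwistedLattice.N, add_comm]
    push_cast
    rfl
  set v := (Γ.twisted c).lift Finset.univ 0 with hv
  have hvc : x + toQ v ∈ Γ.classSet h := (Γ.mem_classSet_iff hx).2 ⟨v, rfl⟩
  refine ⟨x + toQ v, ⟨⟨hvc.1, fun a => ?_⟩, hvc⟩, ?_⟩
  · rw [hN]
    exact_mod_cast TwistedLattice.N_lift (Finset.mem_univ a)
  · rintro y ⟨⟨-, hy⟩, hyc⟩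
    obtain ⟨z, rfl⟩ := (Γ.mem_classSet_iff hx).1 hyc
    have hz : v ≤ z := TwistedLattice.lift_le (fun b hb => absurd (Finset.mem_univ b) hb)
      fun a _ => by
        have := hy a
        rw [hN] at this
        exact_mod_cast this
    exact add_le_add_right (fun a => by simpa [toQ] using hz a) x

theorem isLeast_sMin (h : Γ.H) : IsLeast (Γ.lipmanCone ∩ Γ.classSet h) (Γ.sMin h) :=
  Classical.epsilon_spec (Γ.exists_isLeast_cone_class h)

theorem exists_pair_sMin (h : Γ.H) (a : V) : ∃ m : ℤ, Γ.pair (Γ.sMin h) (E a) = m :=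
  Γ.exists_int_of_mem_dualLattice (Γ.isLeast_sMin h).1.1.1 a

/-- The twisted lattice of the class `h`. -/
def latticeOf (h : Γ.H) : TwistedLattice V := Γ.twisted fun a => (Γ.exists_pair_sMin h a).choose

theorem latticeOf_c (h : Γ.H) (a : V) : (((Γ.latticeOf h).c a : ℤ) : ℚ) = Γ.pair (Γ.sMin h) (E a) :=
  (Γ.exists_pair_sMin h a).choose_spec.symm

theorem latticeOf_N (h : Γ.H) (x : V → ℤ) (a : V) :
    (((Γ.latticeOf h).N x a : ℤ) : ℚ) = Γ.pair (toQ x + Γ.sMin h) (E a) := by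
  rw [pair_add_left, ← latticeOf_c, pair_toQ_E, TwistedLattice.N]
  push_cast
  rfl

theorem latticeOf_c_nonpos (h : Γ.H) (a : V) : (Γ.latticeOf h).c a ≤ 0 := by
  have := (Γ.isLeast_sMin h).1.1.2 a
  rw [← latticeOf_c] at this
  exact_mod_cast this

/-- Such an `x` gives the element `x + s_h` of the cone in the same class, and `s_h` is the smallest
one. This keeps universal cycles in the first quadrant. -/
theorem nonneg_of_latticeOf_N (h : Γ.H) (x : V → ℤ) (hx : ∀ a, (Γ.latticeOf h).N x a ≤ 0) :
    0 ≤ x := by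
  have hm : toQ x + Γ.sMin h ∈ Γ.classSet h :=
    (Γ.mem_classSet_iff (Γ.isLeast_sMin h).1.2).2 ⟨x, add_comm _ _⟩
  have h1 := (Γ.isLeast_sMin h).2 ⟨⟨hm.1, fun a => by
    rw [← latticeOf_N]; exact_mod_cast hx a⟩, hm⟩
  intro a
  have := h1 a
  simp only [Pi.add_apply, toQ, le_add_iff_nonneg_left] at this
  exact_mod_cast this

theorem chi_eq_f (h : Γ.H) (x : V → ℤ) : Γ.chi h x = ((Γ.latticeOf h).f x : ℚ) := by
  have h1 := Γ.chi_eq_X (Γ.latticeOf h).c x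
  have h2 : Γ.chi h x = -(1 / 2) * Γ.pair (toQ x) (toQ x - Γ.ZK) - Γ.pair (toQ x) (Γ.sMin h) := by
    unfold chi kChar
    have : toQ x + (-Γ.ZK + (2 : ℚ) • Γ.sMin h) =
      (toQ x - Γ.ZK) + (Γ.sMin h + Γ.sMin h) := by rw [two_smul]; abel
    rw [this, pair_add_right, pair_add_right]
    ring
  rw [h2, h1, pair_comm, pair_eq_sum, TwistedLattice.f]
  push_cast
  simp only [latticeOf_c]
  rfl

end ResolutionGraph
end FilteredLattice

namespace FilteredLattice

namespace ResolutionGraph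

open FilteredComplex

variable {V : Type} [Fintype V] (Γ : ResolutionGraph V)

/-! ## The reduction theorem -/

/-- The labels are the components left after deleting the edges at `j`. In a tree every edge is a
bridge, so no component contains two neighbours of `j`. -/
theorem exists_isBranching (c : V → ℤ) (j : V) :
    ∃ lab : V → (Γ.graph.deleteEdges (Γ.graph.incidenceSet j)).ConnectedComponent,
      (Γ.twisted c).IsBranching j lab := by
  set G := Γ.graph.deleteEdges (Γ.graph.incidenceSet j) with hG
  refine ⟨G.connectedComponentMk, fun a b ha hb hg => ?_, fun a b ha hb hga hgb hab => ?_⟩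
  · rcases eq_or_ne a b with rfl | h
    · rfl
    refine SimpleGraph.ConnectedComponent.sound (SimpleGraph.Adj.reachable ?_)
    rw [hG, SimpleGraph.deleteEdges_adj]
    refine ⟨Γ.adj_of_g_ne_zero h hg, fun hmem => ?_⟩
    have := hmem.2
    rw [Sym2.mem_iff] at this
    rcases this with h | h
    exacts [ha h.symm, hb h.symm]
  · by_contra hne
    have haj := Γ.adj_of_g_ne_zero ha hga
    have hbj := Γ.adj_of_g_ne_zero hb hgb
    have hbr := SimpleGraph.isAcyclic_iff_forall_isBridge.1 Γ.isTree.isAcyclic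
      ((SimpleGraph.mem_edgeSet _).2 haj)
    rw [SimpleGraph.isBridge_iff] at hbr
    have hle : G ≤ Γ.graph.deleteEdges {s(a, j)} := fun x y hxy => by
      rw [hG, SimpleGraph.deleteEdges_adj] at hxy
      rw [SimpleGraph.deleteEdges_adj]
      refine ⟨hxy.1, fun h => hxy.2 ?_⟩
      rw [Set.mem_singleton_iff] at h
      rw [h]
      exact ⟨haj, Sym2.mem_mk_right _ _⟩
    refine hbr (((SimpleGraph.ConnectedComponent.exact hab).mono hle).trans
      (SimpleGraph.Adj.reachable ?_))
    rw [SimpleGraph.deleteEdges_adj]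
    refine ⟨hbj, fun h => ?_⟩
    rw [Set.mem_singleton_iff, Sym2.eq_iff] at h
    rcases h with h | h
    exacts [hne h.1.symm, hb h.1]

theorem xCycle_eq {B D : Finset V} (hBD : ∀ a, a ∈ B ↔ a ∉ D) (h : Γ.H) (l : ↥B → ℤ)
    {x : V → ℤ} (hx : ∀ i : ↥B, x i = l i) : Γ.xCycle B h l = (Γ.latticeOf h).lift D x := by
  have hset : {x : V → ℤ | (∀ i : ↥B, x i = l i) ∧
      ∀ i, i ∉ B → Γ.pair (toQ x + Γ.sMin h) (E i) ≤ 0} = (Γ.latticeOf h).fiber D x := by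
    ext y
    refine and_congr ⟨fun hy b hb => ?_, fun hy i => ?_⟩ (forall_congr' fun a => ?_)
    · have hbB := (hBD b).2 hb
      exact (hy ⟨b, hbB⟩).trans (hx ⟨b, hbB⟩).symm
    · rw [hy i ((hBD i).1 i.2), hx]
    · rw [hBD, not_not, ← latticeOf_N]
      exact imp_congr_right fun _ => by norm_cast
  have h1 := (Γ.latticeOf h).isLeast_lift D x
  rw [← hset] at h1
  exact (Classical.epsilon_spec (p := fun x => IsLeast _ x) ⟨_, h1⟩).unique h1

theorem redWeight_eq {B D : Finset V} (hBD : ∀ a, a ∈ B ↔ a ∉ D) (h : Γ.H) (l : ↥B → ℤ)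
    {x : V → ℤ} (hx : ∀ i : ↥B, x i = l i) :
    Γ.redWeight B h l = ((Γ.latticeOf h).f ((Γ.latticeOf h).lift D x) : ℚ) := by
  rw [redWeight, xCycle_eq Γ hBD h l hx, chi_eq_f]

theorem antitone_pair {s : V → ℚ} (hs : s ∈ Γ.lipmanCone) :
    Antitone fun l : V → ℤ => Γ.pair s (toQ l) := fun l l' hl => by
  dsimp only
  rw [pair_eq_sum, pair_eq_sum]
  refine Finset.sum_le_sum fun a _ => mul_le_mul_of_nonpos_right ?_ (hs.2 a)
  simpa [toQ] using hl a

theorem extendZero_mono {V : Type} (B : Finset V) : Monotone (extendZero B) := fun l l' hl a => by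
  unfold extendZero
  split_ifs with h
  exacts [hl ⟨a, h⟩, le_rfl]

theorem pair_toQ_congr {s : V → ℚ} {x y : V → ℤ} (h : ∀ a, x a = y a ∨ Γ.pair s (E a) = 0) :
    Γ.pair s (toQ x) = Γ.pair s (toQ y) := by
  rw [pair_eq_sum, pair_eq_sum]
  refine Finset.sum_congr rfl fun a _ => ?_
  rcases h a with h | h
  · simp only [toQ, h]
  · rw [h, mul_zero, mul_zero]

/-- Vertices of `D` are eliminated one at a time. Before `j` is removed, the reduced weight along
its coordinate is the minimum of `f` on a slice; afterwards it is the value at the full lift.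
Orthogonality of `s` to `E_j` makes the filtration independent of this coordinate. -/
theorem pageEquiv_redFilteredChains {s : V → ℚ} (hs : s ∈ Γ.lipmanCone) (h : Γ.H) (n : ℤ)
    (D : Finset V) : (Γ.latticeOf h).IsRationalOn D → (∀ a ∈ D, Γ.pair s (E a) = 0) →
    ∀ B : Finset V, (∀ a, a ∈ B ↔ a ∉ D) →
    PageEquiv (Γ.filteredChains s h n) (Γ.redFilteredChains B s h n) := by
  induction D using Finset.induction_on with
  | empty =>
    intro _ _ B hB
    refine pageEquiv_reindex ((Equiv.Set.univ V).symm.trans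
      (Equiv.subtypeEquivRight fun a => by simp [hB])) _ _ (Γ.antitone_pair hs) _ _
      (fun l => ?_) (fun l => ?_) n
    · rw [redWeight_eq Γ hB h l (x := fun a => l ⟨a, by simp [hB]⟩) fun i => rfl, chi_eq_f]
      congr 2
      exact funext fun a => TwistedLattice.lift_off (by simp)
    · refine Γ.pair_toQ_congr fun a => Or.inl ?_
      have : a ∈ B := by simp [hB]
      simp [extendZero, this]
      rfl
  | insert j D hj ih =>
    intro hD hsD B hB
    have hjB : j ∉ B := by simp [hB]
    have hB' : ∀ a, a ∈ insert j B ↔ a ∉ D := fun a => by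
      rw [Finset.mem_insert, hB, Finset.mem_insert]
      by_cases haj : a = j
      · simp [haj, hj]
      · simp [haj]
    refine (ih (hD.mono (Finset.subset_insert j D))
      (fun a ha => hsD a (Finset.mem_insert_of_mem ha)) (insert j B) hB').trans ?_
    set σ := Finset.subtypeInsertEquivOption hjB with hσ
    have hσj : ∀ i, σ i = none ↔ (i : V) = j := fun i => by
      simp only [hσ, Finset.subtypeInsertEquivOption, Equiv.coe_fn_mk]
      split_ifs with h <;> simp [h]
    have hσs : ∀ (i : ↥(insert j B)) (hi : (i : V) ∈ B), σ i = some ⟨i, hi⟩ := fun i hi => by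
      have : (i : V) ≠ j := fun h => hjB (h ▸ hi)
      simp [hσ, Finset.subtypeInsertEquivOption, this]
    set φ : (↥B → ℤ) → ℚ := fun l => Γ.pair s (toQ (extendZero B l)) with hφ
    have hφa : Antitone φ := (Γ.antitone_pair hs).comp_monotone (extendZero_mono B)
    have hw : ∀ (l : ↥B → ℤ) (x : V → ℤ), (∀ i : ↥B, x i = l i) → ∀ t : ℤ,
        Γ.redWeight (insert j B) h (fun i => withValue l t (σ i)) =
          ((Γ.latticeOf h).sliceMin D j x t : ℚ) := fun l x hx t => by
      refine redWeight_eq Γ hB' h _ fun i => ?_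
      by_cases hi : (i : V) = j
      · rw [hi, Function.update_self, (hσj i).2 hi]; rfl
      · have hiB : (i : V) ∈ B := (Finset.mem_insert.1 i.2).resolve_left hi
        rw [Function.update_of_ne hi, hσs i hiB]
        exact hx ⟨i, hiB⟩
    refine (pageEquiv_reindex σ _ _ ((Γ.antitone_pair hs).comp_monotone
      (extendZero_mono (insert j B))) (fun l => Γ.redWeight (insert j B) h fun i => l (σ i))
      (fun l => φ fun i => l (some i)) (fun l => rfl) (fun l => ?_) n).trans ?_
    · refine Γ.pair_toQ_congr fun a => ?_
      by_cases haj : a = j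
      · exact Or.inr (hsD a (by simp [haj]))
      left
      by_cases haB : a ∈ B
      · simp only [extendZero, dif_pos haB, dif_pos (Finset.mem_insert_of_mem haB)]
        rw [hσs _ haB]
      · simp [extendZero, haB, haj]
    have hext : ∀ (l : ↥B → ℤ) (i : ↥B), extendZero B l i = l i := fun l i => by
      simp [extendZero]
    refine pageEquiv_eliminate _ _ φ n hφa (fun l _ a b c _ hab hbc ha hc => ?_)
      (fun l _ t _ ht => ?_) (fun l I hl hI => ?_)
    · rw [hw l _ (hext l)] at *
      exact_mod_cast TwistedLattice.sliceMin_ordConnected hj hD hab hbc (by exact_mod_cast ha)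
        (by exact_mod_cast hc)
    · rw [hw l _ (hext l)] at ht
      rw [redWeight_eq Γ hB h l (hext l)]
      refine le_trans ?_ ht
      exact_mod_cast TwistedLattice.lift_le_sliceMin hD t
    · obtain ⟨lab, hlab⟩ := Γ.exists_isBranching (Γ.latticeOf h).c j
      set x := extendZero B l with hx
      have hx0 : 0 ≤ x := fun a => by
        simp only [hx, extendZero]
        split_ifs
        exacts [hl _, le_rfl]
      set I' : Finset V := I.map (Function.Embedding.subtype _) with hI'
      have h1 : ∀ K ⊆ I', (Γ.latticeOf h).f ((Γ.latticeOf h).lift (insert j D) (x + sumE K)) ≤ n := by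
        intro K hK
        have h1 := hI (I.filter fun i => (i : V) ∈ K) (Finset.filter_subset _ _)
        have h2 : ∀ i : ↥B, (x + sumE K) i =
            (l + sumE (W := ↥B) (I.filter fun i : ↥B => (i : V) ∈ K) : ↥B → ℤ) i := by
          intro i
          have : (i : V) ∈ K → i ∈ I := fun hi => by
            have := hK hi
            simpa [hI'] using this
          simp only [Pi.add_apply, sumE, Finset.mem_filter, hx, hext]
          by_cases hi : (i : V) ∈ K
          · simp [hi, this hi]
          · simp [hi]
        rw [redWeight_eq Γ hB h _ h2] at h1
        exact_mod_cast h1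
      -- Effectiveness of the full lifts is needed because the complex consists only of cubes in the
      -- first quadrant.
      have h2 : ∀ K ⊆ I', 0 ≤ (Γ.latticeOf h).lift (insert j D) (x + sumE K) j := by
        intro K _
        refine TwistedLattice.lift_nonneg (Γ.latticeOf_c_nonpos h) (Γ.nonneg_of_latticeOf_N h)
          (fun a _ => add_nonneg (hx0 a) ?_) j
        unfold sumE
        split_ifs <;> simp
      obtain ⟨t, ht0, ht⟩ := TwistedLattice.exists_common_nonneg_slice hlab hj hD I' n h1 h2
      refine ⟨t, ht0, fun K hK => ?_⟩
      rw [hw (l + sumE K) (x + sumE (K.map (Function.Embedding.subtype _)))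
        (fun i => by simp [sumE, hx, hext])]
      exact_mod_cast ht _ (Finset.map_subset_map.2 hK)

/-- The decoration at `a` enters `2χ(y)` only through `(y a - (y a)²) e_a`, which vanishes when `y
a` is `0` or `1`. Changing decorations outside `D` therefore does not affect `χ` on cycles reduced
there, and Artin's criterion for the modified graph applies. -/
theorem isRationalOn_of_isSRSet {B D : Finset V} (hBD : ∀ a ∈ D, a ∉ B) (hB : Γ.IsSRSet B)
    (c : V → ℤ) : (Γ.twisted c).IsRationalOn D := by
  obtain ⟨Γ', hg, -, he, hrat⟩ := hB
  intro y hy0 hne hy1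
  have h := hrat y hy0 hne
  rw [Γ'.chi_eq_X c y] at h
  have h1 := Γ'.two_twisted_X c y
  have h2 := Γ.two_twisted_X c y
  have h3 : Γ'.twoX y = Γ.twoX y := by
    rw [twoX, twoX, ← Finset.sum_sub_distrib, ← Finset.sum_sub_distrib]
    refine Finset.sum_congr rfl fun a _ => ?_
    have hdeg : Γ'.deg y a = Γ.deg y a + y a * (Γ'.e a - Γ.e a) := by
      have : ∀ b, y b * Γ'.g b a =
          y b * Γ.g b a + if b = a then y b * (Γ'.e b - Γ.e b) else 0 := fun b => by
        simp only [g, hg]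
        split_ifs <;> ring
      simp only [deg, this, Finset.sum_add_distrib]
      simp
    rw [hdeg, g_self, g_self]
    by_cases ha : a ∈ D
    · rw [he a (hBD a ha)]; ring
    · have h4 := hy0 a
      have h5 := hy1 a ha
      simp only [Pi.zero_apply] at h4
      have : y a = 0 ∨ y a = 1 := by omega
      rcases this with h | h <;> rw [h] <;> ring
  have h' : 1 ≤ (Γ'.twisted c).X y := by exact_mod_cast h
  omega

end ResolutionGraph
end FilteredLattice

namespace FilteredLattice

/-! ## Reduced cycles of a tree -/

namespace ResolutionGraph

open FilteredComplex

variable {V : Type} [Fintype V] (Γ : ResolutionGraph V)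

/-- The decorations cancel, leaving twice the number of vertices minus twice the number of edges,
which is `2` for a tree. -/
theorem twoX_univ : Γ.twoX (sumE Finset.univ) = 2 := by
  have h1 : ∀ a, Γ.deg (sumE Finset.univ) a = Γ.e a + Γ.graph.degree a := fun a => by
    have : ∀ b, sumE Finset.univ b * Γ.g b a =
        (if b = a then Γ.e b else 0) + if Γ.graph.Adj a b then 1 else 0 := fun b => by
      rcases eq_or_ne b a with rfl | h
      · simp [sumE, g]
      · simp [sumE, g, h, SimpleGraph.adj_comm]
    rw [deg, Finset.sum_congr rfl fun b _ => this b, Finset.sum_add_distrib,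
      ← SimpleGraph.card_neighborFinset_eq_degree, SimpleGraph.neighborFinset_eq_filter]
    simp
  have h2 := Γ.graph.sum_degrees_eq_twice_card_edges
  have h3 := Γ.isTree.card_edgeFinset
  have h4 : ∑ a, (Γ.graph.degree a : ℤ) = 2 * (Γ.graph.edgeFinset.card : ℤ) := by exact_mod_cast h2
  have h5 : (Γ.graph.edgeFinset.card : ℤ) + 1 = Fintype.card V := by exact_mod_cast h3
  unfold twoX
  simp only [h1, g_self]
  simp only [sumE, Finset.mem_univ, if_true, one_mul, Finset.sum_add_distrib, h4]
  simp
  omega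

/-- Nonempty reduced cycles on a tree have `χ ≥ 1`. -/
theorem one_le_X_sumE (c : V → ℤ) {K : Finset V} (hK : K.Nonempty) :
    1 ≤ (Γ.twisted c).X (sumE K) := by
  obtain ⟨d, hd⟩ : ∃ d, Kᶜ.card = d := ⟨_, rfl⟩
  induction d generalizing K with
  | zero =>
    have hK' : K = Finset.univ := by rwa [Finset.card_eq_zero, Finset.compl_eq_empty_iff] at hd
    have h1 := Γ.two_twisted_X c (sumE K)
    rw [hK', twoX_univ] at h1
    rw [hK']
    omega
  | succ d ih =>
    obtain ⟨u, hu⟩ := hK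
    obtain ⟨v, hv⟩ : Kᶜ.Nonempty := Finset.card_pos.1 (by omega)
    obtain ⟨p⟩ := Γ.isTree.connected.preconnected u v
    -- A path from `K` to its complement crosses an edge. Adding its outer endpoint does not raise
    -- `χ`, so the bound passes from the larger set to `K`.
    obtain ⟨e, -, h1, h2⟩ := p.exists_boundary_dart (K : Set V) hu (by simpa using hv)
    have h1 : e.fst ∈ K := h1
    have h2 : e.snd ∉ K := h2
    have h3 := ih (K := insert e.snd K) ⟨_, Finset.mem_insert_self _ _⟩ (by
      rw [Finset.compl_insert, Finset.card_erase_of_mem (by simpa using h2), hd]; rfl)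
    have h4 : sumE (insert e.snd K) = sumE K + Pi.single e.snd 1 := by
      funext a
      simp only [sumE, Finset.mem_insert, Pi.add_apply, Pi.single_apply]
      by_cases ha : a = e.snd
      · rw [ha]; simp [h2]
      · simp [ha]
    rw [h4, TwistedLattice.X_add_single] at h3
    have h5 : 1 ≤ (Γ.twisted c).pr (sumE K) e.snd := by
      have hne : e.fst ≠ e.snd := e.adj.ne
      have h6 : sumE K e.fst * Γ.g e.fst e.snd = 1 := by
        rw [g_of_ne _ hne, if_pos e.adj]; simp [sumE, h1]
      rw [← h6]
      refine Finset.single_le_sum (f := fun b => sumE K b * Γ.g b e.snd) (fun b _ => ?_)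
        (Finset.mem_univ e.fst)
      by_cases hb : b ∈ K
      · have hbe : b ≠ e.snd := fun h => h2 (h ▸ hb)
        simpa [sumE, hb] using Γ.g_nonneg hbe
      · simp [sumE, hb]
    omega

theorem deg_single (a b : V) (t : ℤ) : Γ.deg (Pi.single a t) b = t * Γ.g a b := by
  simp [deg, Pi.single_apply]

theorem twoX_single (a : V) (t : ℤ) : Γ.twoX (Pi.single a t) = 2 * t - t * (t - 1) * Γ.g a a := by
  simp [twoX, deg, Pi.single_apply]; ring

end ResolutionGraph

/-! ## Blow-ups -/

/-- The pullback of integral cycles. -/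
def pullbackInt {V₁ V₂ : Type} (σ : Option V₂ ≃ V₁) (c : Finset V₂) (x : V₂ → ℤ) : V₁ → ℤ :=
  fun v => (σ.symm v).elim (∑ i ∈ c, x i) x

section Pullback

variable {V₁ V₂ : Type} (σ : Option V₂ ≃ V₁) (c : Finset V₂)

theorem pullback_new (x : V₂ → ℚ) : pullback σ c x (σ none) = ∑ i ∈ c, x i := by simp [pullback]

theorem pullback_old (x : V₂ → ℚ) (i : V₂) : pullback σ c x (σ (some i)) = x i := by
  simp [pullback]

theorem pullbackInt_new (x : V₂ → ℤ) : pullbackInt σ c x (σ none) = ∑ i ∈ c, x i := by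
  simp [pullbackInt]

theorem pullbackInt_old (x : V₂ → ℤ) (i : V₂) : pullbackInt σ c x (σ (some i)) = x i := by
  simp [pullbackInt]

theorem forall_vertex {p : V₁ → Prop} (h₀ : p (σ none)) (h : ∀ i, p (σ (some i))) (a : V₁) : p a := by
  obtain ⟨o, rfl⟩ := σ.surjective a
  cases o
  exacts [h₀, h _]

theorem toQ_pullbackInt (x : V₂ → ℤ) :
    ResolutionGraph.toQ (pullbackInt σ c x) = pullback σ c (ResolutionGraph.toQ x) :=
  funext <| forall_vertex σ (by simp [ResolutionGraph.toQ, pullbackInt_new, pullback_new])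
    fun i => by simp [ResolutionGraph.toQ, pullbackInt_old, pullback_old]

theorem pullback_add (x y : V₂ → ℚ) :
    pullback σ c (x + y) = pullback σ c x + pullback σ c y :=
  funext <| forall_vertex σ (by simp [pullback_new, Finset.sum_add_distrib])
    fun i => by simp [pullback_old]

/-- Used as an orthogonal decomposition: for a blow-up, pullbacks have zero intersection number with
the new vertex. -/
theorem eq_pullbackInt_add (z : V₁ → ℤ) : z = pullbackInt σ c (fun i => z (σ (some i))) +
    Pi.single (σ none) (z (σ none) - ∑ i ∈ c, z (σ (some i))) :=
  funext <| forall_vertex σ (by simp [pullbackInt_new]) fun i => by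
    have : σ (some i) ≠ σ none := σ.injective.ne (by simp)
    simp [pullbackInt_old, this]

theorem sum_vertex [Fintype V₁] [Fintype V₂] {M : Type} [AddCommMonoid M] (F : V₁ → M) :
    ∑ a, F a = F (σ none) + ∑ i, F (σ (some i)) := by
  rw [← Equiv.sum_comp σ F, Fintype.sum_option]

end Pullback

namespace IsBlowUp

open ResolutionGraph FilteredComplex

variable {V₁ V₂ : Type} [Fintype V₁] [Fintype V₂] {Γ₁ : ResolutionGraph V₁}
  {Γ₂ : ResolutionGraph V₂} {σ : Option V₂ ≃ V₁} {c : Finset V₂} (hb : IsBlowUp Γ₁ Γ₂ σ c)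
include hb

theorem adj_of_mem {i j : V₂} (hi : i ∈ c) (hj : j ∈ c) (hij : i ≠ j) : Γ₂.graph.Adj i j := by
  rcases hb.center with ⟨v, rfl⟩ | ⟨u, v, h, rfl⟩
  · rw [Finset.mem_singleton] at hi hj
    exact absurd (hi.trans hj.symm) hij
  · simp only [Finset.mem_insert, Finset.mem_singleton] at hi hj
    rcases hi with rfl | rfl <;> rcases hj with rfl | rfl
    exacts [absurd rfl hij, h, h.symm, absurd rfl hij]

theorem g_new_new : Γ₁.g (σ none) (σ none) = -1 := by rw [g_self, hb.e_new]

theorem g_old_new (i : V₂) : Γ₁.g (σ (some i)) (σ none) = if i ∈ c then 1 else 0 := by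
  rw [g_of_ne _ (σ.injective.ne (by simp)), SimpleGraph.adj_comm]
  by_cases hi : i ∈ c <;> simp [hb.adj_new, hi]

theorem g_old_old (i j : V₂) :
    Γ₁.g (σ (some i)) (σ (some j)) = Γ₂.g i j - if i ∈ c ∧ j ∈ c then 1 else 0 := by
  rcases eq_or_ne i j with rfl | h
  · rw [g_self, g_self, hb.e_old]
    by_cases hi : i ∈ c <;> simp [hi]
  · rw [g_of_ne _ h, g_of_ne _ (σ.injective.ne (by simpa using h)), hb.adj_old]
    by_cases hc : i ∈ c ∧ j ∈ c
    · simp [hc, hb.adj_of_mem hc.1 hc.2 h]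
    · simp [hc]

theorem pair_pullback_new (x : V₂ → ℚ) : Γ₁.pair (pullback σ c x) (E (σ none)) = 0 := by
  rw [pair_E, sum_vertex σ, pullback_new, hb.g_new_new]
  simp [pullback_old, hb.g_old_new]

theorem pair_pullback_old (x : V₂ → ℚ) (i : V₂) :
    Γ₁.pair (pullback σ c x) (E (σ (some i))) = Γ₂.pair x (E i) := by
  rw [pair_E, pair_E, sum_vertex σ, pullback_new, g_symm, hb.g_old_new]
  simp only [pullback_old, hb.g_old_old]
  by_cases hi : i ∈ c
  · simp [hi, mul_sub, Finset.sum_sub_distrib]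
  · simp [hi]

theorem deg_pullback_new (x : V₂ → ℤ) : Γ₁.deg (pullbackInt σ c x) (σ none) = 0 := by
  have h := hb.pair_pullback_new (toQ x)
  rw [← toQ_pullbackInt, pair_toQ_E] at h
  exact_mod_cast h

theorem deg_pullback_old (x : V₂ → ℤ) (i : V₂) :
    Γ₁.deg (pullbackInt σ c x) (σ (some i)) = Γ₂.deg x i := by
  have h := hb.pair_pullback_old (toQ x) i
  rw [← toQ_pullbackInt, pair_toQ_E, pair_toQ_E] at h
  exact_mod_cast h

theorem twoX_pullback (x : V₂ → ℤ) : Γ₁.twoX (pullbackInt σ c x) = Γ₂.twoX x := by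
  unfold twoX
  rw [sum_vertex σ, sum_vertex σ]
  simp only [hb.deg_pullback_new, hb.deg_pullback_old, pullbackInt_new, pullbackInt_old,
    hb.g_new_new, hb.g_old_old, and_self]
  have : ∑ i ∈ c, x i = ∑ i, x i * (if i ∈ c then 1 else 0) := by simp
  rw [this]
  simp only [mul_add, mul_sub, Finset.sum_add_distrib, Finset.sum_sub_distrib]
  ring

/-- Writing `y = ψ^*x + a E_new` gives `2χ(y) = 2χ(x) + a (a + 1)`, and `a (a + 1) ≥ 0` for
integers. If `x ≠ 0`, it is a nonempty reduced cycle on a tree; if `x = 0`, then `a ≥ 1`. -/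
theorem isRationalOn (t : V₁ → ℤ) : (Γ₁.twisted t).IsRationalOn {σ none} := by
  intro y hy0 hne hy1
  set x : V₂ → ℤ := fun i => y (σ (some i)) with hx
  set a := y (σ none) - ∑ i ∈ c, x i with ha
  have hy : y = pullbackInt σ c x + Pi.single (σ none) a := eq_pullbackInt_add σ c y
  have h1 : Γ₁.twoX y = Γ₂.twoX x + a * (a + 1) := by
    rw [hy, twoX_add, hb.twoX_pullback, twoX_single, hb.g_new_new]
    simp [Pi.single_apply, hb.deg_pullback_new]
    ring
  have h2 := Γ₁.two_twisted_X t y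
  set K : Finset V₂ := Finset.univ.filter fun i => x i = 1 with hK
  have hxK : x = sumE K := funext fun i => by
    have h3 := hy0 (σ (some i))
    have h4 := hy1 (σ (some i)) (by simp)
    simp only [sumE, hK, Finset.mem_filter, Finset.mem_univ, true_and, hx, Pi.zero_apply] at *
    split_ifs <;> omega
  have h3 : 0 ≤ a * (a + 1) := by
    rcases le_or_gt 0 a with h | h
    · positivity
    · exact mul_nonneg_of_nonpos_of_nonpos h.le (by omega)
  rcases K.eq_empty_or_nonempty with h | h
  · have hx0 : x = 0 := by rw [hxK, h]; funext i; simp [sumE]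
    have h4 : Γ₂.twoX x = 0 := by rw [hx0]; simp [twoX]
    have h5 : a = y (σ none) := by rw [ha, hx0]; simp
    have h6 : 0 ≤ y (σ none) := hy0 _
    have h7 : a ≠ 0 := fun h => hne (by
      rw [hy, hx0, h]
      exact funext <| forall_vertex σ (by simp [pullbackInt_new]) fun i => by simp [pullbackInt_old])
    have : 1 ≤ a := by omega
    nlinarith
  · have h4 := Γ₂.one_le_X_sumE 0 h
    have h5 := Γ₂.two_twisted_X 0 (sumE K)
    rw [← hxK] at h4 h5
    omega

/-- An element of the cone in the class is `ψ^*s_h + ψ^*l + a E_new`. Antinefness at the new vertex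
gives `a ≥ 0`; at the old vertices it then shows that `l + s_h` is antinef, so `l ≥ 0` by minimality
of `s_h`. -/
theorem sMin_eq {h₁ : Γ₁.H} {h₂ : Γ₂.H} {x : V₂ → ℚ} (hx : x ∈ Γ₂.classSet h₂)
    (hx' : pullback σ c x ∈ Γ₁.classSet h₁) : Γ₁.sMin h₁ = pullback σ c (Γ₂.sMin h₂) := by
  have hs := Γ₂.isLeast_sMin h₂
  have hcl : pullback σ c (Γ₂.sMin h₂) ∈ Γ₁.classSet h₁ := by
    obtain ⟨z, hz⟩ := (Γ₂.mem_classSet_iff hx).1 hs.1.2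
    refine (Γ₁.mem_classSet_iff hx').2 ⟨pullbackInt σ c z, ?_⟩
    rw [hz, pullback_add, toQ_pullbackInt]
  refine (Γ₁.isLeast_sMin h₁).unique ⟨⟨⟨hcl.1, forall_vertex σ ?_ fun i => ?_⟩, hcl⟩, ?_⟩
  · rw [hb.pair_pullback_new]
  · rw [hb.pair_pullback_old]
    exact hs.1.1.2 i
  · rintro y ⟨⟨-, hy⟩, hyc⟩
    obtain ⟨z, rfl⟩ := (Γ₁.mem_classSet_iff hcl).1 hyc
    set l : V₂ → ℤ := fun i => z (σ (some i)) with hl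
    set a := z (σ none) - ∑ i ∈ c, l i with ha
    have hz : z = pullbackInt σ c l + Pi.single (σ none) a := eq_pullbackInt_add σ c z
    have ha0 : 0 ≤ a := by
      have h := hy (σ none)
      rw [pair_add_left, hb.pair_pullback_new, pair_toQ_E, hz, deg_add, hb.deg_pullback_new,
        deg_single, hb.g_new_new] at h
      have h : ((-a : ℤ) : ℚ) ≤ 0 := by simpa using h
      have : -a ≤ 0 := by exact_mod_cast h
      omega
    have hl0 : 0 ≤ l := Γ₂.nonneg_of_latticeOf_N h₂ l fun i => by
      have h := hy (σ (some i))
      rw [pair_add_left, hb.pair_pullback_old, pair_toQ_E, hz, deg_add, hb.deg_pullback_old,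
        deg_single, g_symm, hb.g_old_new, ← latticeOf_c] at h
      have h : Γ₂.deg l i + (a * if i ∈ c then 1 else 0) + (Γ₂.latticeOf h₂).c i ≤ 0 := by
        rw [add_comm]; exact_mod_cast h
      have h' : 0 ≤ a * if i ∈ c then 1 else 0 := by split_ifs <;> simp [ha0]
      have h'' : (Γ₂.latticeOf h₂).N l i = Γ₂.deg l i + (Γ₂.latticeOf h₂).c i := rfl
      omega
    have hz0 : 0 ≤ z := forall_vertex σ (by
      have := Finset.sum_nonneg fun i (_ : i ∈ c) => hl0 i
      simp only [Pi.zero_apply] at this ⊢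
      omega) hl0
    refine le_add_of_nonneg_right fun v => ?_
    have : 0 ≤ z v := hz0 v
    simpa [toQ] using this

section

variable {h₁ : Γ₁.H} {h₂ : Γ₂.H} (hs : Γ₁.sMin h₁ = pullback σ c (Γ₂.sMin h₂))
include hs

theorem latticeOf_c_new : (Γ₁.latticeOf h₁).c (σ none) = 0 := by
  have h := Γ₁.latticeOf_c h₁ (σ none)
  rw [hs, hb.pair_pullback_new] at h
  exact_mod_cast h

theorem latticeOf_c_old (i : V₂) : (Γ₁.latticeOf h₁).c (σ (some i)) = (Γ₂.latticeOf h₂).c i := by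
  have h := Γ₁.latticeOf_c h₁ (σ (some i))
  rw [hs, hb.pair_pullback_old, ← latticeOf_c] at h
  exact_mod_cast h

theorem f_pullback (l : V₂ → ℤ) :
    (Γ₁.latticeOf h₁).f (pullbackInt σ c l) = (Γ₂.latticeOf h₂).f l := by
  have h1 := Γ₁.two_twisted_X (Γ₁.latticeOf h₁).c (pullbackInt σ c l)
  have h2 := Γ₂.two_twisted_X (Γ₂.latticeOf h₂).c l
  rw [hb.twoX_pullback] at h1
  have h3 : (Γ₁.latticeOf h₁).X (pullbackInt σ c l) = (Γ₂.latticeOf h₂).X l := by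
    have h1' : 2 * (Γ₁.latticeOf h₁).X (pullbackInt σ c l) = Γ₂.twoX l := h1
    have h2' : 2 * (Γ₂.latticeOf h₂).X l = Γ₂.twoX l := h2
    omega
  unfold TwistedLattice.f
  rw [h3, sum_vertex σ, hb.latticeOf_c_new hs]
  simp only [pullbackInt_old, hb.latticeOf_c_old hs]
  ring

/-- Since `E_new² = -1` and the twist vanishes at the new vertex, antinefness there says that its
coordinate is at least the sum over the center. The least choice is equality, which is the pullback.
-/
theorem lift_eq_pullback (x : V₁ → ℤ) :
    (Γ₁.latticeOf h₁).lift {σ none} x = pullbackInt σ c fun i => x (σ (some i)) := by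
  set T := Γ₁.latticeOf h₁ with hT
  set l : V₂ → ℤ := fun i => x (σ (some i)) with hl
  have hN : ∀ y, T.N y (σ none) = Γ₁.deg y (σ none) := fun y => by
    have : T.N y (σ none) = Γ₁.deg y (σ none) + T.c (σ none) := rfl
    rw [this, hT, hb.latticeOf_c_new hs, add_zero]
  have hold : ∀ i, T.lift {σ none} x (σ (some i)) = l i := fun i =>
    TwistedLattice.lift_off (by simp)
  refine le_antisymm (TwistedLattice.lift_le (forall_vertex σ (fun h => ?_) fun i _ => ?_)
    fun a ha => ?_) (forall_vertex σ ?_ fun i => ?_)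
  · simp at h
  · rw [pullbackInt_old]
  · rw [Finset.mem_singleton.1 ha, hN, hb.deg_pullback_new]
  · have h := TwistedLattice.N_lift (T := T) (l := x) (Finset.mem_singleton_self (σ none))
    rw [hN, eq_pullbackInt_add σ c (T.lift {σ none} x), deg_add, hb.deg_pullback_new, deg_single,
      hb.g_new_new] at h
    simp only [hold] at h
    rw [pullbackInt_new]
    change ∑ i ∈ c, l i ≤ _
    omega
  · rw [hold, pullbackInt_old]

end

/-- Eliminating the new vertex, which is orthogonal to `ψ^*s`, leaves the reduced weight `χ_h(ψ^*l)
= χ_h(l)` and the filtration `(ψ^*s, ψ^*l) = (s, l)`, that is, the complex of `Γ₂`. -/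
theorem pageEquiv {h₁ : Γ₁.H} {h₂ : Γ₂.H} {x : V₂ → ℚ} (hx : x ∈ Γ₂.classSet h₂)
    (hx' : pullback σ c x ∈ Γ₁.classSet h₁) {s : V₂ → ℚ} (hs₂ : s ∈ Γ₂.lipmanCone)
    (hs₁ : pullback σ c s ∈ Γ₁.lipmanCone) (n : ℤ) :
    PageEquiv (Γ₁.filteredChains (pullback σ c s) h₁ n) (Γ₂.filteredChains s h₂ n) := by
  have hs := hb.sMin_eq hx hx'
  have hB : ∀ a, a ∈ ({σ none}ᶜ : Finset V₁) ↔ a ∉ ({σ none} : Finset V₁) := fun a => by simp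
  refine (Γ₁.pageEquiv_redFilteredChains hs₁ h₁ n {σ none} (hb.isRationalOn _)
    (fun a ha => by rw [Finset.mem_singleton.1 ha, hb.pair_pullback_new]) _ hB).trans ?_
  have hmem : ∀ i, σ (some i) ∈ ({σ none}ᶜ : Finset V₁) := fun i => by simp
  set τ : V₂ ≃ ↥({σ none}ᶜ : Finset V₁) := Equiv.ofBijective (fun i => ⟨σ (some i), hmem i⟩)
    ⟨fun i j hij => by simpa using hij, fun ⟨a, ha⟩ => by
      obtain ⟨o, rfl⟩ := σ.surjective a
      cases o with
      | none => simp at ha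
      | some i => exact ⟨i, rfl⟩⟩ with hτ
  refine (pageEquiv_reindex τ _ _ (Γ₂.antitone_pair hs₂) _ _ (fun l => ?_) (fun l => ?_) n).symm
  · have hl : ∀ i : ↥({σ none}ᶜ : Finset V₁), extendZero _ l (i : V₁) = l i := fun i => by
      simp only [extendZero, dif_pos i.2]
    rw [redWeight_eq Γ₁ hB h₁ l hl, hb.lift_eq_pullback hs, hb.f_pullback hs, chi_eq_f]
    congr 2
    funext i
    exact hl (τ i)
  · rw [pair_eq_sum, pair_eq_sum, sum_vertex σ, hb.pair_pullback_new, mul_zero, zero_add]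
    refine Finset.sum_congr rfl fun i _ => ?_
    rw [hb.pair_pullback_old]
    congr 1
    simp only [toQ, extendZero, dif_pos (hmem i)]
    rfl

end IsBlowUp

/-! ### Blow-up invariance and reduction to an SR-set -/

theorem DecoratedGraph.Equivalent.pageEquiv {T T' : DecoratedGraph} (h : T.Equivalent T') (n : ℤ) :
    FilteredComplex.PageEquiv (T.Γ.filteredChains T.s T.h n) (T'.Γ.filteredChains T'.s T'.h n) := by
  induction h with
  | rel T T' h =>
    obtain ⟨σ, c, hb, hs, x, hx, hx'⟩ := h
    have h1 := T.s_mem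
    rw [hs] at h1 ⊢
    exact hb.pageEquiv hx hx' T'.s_mem h1 n
  | refl T => exact .refl _
  | symm T T' _ ih => exact ih.symm
  | trans T T' T'' _ _ ih ih' => exact ih.trans ih'

theorem ResolutionGraph.pageEquiv_of_isSRSet {V : Type} [Fintype V] (Γ : ResolutionGraph V)
    {s : V → ℚ} (h : Γ.H) {B : Finset V} (hs : s ∈ Γ.lipmanCone) (hB : Γ.IsSRSet B)
    (hsB : Γ.supp s ⊆ (B : Set V)) (n : ℤ) :
    FilteredComplex.PageEquiv (Γ.filteredChains s h n) (Γ.redFilteredChains B s h n) := by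
  refine Γ.pageEquiv_redFilteredChains hs h n Bᶜ
    (Γ.isRationalOn_of_isSRSet (fun a ha => by simpa using ha) hB _) (fun a ha => ?_) B
    fun a => by simp
  refine le_antisymm (hs.2 a) (not_lt.1 fun hlt => ?_)
  rw [Finset.mem_compl] at ha
  exact ha (hsB hlt)

end FilteredLattice

end

theorem mainTheorem5 :
    (∀ T T' : FilteredLattice.DecoratedGraph, T.Equivalent T' → ∀ n : ℤ,
      Nonempty (FilteredLattice.SpectralSequenceIso
        (T.Γ.filteredChains T.s T.h n) (T'.Γ.filteredChains T'.s T'.h n))) ∧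
    (∀ (V : Type) [Fintype V] (Γ : FilteredLattice.ResolutionGraph V) (s : V → ℚ) (h : Γ.H)
      (B : Finset V), s ∈ Γ.lipmanCone → s ≠ 0 → Γ.IsSRSet B → Γ.supp s ⊆ (B : Set V) → ∀ n : ℤ,
      Nonempty (FilteredLattice.SpectralSequenceIso
        (Γ.filteredChains s h n) (Γ.redFilteredChains B s h n))) := by
  exact ⟨fun _ _ h n => (h.pageEquiv n).spectralSequenceIso,
    fun _ _ Γ _ h _ hs _ hB hsB n => (Γ.pageEquiv_of_isSRSet h hs hB hsB n).spectralSequenceIso⟩
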